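/- **Setting.** Let $\varphi:[0,\infty)\to[0,\infty)$ be an Orlicz function: convex, $\varphi(0)=0$, $\varphi(u)>0$ for $u>0$; put $\varphi(\infty)=\infty$. *Functions.* Let $0<\gamma\le\infty$, $I=[0,\gamma)$ with Lebesgue measure $m$, and let $L_0$ be the space of (classes of a.e. equal) real measurable functions on $I$. Let $w$ be a weight: positive and decreasing (i.e. non-increasing) on $(0,\gamma)$, with $W(t)=\int_0^t w<\infty$ for $0\le t<\gamma$, and with $\int_0^\infty w=\infty$ if $\gamma=\infty$. For $f\in L_0$ let $f^*(t)=\inf\{\lambda>0: m\{|f|>\lambda\}\le t\}$. For positive $v$ on $(0,\gamma)$ write $v\prec w$ if $\int_0^t v\le\int_0^t w$ for all $t<\gamma$. For a measurable $g:I\to[0,\infty]$ and $0\le a<b\le\gamma$ put $R(a,b)=\int_a^b g\big/\int_a^b w$, where for $b=\infty$ one reads $R(a,\infty)=\limsup_{t\to\infty}R(a,t)$. The interval $(a,b]$ is a level interval of $g$ if $R(a,t)\le R(a,b)$ for all $t\in(a,b]$; it is maximal if it is contained in no other level interval. Halperin's level function $g^0$ equals $R(a,b)\,w$ on each maximal level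 interval $(a,b)$ and equals $g$ off these intervals. Define $$P_{\varphi,w}(f)=\inf\Big\{\int_I\varphi\Big(\frac{f^*}{v}\Big)v:\ v>0\text{ decreasing},\ v\prec w\Big\},\qquad Q_{\varphi,w}(f)=\int_I\varphi\Big(\frac{(f^*)^0}{w}\Big)w,$$ $$\mathcal M_{\varphi,w}=\{f\in L_0:P_{\varphi,w}(kf)<\infty\text{ for some }k>0\},\qquad \|f\|_{\mathcal M_{\varphi,w}}=\inf\{\epsilon>0:P_{\varphi,w}(f/\epsilon)\le1\}.$$ *Sequences.* Let $\ell_0$ be the space of real sequences $x=(x(i))_{i\ge1}$ (with counting measure), and let now $w=(w(i))_{i\ge1}$ be a positive decreasing sequence with $\sum_i w(i)=\infty$. Put $x^*(i)=\inf\{\lambda>0:\#\{j:|x(j)|>\lambda\}<i\}$, and define $v\prec w$, level intervals $(a,b]$ (with integers $0\le a<b$, or $b=\infty$) and level sequences $x^0$ as above with sums in place of integrals. Define $\mathfrak p_{\varphi,w}(x)=\inf\{\sum_i\varphi(x^*(i)/v(i))v(i): v>0\text{ decreasing},\ v\prec w\}$, $\mathfrak q_{\varphi,w}(x)=\sum_i\varphi((x^*)^0(i)/w(i))w(i)$,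 and $\mathfrak m_{\varphi,w}$ with its norm from $\mathfrak p_{\varphi,w}$, as $\mathcal M_{\varphi,w}$ from $P_{\varphi,w}$. For $X=\mathcal M_{\varphi,w}$ or $X=\mathfrak m_{\varphi,w}$, let $X_a$ be the set of the $f\in X$ such that $\|f_n\|_X\downarrow0$ for every sequence of measurable $f_n\le|f|$ with $f_n\downarrow0$ a.e., and let $X_b$ be the closure in $X$ of the set of simple functions (measurable, finitely many values, support of finite measure). **Theorem.** For every Orlicz function $\varphi$, every $\gamma$ and every weight $w$ as above, $$(\mathcal M_{\varphi,w})_a=(\mathcal M_{\varphi,w})_b=\{f\in L_0:P_{\varphi,w}(kf)<\infty\ \text{for all }k>0\}=\{f\in L_0:Q_{\varphi,w}(kf)<\infty\ \text{for all }k>0\},$$ and for every weight sequence $w$ as above, $$(\mathfrak m_{\varphi,w})_a=(\mathfrak m_{\varphi,w})_b=\{x\in\ell_0:\mathfrak p_{\varphi,w}(kx)<\infty\ \text{for all }k>0\}=\{x\in\ell_0:\mathfrak q_{\varphi,w}(kx)<\infty\ \text{for all }k>0\}.$$ -/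

import Mathlib

open MeasureTheory Filter Topology Set
open scoped ENNReal

namespace OrliczLorentz

/-! ### Order-continuous part and closure of the simple functions

`L₀(Ω, μ)` is `Ω →ₘ[μ] ℝ`. A function space is given by its carrier `X ⊆ L₀` and its norm
`N : L₀ → [0, ∞]`, which is finite on `X`. -/

section Lattice

variable {Ω : Type*} [MeasurableSpace Ω] {μ : Measure Ω}

/-- `X_a`: those `f ∈ X` such that `‖fₙ‖ ↓ 0` for all measurable `fₙ ≤ |f|` with `fₙ ↓ 0` a.e. -/
def orderContinuousPart (X : Set (Ω →ₘ[μ] ℝ)) (N : (Ω →ₘ[μ] ℝ) → ℝ≥0∞) : Set (Ω →ₘ[μ] ℝ) :=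
  {f | f ∈ X ∧ ∀ g : ℕ → (Ω →ₘ[μ] ℝ), (∀ n, g n ≤ |f|) →
    (∀ᵐ x ∂μ, Antitone (fun n => g n x) ∧ Tendsto (fun n => g n x) atTop (𝓝 0)) →
    Antitone (fun n => N (g n)) ∧ Tendsto (fun n => N (g n)) atTop (𝓝 0)}

/-- A simple function: finitely many values, measurable, support of finite measure. -/
def IsSimple (s : Ω →ₘ[μ] ℝ) : Prop :=
  ∃ g : SimpleFunc Ω ℝ, ⇑s =ᵐ[μ] ⇑g ∧ μ (Function.support ⇑g) < ∞

/-- `X_b`: the closure in `X` of the set of simple functions, for the distance `N (f - s)`. -/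
def simpleClosure (X : Set (Ω →ₘ[μ] ℝ)) (N : (Ω →ₘ[μ] ℝ) → ℝ≥0∞) : Set (Ω →ₘ[μ] ℝ) :=
  {f | f ∈ X ∧ ∀ ε : ℝ≥0∞, 0 < ε → ∃ s : Ω →ₘ[μ] ℝ, IsSimple s ∧ s ∈ X ∧ N (f - s) < ε}

/-- The distribution function `d_f(r) = μ {|f| > r}`. -/
noncomputable def distribution (f : Ω →ₘ[μ] ℝ) (r : ℝ) : ℝ≥0∞ := μ {x | r < |f x|}

/-- The space `{f : ρ(k f) < ∞ for some k > 0}` attached to a modular `ρ`. -/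
def modularSpace (ρ : (Ω →ₘ[μ] ℝ) → ℝ≥0∞) : Set (Ω →ₘ[μ] ℝ) :=
  {f | ∃ k : ℝ, 0 < k ∧ ρ (k • f) < ∞}

/-- The set `{f : ρ(k f) < ∞ for all k > 0}` attached to a modular `ρ`. -/
def finiteElements (ρ : (Ω →ₘ[μ] ℝ) → ℝ≥0∞) : Set (Ω →ₘ[μ] ℝ) :=
  {f | ∀ k : ℝ, 0 < k → ρ (k • f) < ∞}

/-- The Luxemburg norm `inf {ε > 0 : ρ(f / ε) ≤ 1}` of a modular (`∞` if there is no such `ε`). -/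
noncomputable def luxemburg (ρ : (Ω →ₘ[μ] ℝ) → ℝ≥0∞) (f : Ω →ₘ[μ] ℝ) : ℝ≥0∞ :=
  ⨅ (ε : ℝ) (_ : 0 < ε ∧ ρ (ε⁻¹ • f) ≤ 1), ENNReal.ofReal ε

end Lattice

/-! ### Orlicz functions -/

/-- An Orlicz function: `φ : [0, ∞) → [0, ∞)` convex, `φ 0 = 0`, `φ u > 0` for `u > 0`
(only the values on `[0, ∞)` matter). -/
structure IsOrlicz (φ : ℝ → ℝ) : Prop where
  convex : ConvexOn ℝ (Ici 0) φ
  zero : φ 0 = 0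
  pos : ∀ u, 0 < u → 0 < φ u

/-- `φ` extended to `[0, ∞]` by `φ(∞) = ∞`. -/
noncomputable def extend (φ : ℝ → ℝ) (u : ℝ≥0∞) : ℝ≥0∞ :=
  if u = ∞ then ∞ else ENNReal.ofReal (φ u.toReal)

/-! ### Functions on `I = [0, γ)`, `0 < γ ≤ ∞` -/

section Functions

/-- The open interval of the positive reals `s` with `a < s < b`, `0 ≤ a ≤ b ≤ ∞`. -/
def seg (a b : ℝ≥0∞) : Set ℝ := {s | a < ENNReal.ofReal s ∧ ENNReal.ofReal s < b}

/-- Lebesgue measure on `I`; the null set `{0}` is left out of `I`, so that weights may be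
infinite at the origin. -/
noncomputable abbrev leb (γ : ℝ≥0∞) : Measure ℝ := volume.restrict (seg 0 γ)

/-- A weight on `I`: positive, decreasing, `W(t) = ∫₀ᵗ w < ∞` for `t < γ`, and `W(∞) = ∞` in case
`γ = ∞`. -/
structure IsWeight (γ : ℝ≥0∞) (w : ℝ → ℝ) : Prop where
  pos : ∀ t ∈ seg 0 γ, 0 < w t
  anti : AntitoneOn w (seg 0 γ)
  locInt : ∀ t : ℝ≥0∞, t < γ → ∫⁻ s in seg 0 t, ENNReal.ofReal (w s) < ∞
  total : γ = ∞ → ∫⁻ s in seg 0 ∞, ENNReal.ofReal (w s) = ∞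

/-- The decreasing rearrangement `f^*(t) = inf {r > 0 : d_f(r) ≤ t}` (possibly `∞`). -/
noncomputable def rearr {γ : ℝ≥0∞} (f : ℝ →ₘ[leb γ] ℝ) (t : ℝ) : ℝ≥0∞ :=
  ⨅ (r : ℝ) (_ : 0 < r ∧ distribution f r ≤ ENNReal.ofReal t), ENNReal.ofReal r

/-- `v` is positive and decreasing on `I`, and `v ≺ w`, i.e. `∫₀ᵗ v ≤ ∫₀ᵗ w` for all `t ∈ I`.
(Strict positivity gives `φ(f^*/v) v` a meaning. A nonnegative decreasing `v ≺ w` which vanishes from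
some point on can be made larger there without leaving this class, and `φ(x/v) v` decreases in `v`, so
the infimum defining `P` is not affected.) -/
structure IsAdmissible (γ : ℝ≥0∞) (w v : ℝ → ℝ) : Prop where
  pos : ∀ t ∈ seg 0 γ, 0 < v t
  anti : AntitoneOn v (seg 0 γ)
  submaj : ∀ t : ℝ≥0∞, t < γ →
    ∫⁻ s in seg 0 t, ENNReal.ofReal (v s) ≤ ∫⁻ s in seg 0 t, ENNReal.ofReal (w s)

/-- `P_{φ,w}(f) = inf {∫_I φ(f^*/v) v : v ≺ w, v ↓}`. -/
noncomputable def modP (φ : ℝ → ℝ) (γ : ℝ≥0∞) (w : ℝ → ℝ) (f : ℝ →ₘ[leb γ] ℝ) : ℝ≥0∞ :=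
  ⨅ (v : ℝ → ℝ) (_ : IsAdmissible γ w v),
    ∫⁻ t in seg 0 γ, extend φ (rearr f t / ENNReal.ofReal (v t)) * ENNReal.ofReal (v t)

/-- `F(a, b) / W(a, b)`, with `F(a, b) = ∫_a^b f` and `W(a, b) = ∫_a^b w`. -/
noncomputable def quot (f : ℝ → ℝ≥0∞) (w : ℝ → ℝ) (a b : ℝ≥0∞) : ℝ≥0∞ :=
  (∫⁻ s in seg a b, f s) / ∫⁻ s in seg a b, ENNReal.ofReal (w s)

/-- `F(a, b) / W(a, b)`, read as `limsup_{t → ∞} F(a, t) / W(a, t)` if `b = ∞`. -/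
noncomputable def ratio (f : ℝ → ℝ≥0∞) (w : ℝ → ℝ) (a b : ℝ≥0∞) : ℝ≥0∞ :=
  if b = ∞ then limsup (fun t : ℝ => quot f w a (ENNReal.ofReal t)) atTop else quot f w a b

/-- `(a, b]` is a level interval of `f`. -/
def IsLevel (γ : ℝ≥0∞) (f : ℝ → ℝ≥0∞) (w : ℝ → ℝ) (a b : ℝ≥0∞) : Prop :=
  a < b ∧ b ≤ γ ∧ ∀ t, a < t → t ≤ b → ratio f w a t ≤ ratio f w a b

/-- `(a, b]` is a maximal level interval of `f`. -/
def IsMaxLevel (γ : ℝ≥0∞) (f : ℝ → ℝ≥0∞) (w : ℝ → ℝ) (a b : ℝ≥0∞) : Prop :=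
  IsLevel γ f w a b ∧ ∀ c d, IsLevel γ f w c d → c ≤ a → b ≤ d → c = a ∧ d = b

open Classical in
/-- Halperin's level function `f⁰`: it is `F(a, b) / W(a, b) * w` on each maximal level interval
`(a, b)`, and `f` outside of them. (Distinct maximal level intervals do not overlap, so the supremum
has only one term.) -/
noncomputable def levelFun (γ : ℝ≥0∞) (f : ℝ → ℝ≥0∞) (w : ℝ → ℝ) (t : ℝ) : ℝ≥0∞ :=
  if ∃ a b, IsMaxLevel γ f w a b ∧ t ∈ seg a b then
    ⨆ (a : ℝ≥0∞) (b : ℝ≥0∞) (_ : IsMaxLevel γ f w a b ∧ t ∈ seg a b),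
      ratio f w a b * ENNReal.ofReal (w t)
  else f t

/-- `Q_{φ,w}(f) = ∫_I φ((f^*)⁰ / w) w`. -/
noncomputable def modQ (φ : ℝ → ℝ) (γ : ℝ≥0∞) (w : ℝ → ℝ) (f : ℝ →ₘ[leb γ] ℝ) : ℝ≥0∞ :=
  ∫⁻ t in seg 0 γ,
    extend φ (levelFun γ (rearr f) w t / ENNReal.ofReal (w t)) * ENNReal.ofReal (w t)

/-- The space `M_{φ,w}`. -/
def spaceM (φ : ℝ → ℝ) (γ : ℝ≥0∞) (w : ℝ → ℝ) : Set (ℝ →ₘ[leb γ] ℝ) :=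
  modularSpace (modP φ γ w)

/-- The Luxemburg norm of `M_{φ,w}`. -/
noncomputable def normM (φ : ℝ → ℝ) (γ : ℝ≥0∞) (w : ℝ → ℝ) : (ℝ →ₘ[leb γ] ℝ) → ℝ≥0∞ :=
  luxemburg (modP φ γ w)

end Functions

/-! ### Sequences

The index `j : ℕ` stands for the term with number `i = j + 1`. The set of indices `a ≤ j < b` is thus
the set of the numbers `i ∈ (a, b]`. -/

section Sequences

/-- A weight sequence: positive, decreasing, with divergent sum. -/
structure IsSeqWeight (w : ℕ → ℝ) : Prop where
  pos : ∀ j, 0 < w j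
  anti : Antitone w
  total : ∑' j, ENNReal.ofReal (w j) = ∞

/-- The decreasing rearrangement `x^*(i) = inf {r > 0 : d_x(r) < i}`, `i = j + 1`. -/
noncomputable def seqRearr (x : ℕ →ₘ[Measure.count] ℝ) (j : ℕ) : ℝ≥0∞ :=
  ⨅ (r : ℝ) (_ : 0 < r ∧ distribution x r < (j : ℝ≥0∞) + 1), ENNReal.ofReal r

/-- `v` is positive and decreasing, and `v ≺ w`. -/
structure IsSeqAdmissible (w v : ℕ → ℝ) : Prop where
  pos : ∀ j, 0 < v j
  anti : Antitone v
  submaj : ∀ n, ∑ j ∈ Finset.range n, v j ≤ ∑ j ∈ Finset.range n, w j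

/-- `p_{φ,w}(x) = inf {∑ φ(x^*(i)/v(i)) v(i) : v ≺ w, v ↓}`. -/
noncomputable def seqModP (φ : ℝ → ℝ) (w : ℕ → ℝ) (x : ℕ →ₘ[Measure.count] ℝ) : ℝ≥0∞ :=
  ⨅ (v : ℕ → ℝ) (_ : IsSeqAdmissible w v),
    ∑' j, extend φ (seqRearr x j / ENNReal.ofReal (v j)) * ENNReal.ofReal (v j)

/-- `(∑_{a < i ≤ b} x(i)) / (∑_{a < i ≤ b} w(i))`. -/
noncomputable def seqQuot (x : ℕ → ℝ≥0∞) (w : ℕ → ℝ) (a b : ℕ) : ℝ≥0∞ :=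
  (∑ j ∈ Finset.Ico a b, x j) / ∑ j ∈ Finset.Ico a b, ENNReal.ofReal (w j)

/-- The same for `b ≤ ∞`, with the limit superior if `b = ∞`. -/
noncomputable def seqRatio (x : ℕ → ℝ≥0∞) (w : ℕ → ℝ) (a : ℕ) (b : ℕ∞) : ℝ≥0∞ :=
  if b = ⊤ then limsup (fun n : ℕ => seqQuot x w a n) atTop else seqQuot x w a b.toNat

/-- `(a, b]` is a level interval of the sequence `x`. -/
def IsSeqLevel (x : ℕ → ℝ≥0∞) (w : ℕ → ℝ) (a : ℕ) (b : ℕ∞) : Prop :=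
  (a : ℕ∞) < b ∧ ∀ t : ℕ∞, (a : ℕ∞) < t → t ≤ b → seqRatio x w a t ≤ seqRatio x w a b

/-- `(a, b]` is a maximal level interval of the sequence `x`. -/
def IsSeqMaxLevel (x : ℕ → ℝ≥0∞) (w : ℕ → ℝ) (a : ℕ) (b : ℕ∞) : Prop :=
  IsSeqLevel x w a b ∧ ∀ (c : ℕ) (d : ℕ∞), IsSeqLevel x w c d → c ≤ a → b ≤ d → c = a ∧ d = b

open Classical in
/-- The level sequence `x⁰`. -/
noncomputable def levelSeq (x : ℕ → ℝ≥0∞) (w : ℕ → ℝ) (j : ℕ) : ℝ≥0∞ :=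
  if ∃ (a : ℕ) (b : ℕ∞), IsSeqMaxLevel x w a b ∧ a ≤ j ∧ (j : ℕ∞) < b then
    ⨆ (a : ℕ) (b : ℕ∞) (_ : IsSeqMaxLevel x w a b ∧ a ≤ j ∧ (j : ℕ∞) < b),
      seqRatio x w a b * ENNReal.ofReal (w j)
  else x j

/-- `q_{φ,w}(x) = ∑ φ((x^*)⁰(i) / w(i)) w(i)`. -/
noncomputable def seqModQ (φ : ℝ → ℝ) (w : ℕ → ℝ) (x : ℕ →ₘ[Measure.count] ℝ) : ℝ≥0∞ :=
  ∑' j, extend φ (levelSeq (seqRearr x) w j / ENNReal.ofReal (w j)) * ENNReal.ofReal (w j)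

/-- The space `m_{φ,w}`. -/
def seqSpaceM (φ : ℝ → ℝ) (w : ℕ → ℝ) : Set (ℕ →ₘ[Measure.count] ℝ) :=
  modularSpace (seqModP φ w)

/-- The Luxemburg norm of `m_{φ,w}`. -/
noncomputable def seqNormM (φ : ℝ → ℝ) (w : ℕ → ℝ) : (ℕ →ₘ[Measure.count] ℝ) → ℝ≥0∞ :=
  luxemburg (seqModP φ w)

end Sequences

end OrliczLorentz

/-!
Two facts make up the theorem.

*The order-continuous part and the closure of the simple functions are the finite elements of `P`.*
The modular `P` is an infimum over weights `v` of integrals of `φ(f^* / v) v`, and all that matters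
about these is collected in `IsFrame`, so that functions and sequences are treated at once.
If `P(k f) < ∞` for all `k` and `fₙ ↓ 0` below `|f|`, then the distribution function of `f` is
finite, hence `fₙ^* ↓ 0` pointwise, and dominated convergence, with a weight depending only on `k`,
gives `P(k fₙ) → 0` for all `k` (`finiteElements_subset_orderContinuousPart`). Truncation shows that
order continuous elements are limits of simple functions
(`orderContinuousPart_subset_simpleClosure`). Finally `(f + g)^*(2 s) ≤ f^*(s) + g^*(s)`, together
with the dilated weights `t ↦ v (t / 2) / 4 + v' (t / 2) / 4`, is a substitute for convexity of `P`,
and simple functions are finite elements (`simpleClosure_subset_finiteElements`).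

*`P` and `Q` are comparable up to a dilation of the argument by `4`:* `Q(f) ≤ P(4 f)` and
`P(f) ≤ Q(4 f)`, so that their finite elements agree. Let `F` and `W` be the primitives of
`f^*` and `w`. The level function `(f^*)⁰` is `w` times the slope of the least `W`-concave majorant
of `F`; the line of slope `ρ` touches it at the maximizers of `F - ρ W` (`argmax`), and the interval
between the extreme maximizers is a maximal level interval. Hence `(f^*)⁰ ≥ μ w` to the left, and
`(f^*)⁰ ≤ μ w` to the right of a maximizer for the slope `μ` (`le_levelFun`, `levelFun_le`,
`le_levelSeq`, `levelSeq_le`). Only the maximizers `aₙ` for the dyadic slopes `2ⁿ` are used then.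
Between two of them `F` increases at least by `2ⁿ` times the increase of `W`, so that an integrated
Young inequality on each interval and summation by parts, where `v ≺ w` enters, give
`Q(f) ≤ P(4 f)` (`lintegral_slope_le`). Conversely, the weight `v` that equals
`max w (f^* / 2ⁿ⁺¹) / 2` between `aₙ₊₁` and `aₙ` is decreasing and `≺ w`, and shows that
`P(f) ≤ Q(4 f)` (`exists_weight`).

All this requires that `F - ρ W` attains its maximum for every `ρ > 0`, i.e. that `F / W → 0` if the
domain is unbounded. Otherwise `P` is infinite by the Young inequality (`isCoercive_of_weight`), and
`Q` is infinite since then `(f^*)⁰ ≥ L w` far out for some `L > 0` while `W(∞) = ∞`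
(`isCoercive_of_levelFun`, `isCoercive_of_levelSeq`).
-/

namespace OrliczLorentz

/-! ### Orlicz functions and their perspectives -/

section Orlicz

variable {φ : ℝ → ℝ}

theorem IsOrlicz.nonneg (hφ : IsOrlicz φ) {u : ℝ} (hu : 0 ≤ u) : 0 ≤ φ u := by
  rcases hu.eq_or_lt with rfl | h
  · exact hφ.zero.ge
  · exact (hφ.pos u h).le

theorem IsOrlicz.smul_le (hφ : IsOrlicz φ) {c u : ℝ} (hc : 0 ≤ c) (hc1 : c ≤ 1) (hu : 0 ≤ u) :
    φ (c * u) ≤ c * φ u := by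
  have h := hφ.convex.2 (x := u) (y := 0) hu (by simp) hc (sub_nonneg.2 hc1) (by ring)
  simpa [hφ.zero] using h

theorem IsOrlicz.mono (hφ : IsOrlicz φ) {u u' : ℝ} (hu : 0 ≤ u) (h : u ≤ u') : φ u ≤ φ u' := by
  rcases hu.eq_or_lt with rfl | hu0
  · rw [hφ.zero]; exact hφ.nonneg h
  have hu' : 0 < u' := hu0.trans_le h
  have h1 := hφ.smul_le (c := u / u') (u := u') (by positivity) ((div_le_one hu').2 h) hu'.le
  rw [div_mul_cancel₀ _ hu'.ne'] at h1
  exact h1.trans (mul_le_of_le_one_left (hφ.nonneg hu'.le) ((div_le_one hu').2 h))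

theorem IsOrlicz.slope_mono (hφ : IsOrlicz φ) {u u' : ℝ} (hu : 0 < u) (h : u ≤ u') :
    φ u / u ≤ φ u' / u' := by
  have hu' : 0 < u' := hu.trans_le h
  have h1 := hφ.smul_le (c := u / u') (u := u') (by positivity) ((div_le_one hu').2 h) hu'.le
  rw [div_mul_cancel₀ _ hu'.ne'] at h1
  rw [div_le_iff₀ hu]
  calc φ u ≤ u / u' * φ u' := h1
    _ = φ u' / u' * u := by ring

theorem extend_top : extend φ ∞ = ∞ := by simp [extend]

theorem extend_ofReal {u : ℝ} (hu : 0 ≤ u) :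
    extend φ (ENNReal.ofReal u) = ENNReal.ofReal (φ u) := by
  simp [extend, ENNReal.toReal_ofReal hu]

theorem extend_zero (hφ : IsOrlicz φ) : extend φ 0 = 0 := by
  simp [extend, hφ.zero]

theorem extend_mono (hφ : IsOrlicz φ) : Monotone (extend φ) := by
  intro a b hab
  unfold extend
  by_cases hb : b = ∞
  · simp [hb]
  · have ha : a ≠ ∞ := ne_top_of_le_ne_top hb hab
    simp only [ha, hb, if_false]
    exact ENNReal.ofReal_le_ofReal (hφ.mono ENNReal.toReal_nonneg (ENNReal.toReal_mono hb hab))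

theorem extend_measurable (hφ : IsOrlicz φ) : Measurable (extend φ) :=
  (extend_mono hφ).measurable

theorem extend_tendsto_zero (hφ : IsOrlicz φ) : Tendsto (extend φ) (𝓝 0) (𝓝 0) := by
  have hle : ∀ u : ℝ≥0∞, u ≤ 1 → extend φ u ≤ u * ENNReal.ofReal (φ 1) := by
    intro u hu
    have hu' : u ≠ ∞ := ne_top_of_le_ne_top ENNReal.one_ne_top hu
    have h1 : u.toReal ≤ 1 := by
      simpa using ENNReal.toReal_mono ENNReal.one_ne_top hu
    have h2 := hφ.smul_le (u := 1) ENNReal.toReal_nonneg h1 zero_le_one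
    rw [mul_one] at h2
    simp only [extend, hu', if_false]
    calc ENNReal.ofReal (φ u.toReal) ≤ ENNReal.ofReal (u.toReal * φ 1) :=
          ENNReal.ofReal_le_ofReal h2
      _ = u * ENNReal.ofReal (φ 1) := by
          rw [ENNReal.ofReal_mul ENNReal.toReal_nonneg, ENNReal.ofReal_toReal hu']
  have ht : Tendsto (fun u : ℝ≥0∞ => u * ENNReal.ofReal (φ 1)) (𝓝 0) (𝓝 0) := by
    have := ENNReal.Tendsto.mul_const (b := ENNReal.ofReal (φ 1)) (tendsto_id (x := 𝓝 (0 : ℝ≥0∞)))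
      (Or.inr ENNReal.ofReal_ne_top)
    simpa using this
  refine tendsto_of_tendsto_of_tendsto_of_le_of_le' tendsto_const_nhds ht
    (Eventually.of_forall fun _ => zero_le) ?_
  filter_upwards [Iic_mem_nhds (zero_lt_one (α := ℝ≥0∞))] with u hu using hle u hu

/-- The perspective `(x, v) ↦ φ(x / v) v` of `φ`, the integrand of the modulars. -/
noncomputable def persp (φ : ℝ → ℝ) (x : ℝ≥0∞) (v : ℝ) : ℝ≥0∞ :=
  extend φ (x / ENNReal.ofReal v) * ENNReal.ofReal v

theorem persp_mono_left (hφ : IsOrlicz φ) {x y : ℝ≥0∞} (h : x ≤ y) (v : ℝ) :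
    persp φ x v ≤ persp φ y v :=
  mul_le_mul_left (extend_mono hφ (ENNReal.div_le_div_right h _)) _

theorem persp_zero (hφ : IsOrlicz φ) (v : ℝ) : persp φ 0 v = 0 := by
  simp [persp, extend_zero hφ]

theorem persp_top {v : ℝ} (hv : 0 < v) : persp φ ∞ v = ∞ := by
  have : ENNReal.ofReal v ≠ 0 := by simpa using hv
  simp [persp, ENNReal.top_div_of_ne_top ENNReal.ofReal_ne_top, extend_top, this]

theorem persp_ofReal (hφ : IsOrlicz φ) {x v : ℝ} (hx : 0 ≤ x) (hv : 0 < v) :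
    persp φ (ENNReal.ofReal x) v = ENNReal.ofReal (φ (x / v) * v) := by
  rw [persp, ← ENNReal.ofReal_div_of_pos hv, extend_ofReal (by positivity),
    ENNReal.ofReal_mul (hφ.nonneg (by positivity))]

/-- The perspective of a convex function is jointly subadditive. -/
theorem persp_add_le (hφ : IsOrlicz φ) (x y : ℝ≥0∞) {v v' : ℝ} (hv : 0 < v) (hv' : 0 < v') :
    persp φ (x + y) (v + v') ≤ persp φ x v + persp φ y v' := by
  by_cases hx : x = ∞
  · simp [hx, persp_top hv]
  by_cases hy : y = ∞
  · simp [hy, persp_top hv']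
  lift x to NNReal using hx
  lift y to NNReal using hy
  rw [← ENNReal.ofReal_coe_nnreal, ← ENNReal.ofReal_coe_nnreal,
    ← ENNReal.ofReal_add x.coe_nonneg y.coe_nonneg, persp_ofReal hφ (by positivity) (by positivity),
    persp_ofReal hφ x.coe_nonneg hv, persp_ofReal hφ y.coe_nonneg hv',
    ← ENNReal.ofReal_add (mul_nonneg (hφ.nonneg (div_nonneg x.coe_nonneg hv.le)) hv.le)
      (mul_nonneg (hφ.nonneg (div_nonneg y.coe_nonneg hv'.le)) hv'.le)]
  apply ENNReal.ofReal_le_ofReal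
  have h := hφ.convex.2 (show (x : ℝ) / v ∈ Ici 0 from div_nonneg x.coe_nonneg hv.le)
    (show (y : ℝ) / v' ∈ Ici 0 from div_nonneg y.coe_nonneg hv'.le)
    (show 0 ≤ v / (v + v') by positivity) (show 0 ≤ v' / (v + v') by positivity) (by field_simp)
  have e : (v / (v + v')) • ((x : ℝ) / v) + (v' / (v + v')) • ((y : ℝ) / v')
      = ((x : ℝ) + y) / (v + v') := by
    simp only [smul_eq_mul]; field_simp
  rw [e] at h
  calc φ (((x : ℝ) + y) / (v + v')) * (v + v')
      ≤ ((v / (v + v')) • φ (x / v) + (v' / (v + v')) • φ (y / v')) * (v + v') := by gcongr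
    _ = φ (x / v) * v + φ (y / v') * v' := by simp only [smul_eq_mul]; field_simp

/-- `φ(x / v) v` decreases in `v`. -/
theorem persp_anti_right (hφ : IsOrlicz φ) (x : ℝ≥0∞) {v v' : ℝ} (hv : 0 < v) (h : v ≤ v') :
    persp φ x v' ≤ persp φ x v := by
  rcases h.eq_or_lt with rfl | h
  · exact le_rfl
  have := persp_add_le hφ x 0 hv (sub_pos.2 h)
  simpa [persp_zero hφ] using this

theorem persp_div_le (x : ℝ≥0∞) {v : ℝ} (hv : 0 < v) :
    persp φ x (v / 4) ≤ persp φ (4 * x) v := by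
  have e : x / ENNReal.ofReal (v / 4) = 4 * x / ENNReal.ofReal v := by
    rw [ENNReal.ofReal_div_of_pos (by norm_num), div_eq_mul_inv, div_eq_mul_inv (4 * x),
      ENNReal.inv_div (Or.inl ENNReal.ofReal_ne_top)
        (Or.inl (by norm_num)), div_eq_mul_inv]
    norm_num
    ring
  unfold persp
  rw [e]
  gcongr
  linarith

/-- A rough Young inequality, with the slope `φ l / l` in place of a derivative: if `4 x / v ≤ l`,
the left side is at most `φ l v`, otherwise the slope at `l` is at most that at `4 x / v`. -/
theorem young (hφ : IsOrlicz φ) (x : ℝ≥0∞) {v l : ℝ} (hv : 0 < v) (hl : 0 < l) :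
    ENNReal.ofReal (4 * φ l / l) * x ≤ persp φ (4 * x) v + ENNReal.ofReal (φ l * v) := by
  by_cases hx : x = ∞
  · simp [hx, ENNReal.mul_top, persp_top hv]
  lift x to NNReal using hx
  have hφl := hφ.pos l hl
  rw [show (4 : ℝ≥0∞) * (x : ℝ≥0∞) = ENNReal.ofReal (4 * x) by
      rw [ENNReal.ofReal_mul (by norm_num)]; simp,
    persp_ofReal hφ (by positivity) hv, ← ENNReal.ofReal_coe_nnreal,
    ← ENNReal.ofReal_mul (by positivity), ← ENNReal.ofReal_add
      (mul_nonneg (hφ.nonneg (by positivity)) hv.le) (by positivity)]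
  apply ENNReal.ofReal_le_ofReal
  have hnn : 0 ≤ φ (4 * x / v) * v := mul_nonneg (hφ.nonneg (by positivity)) hv.le
  rcases le_total (4 * x / v) l with h | h
  · have : 4 * φ l / l * x ≤ φ l * v := by
      rw [div_le_iff₀ hv] at h
      calc 4 * φ l / l * x = φ l / l * (4 * x) := by ring
        _ ≤ φ l / l * (l * v) := by gcongr
        _ = φ l * v := by field_simp
    linarith
  · have h1 := hφ.slope_mono hl h
    have h0 : 0 < 4 * (x : ℝ) / v := hl.trans_le h
    have : 4 * φ l / l * x ≤ φ (4 * x / v) * v := by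
      calc 4 * φ l / l * x = φ l / l * (4 * x / v) * v := by field_simp
        _ ≤ φ (4 * x / v) / (4 * x / v) * (4 * x / v) * v := by gcongr
        _ = φ (4 * x / v) * v := by rw [div_mul_cancel₀ _ h0.ne']
    have : 0 ≤ φ l * v := by positivity
    linarith

end Orlicz

/-! ### Decreasing rearrangements -/

section Rearrangement

variable {Ω : Type*} [MeasurableSpace Ω] {μ : Measure Ω}

/-- The decreasing rearrangement at the level `s ∈ [0, ∞]`, for an arbitrary measure. Both `rearr`
and `seqRearr` are instances of it. -/
noncomputable def rearrAt (f : Ω →ₘ[μ] ℝ) (s : ℝ≥0∞) : ℝ≥0∞ :=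
  ⨅ (r : ℝ) (_ : 0 < r ∧ distribution f r ≤ s), ENNReal.ofReal r

theorem rearrAt_le {f : Ω →ₘ[μ] ℝ} {s : ℝ≥0∞} {r : ℝ} (hr : 0 < r) (h : distribution f r ≤ s) :
    rearrAt f s ≤ ENNReal.ofReal r :=
  iInf₂_le r ⟨hr, h⟩

theorem distribution_mono {f g : Ω →ₘ[μ] ℝ} (h : ∀ᵐ x ∂μ, |g x| ≤ |f x|) (r : ℝ) :
    distribution g r ≤ distribution f r := by
  apply measure_mono_ae
  filter_upwards [h] with x hx hr
  exact lt_of_lt_of_le hr hx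

theorem distribution_anti (f : Ω →ₘ[μ] ℝ) {r r' : ℝ} (h : r ≤ r') :
    distribution f r' ≤ distribution f r :=
  measure_mono fun _ hx => lt_of_le_of_lt h hx

theorem rearrAt_mono {f g : Ω →ₘ[μ] ℝ} (h : ∀ᵐ x ∂μ, |g x| ≤ |f x|) (s : ℝ≥0∞) :
    rearrAt g s ≤ rearrAt f s :=
  le_iInf₂ fun _ hr => rearrAt_le hr.1 ((distribution_mono h _).trans hr.2)

theorem rearrAt_anti (f : Ω →ₘ[μ] ℝ) : Antitone (rearrAt f) := fun _ _ hs =>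
  le_iInf₂ fun _ hr => rearrAt_le hr.1 (hr.2.trans hs)

theorem rearrAt_smul_le (f : Ω →ₘ[μ] ℝ) {k : ℝ} (hk : 0 < k) (s : ℝ≥0∞) :
    rearrAt (k • f) s ≤ ENNReal.ofReal k * rearrAt f s := by
  have hk0 : ENNReal.ofReal k ≠ 0 := by simpa using hk
  rw [rearrAt.eq_def f, ENNReal.mul_iInf_of_ne hk0 ENNReal.ofReal_ne_top]
  refine le_iInf fun r => ?_
  rw [ENNReal.mul_iInf_of_ne hk0 ENNReal.ofReal_ne_top]
  refine le_iInf fun hr => ?_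
  rw [← ENNReal.ofReal_mul hk.le]
  refine rearrAt_le (mul_pos hk hr.1) (le_trans ?_ hr.2)
  apply measure_mono_ae
  filter_upwards [AEEqFun.coeFn_smul k f] with x hx h
  have h' : k * r < |(k • f) x| := h
  rw [hx, Pi.smul_apply, smul_eq_mul, abs_mul, abs_of_pos hk] at h'
  exact lt_of_mul_lt_mul_left h' hk.le

theorem rearrAt_smul (f : Ω →ₘ[μ] ℝ) {k : ℝ} (hk : 0 < k) (s : ℝ≥0∞) :
    rearrAt (k • f) s = ENNReal.ofReal k * rearrAt f s := by
  refine le_antisymm (rearrAt_smul_le f hk s) ?_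
  have h := rearrAt_smul_le (k • f) (inv_pos.2 hk) s
  rw [smul_smul, inv_mul_cancel₀ hk.ne', one_smul] at h
  calc ENNReal.ofReal k * rearrAt f s
      ≤ ENNReal.ofReal k * (ENNReal.ofReal k⁻¹ * rearrAt (k • f) s) := by gcongr
    _ = rearrAt (k • f) s := by
      rw [← mul_assoc, ← ENNReal.ofReal_mul hk.le, mul_inv_cancel₀ hk.ne']; simp

theorem rearrAt_add_le (f g : Ω →ₘ[μ] ℝ) {s₁ s₂ s : ℝ≥0∞} (hs : s₁ + s₂ ≤ s) :
    rearrAt (f + g) s ≤ rearrAt f s₁ + rearrAt g s₂ := by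
  rw [rearrAt.eq_def f, rearrAt.eq_def g]
  simp_rw [ENNReal.iInf_add, ENNReal.add_iInf]
  refine le_iInf fun r => le_iInf fun hr => le_iInf fun r' => le_iInf fun hr' => ?_
  rw [← ENNReal.ofReal_add hr.1.le hr'.1.le]
  refine rearrAt_le (add_pos hr.1 hr'.1) (le_trans ?_ hs)
  refine le_trans ?_ (add_le_add hr.2 hr'.2)
  refine le_trans (measure_mono_ae ?_) (measure_union_le _ _)
  filter_upwards [AEEqFun.coeFn_add f g] with x hx h
  have h' : r + r' < |(f + g) x| := h
  rw [hx, Pi.add_apply] at h'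
  have := abs_add_le (f x) (g x)
  by_contra hcon
  have hcon' : ¬ (r < |f x| ∨ r' < |g x|) := hcon
  push Not at hcon'
  linarith [hcon'.1, hcon'.2]

/-- If `f` has finite distribution function, and `|gₙ| ≤ |f|` tends to `0` a.e., then so does the
distribution function of `gₙ`. -/
theorem distribution_tendsto_zero {f : Ω →ₘ[μ] ℝ} {g : ℕ → (Ω →ₘ[μ] ℝ)}
    (hgf : ∀ n, ∀ᵐ x ∂μ, |g n x| ≤ |f x|)
    (hg : ∀ᵐ x ∂μ, Tendsto (fun n => g n x) atTop (𝓝 0)) {r : ℝ} (hr : 0 < r)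
    (hfin : distribution f r ≠ ∞) :
    Tendsto (fun n => distribution (g n) r) atTop (𝓝 0) := by
  have hm : ∀ h : Ω →ₘ[μ] ℝ, MeasurableSet {x | r < |h x|} := fun h =>
    measurableSet_lt measurable_const h.measurable.abs
  have key := tendsto_measure_of_ae_tendsto_indicator (μ := μ) (A := ∅) (L := atTop)
    (As := fun n => {x | r < |g n x|} ∩ {x | r < |f x|}) MeasurableSet.empty
    (fun n => (hm _).inter (hm _)) (hm f) hfin
    (Eventually.of_forall fun n => inter_subset_right) ?_
  · rw [measure_empty] at key
    refine key.congr fun n => measure_congr ?_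
    filter_upwards [hgf n] with x hx
    apply propext
    exact ⟨fun h => h.1, fun h => ⟨h, lt_of_lt_of_le h hx⟩⟩
  · filter_upwards [hg] with x hx
    have h2 := (hx.abs.eventually (gt_mem_nhds (by simpa using hr)))
    filter_upwards [h2] with n hn
    simp only [mem_inter_iff, mem_ofPred_eq, mem_empty_iff_false, iff_false, not_and]
    exact fun h => absurd h (not_lt.2 hn.le)

end Rearrangement

/-! ### The modular of a class of weights, and its order-continuous part -/

section Modular

variable {T : Type*} [MeasurableSpace T] {ν : Measure T}

/-- The modular `f ↦ inf {∫ φ(f^* / v) v : v ∈ A}`, with `f^*` at the point `t` of the measure space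
read off at the level `τ t`. -/
noncomputable def genMod (φ : ℝ → ℝ) (τ : T → ℝ≥0∞) (A : Set (T → ℝ)) (f : T →ₘ[ν] ℝ) : ℝ≥0∞ :=
  ⨅ (v : T → ℝ) (_ : v ∈ A), ∫⁻ t, persp φ (rearrAt f (τ t)) (v t) ∂ν

/-- What the class `A` of weights must satisfy for the modular `genMod` to behave as `P_{φ,w}`
does. The map `δ` halves the level (`t ↦ t / 2`, or `j ↦ ⌊j / 2⌋`).
By `small`, distribution functions that tend to `0` are eventually at most `τ t`, even if `τ t = 0`
(the first index of a sequence). By `bdd` a weight is bounded on a set of infinite measure if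
`ν` is infinite, which forces `f^*(∞) = 0`; `low` and `fin` make the modular finite for bounded
functions with a support of measure `m`. -/
structure IsFrame (ν : Measure T) (τ : T → ℝ≥0∞) (δ : T → T) (D : Set T) (A : Set (T → ℝ)) :
    Prop where
  ae_mem : ∀ᵐ t ∂ν, t ∈ D
  pos : ∀ v ∈ A, ∀ t ∈ D, 0 < v t
  meas : ∀ v ∈ A, AEMeasurable v ν
  measτ : Measurable τ
  ne_top : ∀ t, τ t ≠ ∞
  small : ∀ᵐ t ∂ν, ∃ η : ℝ≥0∞, 0 < η ∧ ∀ S, ν S < η → ν S ≤ τ t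
  bdd : ν univ = ∞ → ∀ v ∈ A, ∃ M : ℝ, 0 < M ∧ ν {t | v t ≤ M} = ∞
  half_mem : ∀ t ∈ D, δ t ∈ D
  half_level : ∀ t, τ (δ t) + τ (δ t) ≤ τ t
  half_lintegral : ∀ g : T → ℝ≥0∞, ∫⁻ t, g (δ t) ∂ν ≤ 2 * ∫⁻ t, g t ∂ν
  half_weight : ∀ v ∈ A, ∀ v' ∈ A, (fun t => v (δ t) / 4 + v' (δ t) / 4) ∈ A
  low : ∀ m : ℝ≥0∞, m ≠ ∞ → m ≤ ν univ → ∃ v ∈ A, ∃ c : ℝ, 0 < c ∧ ∀ᵐ t ∂ν, τ t < m → c ≤ v t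
  fin : ∀ m : ℝ≥0∞, m ≠ ∞ → ν {t | τ t < m} ≠ ∞

variable {φ : ℝ → ℝ} {τ : T → ℝ≥0∞} {δ : T → T} {D : Set T} {A : Set (T → ℝ)}

theorem genMod_mono (hφ : IsOrlicz φ) {f g : T →ₘ[ν] ℝ} (h : ∀ᵐ x ∂ν, |g x| ≤ |f x|) :
    genMod φ τ A g ≤ genMod φ τ A f :=
  iInf₂_mono fun _ _ => lintegral_mono fun _ => persp_mono_left hφ (rearrAt_mono h _) _

theorem abs_smul_le {f g : T →ₘ[ν] ℝ} (h : ∀ᵐ x ∂ν, |g x| ≤ |f x|) {k l : ℝ} (hk : 0 ≤ k)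
    (hkl : k ≤ l) : ∀ᵐ x ∂ν, |(k • g) x| ≤ |(l • f) x| := by
  filter_upwards [h, AEEqFun.coeFn_smul k g, AEEqFun.coeFn_smul l f] with x h1 h2 h3
  rw [h2, h3]
  simp only [Pi.smul_apply, smul_eq_mul, abs_mul, abs_of_nonneg hk, abs_of_nonneg (hk.trans hkl)]
  exact mul_le_mul hkl h1 (abs_nonneg _) (hk.trans hkl)

theorem luxemburg_mono (hφ : IsOrlicz φ) {f g : T →ₘ[ν] ℝ} (h : ∀ᵐ x ∂ν, |g x| ≤ |f x|) :
    luxemburg (genMod φ τ A) g ≤ luxemburg (genMod φ τ A) f :=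
  le_iInf₂ fun ε hε => iInf₂_le ε
    ⟨hε.1, (genMod_mono hφ (abs_smul_le h (inv_nonneg.2 hε.1.le) le_rfl)).trans hε.2⟩

theorem measurable_integrand (hφ : IsOrlicz φ) (hF : IsFrame ν τ δ D A) {v : T → ℝ} (hv : v ∈ A)
    (f : T →ₘ[ν] ℝ) : AEMeasurable (fun t => persp φ (rearrAt f (τ t)) (v t)) ν := by
  have h1 : Measurable fun t => rearrAt f (τ t) := (rearrAt_anti f).measurable.comp hF.measτ
  have h2 := (hF.meas v hv).ennreal_ofReal
  exact ((extend_measurable hφ).comp_aemeasurable (h1.aemeasurable.div h2)).mul h2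

/-- Functions of finite modular have a finite distribution function, i.e. `f^*(∞) = 0`. -/
theorem distribution_ne_top (hφ : IsOrlicz φ) (hF : IsFrame ν τ δ D A) {f : T →ₘ[ν] ℝ}
    (hf : genMod φ τ A f < ∞) {r : ℝ} (hr : 0 < r) : distribution f r ≠ ∞ := by
  intro htop
  have huniv : ν univ = ∞ := top_le_iff.1 (htop ▸ measure_mono (subset_univ _))
  obtain ⟨v, hv⟩ := iInf_lt_iff.1 hf
  obtain ⟨hvA, hv⟩ := iInf_lt_iff.1 hv
  obtain ⟨M, hM, hMtop⟩ := hF.bdd huniv v hvA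
  have hlow : ∀ t, ENNReal.ofReal r ≤ rearrAt f (τ t) := by
    intro t
    refine le_iInf₂ fun r' hr' => ENNReal.ofReal_le_ofReal ?_
    by_contra hlt
    exact hF.ne_top t (top_le_iff.1
      (htop ▸ (distribution_anti f (not_le.1 hlt).le).trans hr'.2))
  set c := persp φ (ENNReal.ofReal r) M
  have hc : c ≠ 0 := by
    have : 0 < φ (r / M) * M := mul_pos (hφ.pos _ (by positivity)) hM
    simpa [c, persp_ofReal hφ hr.le hM] using this
  have h1 := mul_meas_ge_le_lintegral₀ (measurable_integrand hφ hF hvA f) c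
  have h2 : ν {t | c ≤ persp φ (rearrAt f (τ t)) (v t)} = ∞ := by
    refine top_le_iff.1 (hMtop ▸ measure_mono_ae ?_)
    filter_upwards [hF.ae_mem] with t ht hvt
    exact (persp_anti_right hφ _ (hF.pos v hvA t ht) hvt).trans (persp_mono_left hφ (hlow t) _)
  rw [h2, ENNReal.mul_top hc] at h1
  exact absurd hv (not_lt.2 h1)

theorem finiteElements_subset_modularSpace {ρ : (T →ₘ[ν] ℝ) → ℝ≥0∞} :
    finiteElements ρ ⊆ modularSpace ρ := fun _ hf => ⟨1, one_pos, hf 1 one_pos⟩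

/-- Dominated convergence, for a fixed weight `v` with `∫ φ(k f^* / v) v < ∞`. -/
theorem finiteElements_subset_orderContinuousPart (hφ : IsOrlicz φ) (hF : IsFrame ν τ δ D A) :
    finiteElements (μ := ν) (genMod φ τ A) ⊆
      orderContinuousPart (modularSpace (genMod φ τ A)) (luxemburg (genMod φ τ A)) := by
  intro f hf
  refine ⟨finiteElements_subset_modularSpace hf, fun g hgf hg => ?_⟩
  have h0 : ∀ᵐ x ∂ν, ∀ n, 0 ≤ g n x := by
    filter_upwards [hg] with x hx n using hx.1.le_of_tendsto hx.2 n
  have hle : ∀ n, ∀ᵐ x ∂ν, |g n x| ≤ |f x| := by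
    intro n
    filter_upwards [h0, AEEqFun.coeFn_le.2 (hgf n), AEEqFun.coeFn_abs f] with x h1 h2 h3
    rw [abs_of_nonneg (h1 n), ← h3]
    exact h2
  refine ⟨fun m n hmn => luxemburg_mono hφ ?_, ?_⟩
  · filter_upwards [h0, hg] with x h1 h2
    rw [abs_of_nonneg (h1 n), abs_of_nonneg (h1 m)]
    exact h2.1 hmn
  have key : ∀ ε : ℝ, 0 < ε →
      ∀ᶠ n in atTop, luxemburg (genMod φ τ A) (g n) ≤ ENNReal.ofReal ε := by
    intro ε hε
    set k := ε⁻¹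
    have hk : 0 < k := inv_pos.2 hε
    obtain ⟨v, hv⟩ := iInf_lt_iff.1 (hf k hk)
    obtain ⟨hvA, hv⟩ := iInf_lt_iff.1 hv
    have hlek : ∀ n, ∀ᵐ x ∂ν, |(k • g n) x| ≤ |(k • f) x| := fun n =>
      abs_smul_le (hle n) hk.le le_rfl
    have hgk : ∀ᵐ x ∂ν, Tendsto (fun n => (k • g n) x) atTop (𝓝 0) := by
      filter_upwards [hg, ae_all_iff.2 fun n => AEEqFun.coeFn_smul k (g n)] with x h1 h2
      have := h1.2.const_mul k
      rw [mul_zero] at this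
      exact this.congr fun n => by rw [h2 n]; rfl
    have hlim := tendsto_lintegral_of_dominated_convergence' (μ := ν) (f := fun _ => 0)
      (F := fun n t => persp φ (rearrAt (k • g n) (τ t)) (v t))
      (fun t => persp φ (rearrAt (k • f) (τ t)) (v t))
      (fun n => measurable_integrand hφ hF hvA _)
      (fun n => Eventually.of_forall fun t => persp_mono_left hφ (rearrAt_mono (hlek n) _) _)
      hv.ne ?_
    · rw [lintegral_zero] at hlim
      filter_upwards [hlim.eventually (gt_mem_nhds zero_lt_one)] with n hn
      exact iInf₂_le ε ⟨hε, (iInf₂_le v hvA).trans hn.le⟩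
    · filter_upwards [hF.ae_mem, hF.small] with t ht hη
      obtain ⟨η, hη, hS⟩ := hη
      have h1 : Tendsto (fun n => rearrAt (k • g n) (τ t)) atTop (𝓝 0) := by
        rw [ENNReal.tendsto_nhds_zero]
        intro e he
        obtain ⟨r, hr, hre⟩ : ∃ r : ℝ, 0 < r ∧ ENNReal.ofReal r ≤ e := by
          obtain ⟨q, hq, hqe⟩ := ENNReal.lt_iff_exists_real_btwn.1 he
          exact ⟨q, by simpa using hqe.1, hqe.2.le⟩
        have hd := distribution_tendsto_zero hlek hgk hr (distribution_ne_top hφ hF (hf k hk) hr)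
        filter_upwards [hd.eventually (gt_mem_nhds hη)] with n hn
        exact (rearrAt_le hr (hS _ hn)).trans hre
      have hvt : ENNReal.ofReal (v t) ≠ 0 := by simpa using hF.pos v hvA t ht
      have h2 := ENNReal.Tendsto.div_const h1 (Or.inr hvt)
      rw [ENNReal.zero_div] at h2
      have h3 := ENNReal.Tendsto.mul_const (b := ENNReal.ofReal (v t))
        ((extend_tendsto_zero hφ).comp h2) (Or.inr ENNReal.ofReal_ne_top)
      rw [zero_mul] at h3
      exact h3
  rw [ENNReal.tendsto_nhds_zero]
  intro e he
  obtain ⟨q, hq, hqe⟩ := ENNReal.lt_iff_exists_real_btwn.1 he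
  filter_upwards [key q (by simpa using hqe.1)] with n hn using hn.trans hqe.2.le

/-- `|f|` decreases to `0` under subtraction of simple functions taken from standard
approximations of the positive and of the negative part. -/
theorem exists_simple_approx [SigmaFinite ν] (f : T →ₘ[ν] ℝ) :
    ∃ s : ℕ → (T →ₘ[ν] ℝ), (∀ n, IsSimple (s n)) ∧ (∀ n, ∀ᵐ x ∂ν, |s n x| ≤ |f x|) ∧
      (∀ n, ∀ᵐ x ∂ν, |(f - s n) x| ≤ |f x|) ∧
      ∀ᵐ x ∂ν, Antitone (fun n => |(f - s n) x|) ∧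
        Tendsto (fun n => |(f - s n) x|) atTop (𝓝 0) := by
  set p : T → ℝ≥0∞ := fun x => ENNReal.ofReal (f x)
  set q : T → ℝ≥0∞ := fun x => ENNReal.ofReal (-f x)
  have hp : Measurable p := f.measurable.ennreal_ofReal
  have hq : Measurable q := f.measurable.neg.ennreal_ofReal
  set P : ℕ → T → ℝ := fun n x => (SimpleFunc.eapprox p n x).toReal
  set P' : ℕ → T → ℝ := fun n x => (SimpleFunc.eapprox q n x).toReal
  set S : ℕ → SimpleFunc T ℝ := fun n =>
    (((SimpleFunc.eapprox p n).map ENNReal.toReal)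
      - ((SimpleFunc.eapprox q n).map ENNReal.toReal)).restrict (spanningSets ν n)
  have hS : ∀ n x, S n x = (spanningSets ν n).indicator (fun x => P n x - P' n x) x := by
    intro n x
    simp only [S]
    rw [SimpleFunc.restrict_apply _ (measurableSet_spanningSets ν n)]
    rfl
  have hle : ∀ g : T → ℝ≥0∞, Measurable g → ∀ n x, SimpleFunc.eapprox g n x ≤ g x := by
    intro g hg n x
    rw [← SimpleFunc.iSup_eapprox_apply hg x]
    exact le_iSup (fun n => SimpleFunc.eapprox g n x) n
  have hP0 : ∀ n x, 0 ≤ P n x := fun _ _ => ENNReal.toReal_nonneg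
  have hP0' : ∀ n x, 0 ≤ P' n x := fun _ _ => ENNReal.toReal_nonneg
  have hPle : ∀ n x, P n x ≤ max (f x) 0 := fun n x => by
    have := ENNReal.toReal_mono ENNReal.ofReal_ne_top (hle p hp n x)
    rwa [ENNReal.toReal_ofReal'] at this
  have hPle' : ∀ n x, P' n x ≤ max (-f x) 0 := fun n x => by
    have := ENNReal.toReal_mono ENNReal.ofReal_ne_top (hle q hq n x)
    rwa [ENNReal.toReal_ofReal'] at this
  have hmono : ∀ x, Monotone fun n => P n x := fun x m n hmn =>
    ENNReal.toReal_mono (SimpleFunc.eapprox_lt_top p n x).ne (SimpleFunc.monotone_eapprox p hmn x)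
  have hmono' : ∀ x, Monotone fun n => P' n x := fun x m n hmn =>
    ENNReal.toReal_mono (SimpleFunc.eapprox_lt_top q n x).ne (SimpleFunc.monotone_eapprox q hmn x)
  have hlim : ∀ x, Tendsto (fun n => P n x) atTop (𝓝 (max (f x) 0)) := fun x => by
    have h1 := tendsto_atTop_iSup (f := fun n => SimpleFunc.eapprox p n x)
      fun m n hmn => SimpleFunc.monotone_eapprox p hmn x
    rw [SimpleFunc.iSup_eapprox_apply hp] at h1
    have := (ENNReal.tendsto_toReal ENNReal.ofReal_ne_top).comp h1
    rwa [ENNReal.toReal_ofReal'] at this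
  have hlim' : ∀ x, Tendsto (fun n => P' n x) atTop (𝓝 (max (-f x) 0)) := fun x => by
    have h1 := tendsto_atTop_iSup (f := fun n => SimpleFunc.eapprox q n x)
      fun m n hmn => SimpleFunc.monotone_eapprox q hmn x
    rw [SimpleFunc.iSup_eapprox_apply hq] at h1
    have := (ENNReal.tendsto_toReal ENNReal.ofReal_ne_top).comp h1
    rwa [ENNReal.toReal_ofReal'] at this
  -- `|f - S n| = |f| - U n` with `U n` increasing to `|f|`
  set U : ℕ → T → ℝ := fun n x => (spanningSets ν n).indicator (fun x => P n x + P' n x) x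
  have hdiff : ∀ n x, |f x - S n x| = |f x| - U n x ∧ |S n x| ≤ |f x| ∧ 0 ≤ U n x := by
    intro n x
    rw [hS]
    simp only [U, indicator]
    split_ifs
    · have a1 := hP0 n x; have a2 := hP0' n x; have a3 := hPle n x; have a4 := hPle' n x
      rcases le_total 0 (f x) with h | h
      · rw [max_eq_left h] at a3
        rw [max_eq_right (by linarith)] at a4
        have a5 : P' n x = 0 := le_antisymm a4 a2
        rw [a5, abs_of_nonneg h, abs_of_nonneg (by linarith), abs_of_nonneg (by linarith)]
        refine ⟨by ring, by linarith, by linarith⟩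
      · rw [max_eq_right h] at a3
        rw [max_eq_left (by linarith)] at a4
        have a5 : P n x = 0 := le_antisymm a3 a1
        rw [a5, abs_of_nonpos h, abs_of_nonpos (by linarith), abs_of_nonpos (by linarith)]
        refine ⟨by ring, by linarith, by linarith⟩
    · simp
  set s : ℕ → (T →ₘ[ν] ℝ) := fun n => AEEqFun.mk (S n) (S n).aestronglyMeasurable
  have hs : ∀ n, s n =ᵐ[ν] S n := fun n => AEEqFun.coeFn_mk _ _
  have hfs : ∀ n, ∀ᵐ x ∂ν, (f - s n) x = f x - S n x := by
    intro n
    filter_upwards [AEEqFun.coeFn_sub f (s n), hs n] with x h1 h2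
    rw [h1, Pi.sub_apply, h2]
  refine ⟨s, fun n => ⟨S n, hs n, ?_⟩, fun n => ?_, fun n => ?_, ?_⟩
  · refine lt_of_le_of_lt (measure_mono fun x hx => ?_) (measure_spanningSets_lt_top ν n)
    by_contra hcon
    apply hx
    rw [hS, indicator_of_notMem hcon]
  · filter_upwards [hs n] with x hx
    rw [hx]; exact (hdiff n x).2.1
  · filter_upwards [hfs n] with x hx
    rw [hx, (hdiff n x).1]
    linarith [(hdiff n x).2.2]
  · filter_upwards [ae_all_iff.2 hfs] with x hx
    simp_rw [hx, fun n => (hdiff n x).1]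
    constructor
    · intro m n hmn
      refine sub_le_sub_left ?_ _
      simp only [U]
      by_cases hm : x ∈ spanningSets ν m
      · rw [indicator_of_mem hm, indicator_of_mem (monotone_spanningSets ν hmn hm)]
        exact add_le_add (hmono x hmn) (hmono' x hmn)
      · rw [indicator_of_notMem hm]
        exact (hdiff n x).2.2
    · have h1 : Tendsto (fun n => |f x| - (P n x + P' n x)) atTop (𝓝 0) := by
        have := ((hlim x).add (hlim' x)).const_sub |f x|
        convert this using 2
        rcases le_total 0 (f x) with h | h
        · rw [abs_of_nonneg h, max_eq_left h, max_eq_right (by linarith)]; ring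
        · rw [abs_of_nonpos h, max_eq_right h, max_eq_left (by linarith)]; ring
      refine h1.congr' ?_
      obtain ⟨N, hN⟩ : ∃ N, x ∈ spanningSets ν N := by
        have := mem_univ x
        rwa [← iUnion_spanningSets ν, mem_iUnion] at this
      filter_upwards [eventually_ge_atTop N] with n hn
      simp only [U]
      rw [indicator_of_mem (monotone_spanningSets ν hn hN)]

theorem orderContinuousPart_subset_simpleClosure [SigmaFinite ν] (hφ : IsOrlicz φ) :
    orderContinuousPart (μ := ν) (modularSpace (genMod φ τ A)) (luxemburg (genMod φ τ A)) ⊆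
      simpleClosure (modularSpace (genMod φ τ A)) (luxemburg (genMod φ τ A)) := by
  intro f hf
  refine ⟨hf.1, fun ε hε => ?_⟩
  obtain ⟨s, hs, hsf, hfs, hlim⟩ := exists_simple_approx f
  have habs : ∀ n, ∀ᵐ x ∂ν, |f - s n| x = |(f - s n) x| := fun n => AEEqFun.coeFn_abs _
  have h := (hf.2 (fun n => |f - s n|) (fun n => ?_) ?_).2
  · obtain ⟨n, hn⟩ := (h.eventually (gt_mem_nhds hε)).exists
    refine ⟨s n, hs n, ?_, lt_of_le_of_lt (luxemburg_mono hφ ?_) hn⟩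
    · obtain ⟨k, hk, hkf⟩ := hf.1
      exact ⟨k, hk, lt_of_le_of_lt (genMod_mono hφ (abs_smul_le (hsf n) hk.le le_rfl)) hkf⟩
    · filter_upwards [habs n] with x hx
      rw [hx, abs_abs]
  · rw [← AEEqFun.coeFn_le]
    filter_upwards [habs n, hfs n, AEEqFun.coeFn_abs f] with x h1 h2 h3
    rw [h1, h3]; exact h2
  · filter_upwards [hlim, ae_all_iff.2 habs] with x h1 h2
    simp_rw [h2]
    exact h1

/-- The modular of a sum, by `(f + g)^*(t) ≤ f^*(δ t) + g^*(δ t)` and the weight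
`(v ∘ δ + v' ∘ δ) / 4`. -/
theorem genMod_add_lt_top (hφ : IsOrlicz φ) (hF : IsFrame ν τ δ D A) {f g : T →ₘ[ν] ℝ}
    (hf : genMod φ τ A ((4 : ℝ) • f) < ∞) (hg : genMod φ τ A ((4 : ℝ) • g) < ∞) :
    genMod φ τ A (f + g) < ∞ := by
  obtain ⟨v, hv⟩ := iInf_lt_iff.1 hf
  obtain ⟨hvA, hv⟩ := iInf_lt_iff.1 hv
  obtain ⟨v', hv'⟩ := iInf_lt_iff.1 hg
  obtain ⟨hvA', hv'⟩ := iInf_lt_iff.1 hv'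
  have e4 : ENNReal.ofReal 4 = 4 := by norm_num
  refine lt_of_le_of_lt (iInf₂_le _ (hF.half_weight v hvA v' hvA')) ?_
  calc ∫⁻ t, persp φ (rearrAt (f + g) (τ t)) (v (δ t) / 4 + v' (δ t) / 4) ∂ν
      ≤ ∫⁻ t, (fun u => persp φ (rearrAt ((4 : ℝ) • f) (τ u)) (v u)
          + persp φ (rearrAt ((4 : ℝ) • g) (τ u)) (v' u)) (δ t) ∂ν := by
        refine lintegral_mono_ae ?_
        filter_upwards [hF.ae_mem] with t ht
        have p1 := hF.pos v hvA _ (hF.half_mem t ht)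
        have p2 := hF.pos v' hvA' _ (hF.half_mem t ht)
        refine (persp_mono_left hφ (rearrAt_add_le f g (hF.half_level t)) _).trans ?_
        refine (persp_add_le hφ _ _ (by positivity) (by positivity)).trans ?_
        simp only [rearrAt_smul _ (four_pos (α := ℝ)), e4]
        exact add_le_add (persp_div_le _ p1) (persp_div_le _ p2)
    _ ≤ 2 * ∫⁻ u, (persp φ (rearrAt ((4 : ℝ) • f) (τ u)) (v u)
          + persp φ (rearrAt ((4 : ℝ) • g) (τ u)) (v' u)) ∂ν := hF.half_lintegral _
    _ = 2 * (∫⁻ u, persp φ (rearrAt ((4 : ℝ) • f) (τ u)) (v u) ∂ν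
          + ∫⁻ u, persp φ (rearrAt ((4 : ℝ) • g) (τ u)) (v' u) ∂ν) := by
        rw [lintegral_add_left' (measurable_integrand hφ hF hvA _)]
    _ < ∞ := ENNReal.mul_lt_top (by norm_num) (ENNReal.add_lt_top.2 ⟨hv, hv'⟩)

theorem genMod_lt_top_of_bounded (hφ : IsOrlicz φ) (hF : IsFrame ν τ δ D A) {f : T →ₘ[ν] ℝ}
    {M : ℝ} (hM : ∀ᵐ x ∂ν, |f x| ≤ M) (hsupp : ν {x | f x ≠ 0} ≠ ∞) :
    genMod φ τ A f < ∞ := by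
  set m := ν {x | f x ≠ 0}
  obtain ⟨v, hvA, c, hc, hlow⟩ := hF.low m hsupp (measure_mono (subset_univ _))
  refine lt_of_le_of_lt (iInf₂_le v hvA) ?_
  set K := persp φ (ENNReal.ofReal (max M 1)) c
  have hM1 : 0 < max M 1 := lt_max_of_lt_right one_pos
  have hK : K ≠ ∞ := by
    simp only [K, persp_ofReal hφ hM1.le hc]
    exact ENNReal.ofReal_ne_top
  have hms : MeasurableSet {t | τ t < m} := measurableSet_lt hF.measτ measurable_const
  have hle : ∫⁻ t, persp φ (rearrAt f (τ t)) (v t) ∂ν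
      ≤ ∫⁻ t, {t | τ t < m}.indicator (fun _ => K) t ∂ν := by
    refine lintegral_mono_ae ?_
    filter_upwards [hF.ae_mem, hlow] with t ht hl
    by_cases htm : τ t < m
    · rw [indicator_of_mem (show t ∈ {t | τ t < m} from htm)]
      refine (persp_anti_right hφ _ hc (hl htm)).trans (persp_mono_left hφ (rearrAt_le hM1 ?_) _)
      have : distribution f (max M 1) = 0 := by
        refine measure_mono_null_ae (t := ∅) ?_ measure_empty
        filter_upwards [hM] with x hx h
        exact absurd (lt_of_lt_of_le (lt_of_le_of_lt (le_max_left M 1) h) hx) (lt_irrefl _)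
      rw [this]; exact zero_le
    · rw [indicator_of_notMem (show t ∉ {t | τ t < m} from htm)]
      have : rearrAt f (τ t) = 0 := by
        refine le_antisymm (ENNReal.le_of_forall_pos_le_add fun r hr _ => ?_) zero_le
        rw [zero_add, ← ENNReal.ofReal_coe_nnreal]
        refine rearrAt_le hr ((measure_mono fun x hx => ?_).trans (not_lt.1 htm))
        intro h0
        have h' : (r : ℝ) < |f x| := hx
        rw [h0, abs_zero] at h'
        exact absurd h' (not_lt.2 r.coe_nonneg)
      rw [this, persp_zero hφ]
  refine hle.trans_lt ?_
  rw [lintegral_indicator_const hms]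
  exact ENNReal.mul_lt_top hK.lt_top (hF.fin m hsupp).lt_top

theorem simpleClosure_subset_finiteElements (hφ : IsOrlicz φ) (hF : IsFrame ν τ δ D A) :
    simpleClosure (modularSpace (genMod φ τ A)) (luxemburg (genMod φ τ A)) ⊆
      finiteElements (μ := ν) (genMod φ τ A) := by
  intro f hf k hk
  obtain ⟨s, ⟨g, hsg, hg⟩, -, hN⟩ := hf.2 (ENNReal.ofReal (4 * k)⁻¹) (by simpa using hk)
  obtain ⟨ε, hε⟩ := iInf_lt_iff.1 hN
  obtain ⟨⟨hε, h1⟩, hlt⟩ := iInf_lt_iff.1 hε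
  have hlt' : ε < (4 * k)⁻¹ := (ENNReal.ofReal_lt_ofReal_iff (by positivity)).1 hlt
  have hsplit : k • f = k • (f - s) + k • s := by rw [← smul_add, sub_add_cancel]
  rw [hsplit]
  apply genMod_add_lt_top hφ hF
  · refine lt_of_le_of_lt ?_ (h1.trans_lt ENNReal.one_lt_top)
    rw [smul_smul]
    apply genMod_mono hφ (abs_smul_le (Eventually.of_forall fun _ => le_rfl) (by positivity) _)
    exact (le_inv_comm₀ hε (by positivity)).1 hlt'.le
  · rw [smul_smul]
    obtain ⟨M, hM⟩ : ∃ M, ∀ x, |g x| ≤ M := by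
      obtain ⟨M, hM⟩ := (g.map abs).finite_range.bddAbove
      exact ⟨M, fun x => hM ⟨x, rfl⟩⟩
    have hks : ∀ᵐ x ∂ν, ((4 * k) • s) x = 4 * k * g x := by
      filter_upwards [AEEqFun.coeFn_smul (4 * k) s, hsg] with x h2 h3
      rw [h2, Pi.smul_apply, h3, smul_eq_mul]
    refine genMod_lt_top_of_bounded hφ hF (M := 4 * k * M) ?_ ?_
    · filter_upwards [hks] with x hx
      rw [hx, abs_mul, abs_of_pos (by positivity : 0 < 4 * k)]
      exact mul_le_mul_of_nonneg_left (hM x) (by positivity)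
    · refine ne_top_of_le_ne_top hg.ne (measure_mono_ae ?_)
      filter_upwards [hks] with x hx h0 hg0
      apply h0
      rw [hx, hg0, mul_zero]

end Modular

/-! ### Maximizers of `F - ρ W` and level intervals -/

section Cuts

/-- Primitives `F` of a function and `W` of a weight, on a closed set `C ⊆ [0, ∞)` of possible end
points of intervals: `C = [0, γ]` for functions, and `C = ℕ` for sequences. -/
structure IsCut (C : Set ℝ) (F W : ℝ → ℝ) : Prop where
  closed : IsClosed C
  nonneg : ∀ x ∈ C, 0 ≤ x
  zero : (0 : ℝ) ∈ C
  contF : ContinuousOn F C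
  contW : ContinuousOn W C
  monoF : MonotoneOn F C
  monoW : StrictMonoOn W C
  F_zero : F 0 = 0
  W_zero : W 0 = 0

/-- The points where `F - ρ W` attains its maximum over `C`. These are the points at which a line of
slope `ρ` touches the least `W`-concave majorant of `F`. -/
def argmax (C : Set ℝ) (F W : ℝ → ℝ) (ρ : ℝ) : Set ℝ :=
  {x | x ∈ C ∧ ∀ y ∈ C, F y - ρ * W y ≤ F x - ρ * W x}

/-- `F < ρ W` far out, so that `F - ρ W` attains its maximum. -/
def IsCoercive (C : Set ℝ) (F W : ℝ → ℝ) (ρ : ℝ) : Prop :=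
  ∃ B : ℝ, ∀ x ∈ C, B < x → F x < ρ * W x

/-- `(a, b]` is a level interval with bounded end points, of slope `R`. -/
structure IsCutLevel (C : Set ℝ) (F W : ℝ → ℝ) (a b R : ℝ) : Prop where
  left : a ∈ C
  right : b ∈ C
  lt : a < b
  slope : F b - F a = R * (W b - W a)
  le : ∀ x ∈ C, a < x → x ≤ b → F x - F a ≤ R * (W x - W a)

variable {C : Set ℝ} {F W : ℝ → ℝ}

theorem isCutLevel_argmax {a b ρ : ℝ} (ha : a ∈ argmax C F W ρ) (hb : b ∈ argmax C F W ρ)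
    (hab : a < b) : IsCutLevel C F W a b ρ := by
  refine ⟨ha.1, hb.1, hab, ?_, fun x hx _ _ => ?_⟩
  · have h1 := ha.2 b hb.1
    have h2 := hb.2 a ha.1
    linarith
  · have := ha.2 x hx
    linarith

variable (hC : IsCut C F W)
include hC

theorem IsCut.W_nonneg {x : ℝ} (hx : x ∈ C) : 0 ≤ W x := by
  have := hC.monoW.monotoneOn hC.zero hx (hC.nonneg x hx)
  rwa [hC.W_zero] at this

theorem IsCut.W_pos {x : ℝ} (hx : x ∈ C) (h : 0 < x) : 0 < W x := by
  have := hC.monoW hC.zero hx h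
  rwa [hC.W_zero] at this

theorem IsCut.F_nonneg {x : ℝ} (hx : x ∈ C) : 0 ≤ F x := by
  have := hC.monoF hC.zero hx (hC.nonneg x hx)
  rwa [hC.F_zero] at this

theorem IsCut.W_sub_pos {x y : ℝ} (hx : x ∈ C) (hy : y ∈ C) (h : x < y) : 0 < W y - W x :=
  sub_pos.2 (hC.monoW hx hy h)

theorem IsCoercive.mono {ρ σ : ℝ} (h : IsCoercive C F W ρ) (hρσ : ρ ≤ σ) :
    IsCoercive C F W σ := by
  obtain ⟨B, hB⟩ := h
  exact ⟨B, fun x hx hBx => (hB x hx hBx).trans_le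
    (mul_le_mul_of_nonneg_right hρσ (hC.W_nonneg hx))⟩

theorem argmax_nonneg {ρ x : ℝ} (hx : x ∈ argmax C F W ρ) : ρ * W x ≤ F x := by
  have := hx.2 0 hC.zero
  rw [hC.F_zero, hC.W_zero] at this
  linarith

/-- The maximizers move to the left as the slope increases. -/
theorem argmax_anti {ρ σ x y : ℝ} (h : ρ < σ) (hx : x ∈ argmax C F W σ)
    (hy : y ∈ argmax C F W ρ) : x ≤ y := by
  by_contra hlt
  have h1 := hC.W_sub_pos hy.1 hx.1 (not_le.1 hlt)
  have h2 := hx.2 y hy.1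
  have h3 := hy.2 x hx.1
  nlinarith

theorem argmax_closed (ρ : ℝ) : IsClosed (argmax C F W ρ) := by
  have hcont : ContinuousOn (fun x => F x - ρ * W x) C :=
    hC.contF.sub (continuousOn_const.mul hC.contW)
  have h2 : argmax C F W ρ
      = C ∩ ⋂ y ∈ C, (C ∩ (fun x => F x - ρ * W x) ⁻¹' (Ici (F y - ρ * W y))) := by
    ext x
    simp only [argmax, mem_ofPred_eq, mem_iInter, mem_inter_iff, mem_preimage, mem_Ici]
    exact ⟨fun h => ⟨h.1, fun y hy => ⟨h.1, h.2 y hy⟩⟩, fun h => ⟨h.1, fun y hy => (h.2 y hy).2⟩⟩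
  rw [h2]
  exact hC.closed.inter (isClosed_biInter fun y _ =>
    hcont.preimage_isClosed_of_isClosed hC.closed isClosed_Ici)

theorem argmax_subset {ρ B : ℝ} (hB : ∀ x ∈ C, B < x → F x < ρ * W x) :
    argmax C F W ρ ⊆ Icc 0 B := fun x hx =>
  ⟨hC.nonneg x hx.1, not_lt.1 fun h => absurd (hB x hx.1 h) (not_lt.2 (argmax_nonneg hC hx))⟩

theorem argmax_compact {ρ : ℝ} (h : IsCoercive C F W ρ) : IsCompact (argmax C F W ρ) := by
  obtain ⟨B, hB⟩ := h
  exact isCompact_Icc.of_isClosed_subset (argmax_closed hC ρ) (argmax_subset hC hB)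

theorem argmax_nonempty {ρ : ℝ} (h : IsCoercive C F W ρ) : (argmax C F W ρ).Nonempty := by
  obtain ⟨B, hB⟩ := h
  have hK : IsCompact (C ∩ Icc 0 (max B 0)) := isCompact_Icc.inter_left hC.closed
  have hcont : ContinuousOn (fun x => F x - ρ * W x) (C ∩ Icc 0 (max B 0)) :=
    (hC.contF.sub (continuousOn_const.mul hC.contW)).mono inter_subset_left
  have h0 : (0 : ℝ) ∈ C ∩ Icc 0 (max B 0) := ⟨hC.zero, le_rfl, le_max_right _ _⟩
  obtain ⟨x, hx, hmax⟩ := hK.exists_isMaxOn ⟨0, h0⟩ hcont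
  refine ⟨x, hx.1, fun y hy => ?_⟩
  by_cases hyB : y ≤ max B 0
  · exact hmax ⟨hy, hC.nonneg y hy, hyB⟩
  · have h1 := hB y hy ((le_max_left _ _).trans_lt (not_le.1 hyB))
    have h2 : F 0 - ρ * W 0 ≤ F x - ρ * W x := hmax h0
    rw [hC.F_zero, hC.W_zero] at h2
    linarith

theorem exists_argmax_bounds {ρ : ℝ} (h : IsCoercive C F W ρ) :
    ∃ a ∈ argmax C F W ρ, ∃ b ∈ argmax C F W ρ, ∀ x ∈ argmax C F W ρ, a ≤ x ∧ x ≤ b := by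
  obtain ⟨a, ha, h1⟩ := (argmax_compact hC h).exists_isLeast (argmax_nonempty hC h)
  obtain ⟨b, hb, h2⟩ := (argmax_compact hC h).exists_isGreatest (argmax_nonempty hC h)
  exact ⟨a, ha, b, hb, fun x hx => ⟨h1 hx, h2 hx⟩⟩

/-- The maximizers tend to `0` as the slope tends to `∞`. -/
theorem exists_argmax_lt {ρ t : ℝ} (h : IsCoercive C F W ρ) (ht : 0 < t) :
    ∃ μ, ρ < μ ∧ ∀ σ, μ ≤ σ → ∀ x ∈ argmax C F W σ, x < t := by
  obtain ⟨B, hB⟩ := h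
  by_cases hne : (C ∩ Icc t B).Nonempty
  · have hK : IsCompact (C ∩ Icc t B) := isCompact_Icc.inter_left hC.closed
    obtain ⟨c, hc, h1⟩ := hK.exists_isLeast hne
    obtain ⟨d, hd, h2⟩ := hK.exists_isGreatest hne
    have hW := hC.W_pos hc.1 (ht.trans_le hc.2.1)
    have hF := hC.F_nonneg hd.1
    refine ⟨max ρ (F d / W c) + 1, (le_max_left _ _).trans_lt (lt_add_one _), fun σ hσ x hx => ?_⟩
    by_contra hlt
    have hρσ : ρ ≤ σ := by linarith [le_max_left ρ (F d / W c)]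
    have hxB := (argmax_subset hC (fun y hy hBy => (hB y hy hBy).trans_le
      (mul_le_mul_of_nonneg_right hρσ (hC.W_nonneg hy))) hx).2
    have hxK : x ∈ C ∩ Icc t B := ⟨hx.1, not_lt.1 hlt, hxB⟩
    have a1 : F x ≤ F d := hC.monoF hx.1 hd.1 (h2 hxK)
    have a2 : W c ≤ W x := hC.monoW.monotoneOn hc.1 hx.1 (h1 hxK)
    have a3 := argmax_nonneg hC hx
    have a4 : F d / W c < σ := by linarith [le_max_right ρ (F d / W c)]
    rw [div_lt_iff₀ hW] at a4
    have a5 : 0 < σ := pos_of_mul_pos_left (hF.trans_lt a4) hW.le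
    nlinarith
  · refine ⟨ρ + 1, by linarith, fun σ hσ x hx => ?_⟩
    by_contra hlt
    have hxB := (argmax_subset hC (fun y hy hBy => (hB y hy hBy).trans_le
      (mul_le_mul_of_nonneg_right (by linarith) (hC.W_nonneg hy))) hx).2
    exact hne ⟨x, hx.1, not_lt.1 hlt, hxB⟩

/-- A point (or a gap `(p, q)` of `C`) between maximizers for two slopes lies between two maximizers
for one slope in between, by connectedness of the interval of slopes. -/
theorem exists_slope {ρ μ p q x y : ℝ} (h : IsCoercive C F W ρ) (hρμ : ρ ≤ μ)
    (hpq : ∀ z ∈ C, z ≤ p ∨ q ≤ z) (hx : x ∈ argmax C F W μ) (hxp : x ≤ p)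
    (hy : y ∈ argmax C F W ρ) (hqy : q ≤ y) :
    ∃ σ ∈ Icc ρ μ, ∃ x ∈ argmax C F W σ, ∃ y ∈ argmax C F W σ, x ≤ p ∧ q ≤ y := by
  obtain ⟨B, hB⟩ := h
  have hB' : ∀ σ ∈ Icc ρ μ, argmax C F W σ ⊆ Icc 0 B := fun σ hσ =>
    argmax_subset hC fun y hy hBy => (hB y hy hBy).trans_le
      (mul_le_mul_of_nonneg_right hσ.1 (hC.W_nonneg hy))
  -- the set of slopes with a maximizer in a given closed set is closed
  have hclosed : ∀ E : Set ℝ, IsClosed E →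
      IsClosed {σ | σ ∈ Icc ρ μ ∧ ∃ x ∈ argmax C F W σ, x ∈ E} := by
    intro E hE
    have hG : IsClosed {z : ℝ × ℝ | z.2 ∈ C ∩ (E ∩ Icc 0 B) ∧
        ∀ y ∈ C, F y - z.1 * W y ≤ F z.2 - z.1 * W z.2} := by
      have hcont : ContinuousOn (fun z : ℝ × ℝ => F z.2 - z.1 * W z.2)
          {z : ℝ × ℝ | z.2 ∈ C ∩ (E ∩ Icc 0 B)} := by
        have hm : MapsTo (Prod.snd : ℝ × ℝ → ℝ) {z : ℝ × ℝ | z.2 ∈ C ∩ (E ∩ Icc 0 B)} C :=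
          fun z hz => hz.1
        exact (hC.contF.comp continuousOn_snd hm).sub
          (continuousOn_fst.mul (hC.contW.comp continuousOn_snd hm))
      have hcl : IsClosed {z : ℝ × ℝ | z.2 ∈ C ∩ (E ∩ Icc 0 B)} :=
        (hC.closed.inter (hE.inter isClosed_Icc)).preimage continuous_snd
      have e : {z : ℝ × ℝ | z.2 ∈ C ∩ (E ∩ Icc 0 B) ∧
          ∀ y ∈ C, F y - z.1 * W y ≤ F z.2 - z.1 * W z.2}
          = {z : ℝ × ℝ | z.2 ∈ C ∩ (E ∩ Icc 0 B)} ∩ ⋂ y ∈ C,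
            ({z : ℝ × ℝ | z.2 ∈ C ∩ (E ∩ Icc 0 B)} ∩
              (fun z : ℝ × ℝ => F z.2 - z.1 * W z.2 - (F y - z.1 * W y)) ⁻¹' Ici 0) := by
        ext z
        simp only [mem_ofPred_eq, mem_iInter, mem_inter_iff, mem_preimage, mem_Ici, sub_nonneg]
        exact ⟨fun h => ⟨h.1, fun y hy => ⟨h.1, h.2 y hy⟩⟩,
          fun h => ⟨h.1, fun y hy => (h.2 y hy).2⟩⟩
      rw [e]
      refine hcl.inter (isClosed_biInter fun y _ => ?_)
      refine ContinuousOn.preimage_isClosed_of_isClosed ?_ hcl isClosed_Ici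
      exact hcont.sub (continuousOn_const.sub (continuousOn_fst.mul continuousOn_const))
    have hK : IsCompact ((Icc ρ μ ×ˢ Icc 0 B) ∩ {z : ℝ × ℝ | z.2 ∈ C ∩ (E ∩ Icc 0 B) ∧
        ∀ y ∈ C, F y - z.1 * W y ≤ F z.2 - z.1 * W z.2}) :=
      (isCompact_Icc.prod isCompact_Icc).inter_right hG
    convert (hK.image continuous_fst).isClosed using 1
    ext σ
    constructor
    · rintro ⟨hσ, x, hx, hxE⟩
      exact ⟨(σ, x), ⟨⟨hσ, hB' σ hσ hx⟩, ⟨hx.1, hxE, hB' σ hσ hx⟩, hx.2⟩, rfl⟩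
    · rintro ⟨⟨σ', x⟩, ⟨⟨hσ, -⟩, ⟨hxC, hxE, -⟩, hx⟩, rfl⟩
      exact ⟨hσ, x, ⟨hxC, hx⟩, hxE⟩
  obtain ⟨σ, hσ, h1, h2⟩ := isPreconnected_closed_iff.1 (isPreconnected_Icc (a := ρ) (b := μ))
    _ _ (hclosed (Iic p) isClosed_Iic) (hclosed (Ici q) isClosed_Ici) (fun σ hσ => by
      have hco : IsCoercive C F W σ := IsCoercive.mono hC ⟨B, hB⟩ hσ.1
      obtain ⟨z, hz⟩ := argmax_nonempty hC hco
      rcases hpq z hz.1 with hzp | hqz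
      · exact Or.inl ⟨hσ, z, hz, hzp⟩
      · exact Or.inr ⟨hσ, z, hz, hqz⟩)
    ⟨μ, right_mem_Icc.2 hρμ, right_mem_Icc.2 hρμ, x, hx, hxp⟩
    ⟨ρ, left_mem_Icc.2 hρμ, left_mem_Icc.2 hρμ, y, hy, hqy⟩
  obtain ⟨-, x', hx', hxp'⟩ := h1
  obtain ⟨-, y', hy', hqy'⟩ := h2
  exact ⟨σ, hσ, x', hx', y', hy', hxp', hqy'⟩

/-- A level interval with a maximizer of `F - ρ W` inside has slope `ρ`. -/
theorem IsCutLevel.slope_eq {a b R ρ x : ℝ} (h : IsCutLevel C F W a b R)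
    (hx : x ∈ argmax C F W ρ) (hax : a < x) (hxb : x < b) : R = ρ := by
  have h1 := h.le x hx.1 hax hxb.le
  have h2 := h.slope
  have h3 := hx.2 a h.left
  have h4 := hx.2 b h.right
  have w1 := hC.W_sub_pos h.left hx.1 hax
  have w2 := hC.W_sub_pos hx.1 h.right hxb
  apply le_antisymm
  · by_contra hlt
    nlinarith
  · by_contra hlt
    nlinarith

/-- The interval between the extreme maximizers of `F - ρ W` is a maximal level interval. -/
theorem IsCutLevel.eq_of_argmax_subset {a b c d R ρ : ℝ} (h : IsCutLevel C F W c d R)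
    (ha : a ∈ argmax C F W ρ) (hb : b ∈ argmax C F W ρ)
    (hab : ∀ x ∈ argmax C F W ρ, a ≤ x ∧ x ≤ b) (hlt : a < b) (hca : c ≤ a) (hbd : b ≤ d) :
    c = a ∧ d = b := by
  constructor
  · rcases hca.eq_or_lt with h' | h'
    · exact h'
    have hR := h.slope_eq hC ha h' (hlt.trans_le hbd)
    subst hR
    have h1 := h.le a ha.1 h' (hlt.le.trans hbd)
    have hc : c ∈ argmax C F W R := ⟨h.left, fun y hy => (ha.2 y hy).trans (by linarith)⟩
    exact absurd (hab c hc).1 (not_le.2 h')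
  · rcases hbd.eq_or_lt with h' | h'
    · exact h'.symm
    have hR := h.slope_eq hC hb (hca.trans_lt hlt) h'
    subst hR
    have h1 := h.le b hb.1 (hca.trans_lt hlt) hbd
    have h2 := h.slope
    have hd : d ∈ argmax C F W R := ⟨h.right, fun y hy => (hb.2 y hy).trans (by linarith)⟩
    exact absurd (hab d hd).2 (not_le.2 h')

/-- A level interval that meets `(a, b)` has slope `ρ`, if it is maximal at least in comparison with
the interval `(a, b]` between the extreme maximizers of `F - ρ W`. -/
theorem IsCutLevel.slope_eq_of_meets {a b c d R ρ : ℝ} (h : IsCutLevel C F W c d R)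
    (ha : a ∈ argmax C F W ρ) (hb : b ∈ argmax C F W ρ) (had : a < d) (hcb : c < b)
    (hmax : a ≤ c → d ≤ b → a = c ∧ b = d) : R = ρ := by
  rcases lt_or_ge c a with h1 | h1
  · exact h.slope_eq hC ha h1 had
  rcases lt_or_ge b d with h2 | h2
  · exact h.slope_eq hC hb hcb h2
  obtain ⟨rfl, rfl⟩ := hmax h1 h2
  have h3 := (isCutLevel_argmax ha hb h.lt).slope
  rw [h.slope] at h3
  exact mul_right_cancel₀ (hC.W_sub_pos h.left h.right h.lt).ne' h3

/-- If `F - L W` has no maximum, then the maximizers for slopes above `L` leave every bounded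
set. -/
theorem exists_argmax_gt {L : ℝ} (hne : argmax C F W L = ∅) (t : ℝ) :
    ∃ ρ, L < ρ ∧ ∀ x ∈ argmax C F W ρ, t < x := by
  have hK : IsCompact (C ∩ Icc 0 (max t 0)) := isCompact_Icc.inter_left hC.closed
  have hcont : ContinuousOn (fun x => F x - L * W x) (C ∩ Icc 0 (max t 0)) :=
    (hC.contF.sub (continuousOn_const.mul hC.contW)).mono inter_subset_left
  obtain ⟨m, hm, hmax⟩ := hK.exists_isMaxOn ⟨0, hC.zero, le_rfl, le_max_right _ _⟩ hcont
  obtain ⟨y, hy, hlt⟩ : ∃ y ∈ C, F m - L * W m < F y - L * W y := by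
    by_contra hcon
    push Not at hcon
    exact (hne ▸ (⟨hm.1, hcon⟩ : m ∈ argmax C F W L) : m ∈ (∅ : Set ℝ))
  have hWy := hC.W_nonneg hy
  set ε := ((F y - L * W y) - (F m - L * W m)) / (W y + 1)
  have hε : 0 < ε := div_pos (sub_pos.2 hlt) (by linarith)
  have hεW : ε * (W y + 1) = (F y - L * W y) - (F m - L * W m) :=
    div_mul_cancel₀ _ (by positivity)
  refine ⟨L + ε, by linarith, fun x hx => ?_⟩
  by_contra hxt
  have h1 : F x - L * W x ≤ F m - L * W m :=
    hmax ⟨hx.1, hC.nonneg x hx.1, (not_lt.1 hxt).trans (le_max_left _ _)⟩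
  have h2 := hx.2 y hy
  have h3 := hC.W_nonneg hx.1
  nlinarith

/-- `F` is constant to the right of the maximizers for all small slopes. -/
theorem eq_of_forall_argmax_le (hco : ∀ ρ, 0 < ρ → IsCoercive C F W ρ) {μ y s : ℝ} (hμ : 0 < μ)
    (h : ∀ l, 0 < l → l < μ → ∀ z ∈ argmax C F W l, z ≤ y) (hy : y ∈ C) (hs : s ∈ C)
    (hys : y ≤ s) : F s = F y := by
  refine le_antisymm (le_of_forall_pos_le_add fun ε hε => ?_) (hC.monoF hy hs hys)
  have hWs := hC.W_nonneg hs
  set l := min (μ / 2) (ε / (W s + 1))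
  have hl0 : 0 < l := lt_min (half_pos hμ) (by positivity)
  have hlμ : l < μ := (min_le_left _ _).trans_lt (half_lt_self hμ)
  obtain ⟨z, hz⟩ := argmax_nonempty hC (hco l hl0)
  have h1 := hz.2 s hs
  have h2 := hC.monoF hz.1 hy (h l hl0 hlμ z hz)
  have h3 := hC.W_nonneg hz.1
  have h4 : l * (W s + 1) ≤ ε := by
    calc l * (W s + 1) ≤ ε / (W s + 1) * (W s + 1) := by
          gcongr; exact min_le_right _ _
      _ = ε := div_mul_cancel₀ _ (by positivity)
  nlinarith

end Cuts

/-! ### Slopes of intervals with right end point `∞` -/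

section Limsup

variable {C : Set ℝ} {F W : ℝ → ℝ} {ι : Type*} {l : Filter ι} {c : ι → ℝ}

/-- The slopes of the intervals `(a, c i]`. -/
noncomputable def slopes (F W : ℝ → ℝ) (c : ι → ℝ) (a : ℝ) (i : ι) : ℝ≥0∞ :=
  ENNReal.ofReal ((F (c i) - F a) / (W (c i) - W a))

/-- A net of right end points exhausting an unbounded `C`. -/
structure IsExhausting (C : Set ℝ) (W : ℝ → ℝ) (l : Filter ι) (c : ι → ℝ) : Prop where
  mem : ∀ᶠ i in l, c i ∈ C
  tendsto : Tendsto c l atTop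
  tendstoW : Tendsto (fun i => W (c i)) l atTop
  cofinal : ∀ p : ℝ → Prop, (∀ᶠ i in l, p (c i)) → ∃ B, ∀ x ∈ C, B < x → p x

theorem limsup_slopes_le (hl : IsExhausting C W l c) {ρ ρ' a : ℝ} (h : IsCoercive C F W ρ)
    (hρ : ρ < ρ') : limsup (slopes F W c a) l ≤ ENNReal.ofReal ρ' := by
  obtain ⟨B, hB⟩ := h
  refine limsup_le_of_le (by isBoundedDefault) ?_
  filter_upwards [hl.mem, hl.tendsto.eventually_gt_atTop B, hl.tendstoW.eventually_gt_atTop (W a),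
    hl.tendstoW.eventually_gt_atTop ((ρ' * W a - F a) / (ρ' - ρ))] with i h1 h2 h3 h4
  apply ENNReal.ofReal_le_ofReal
  rw [div_le_iff₀ (sub_pos.2 h3)]
  have h5 := hB _ h1 h2
  rw [div_lt_iff₀ (sub_pos.2 hρ)] at h4
  nlinarith

theorem isCoercive_of_limsup_lt (hC : IsCut C F W) (hl : IsExhausting C W l c) {ρ : ℝ}
    (h : limsup (slopes F W c 0) l < ENNReal.ofReal ρ) : IsCoercive C F W ρ := by
  have h1 := eventually_lt_of_limsup_lt h (by isBoundedDefault)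
  refine hl.cofinal (fun x => F x < ρ * W x) ?_
  filter_upwards [h1, hl.tendstoW.eventually_gt_atTop 0] with i h2 h3
  rw [slopes, hC.F_zero, hC.W_zero, sub_zero, sub_zero] at h2
  have hρ : 0 < ρ := by
    by_contra hn
    rw [ENNReal.ofReal_of_nonpos (not_lt.1 hn)] at h2
    exact absurd h2 not_lt_zero
  rw [ENNReal.ofReal_lt_ofReal_iff hρ, div_lt_iff₀ h3] at h2
  exact h2

theorem le_limsup_slopes (hC : IsCut C F W) (hl : IsExhausting C W l c) {ρ ρ' a : ℝ} (hρ0 : 0 ≤ ρ)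
    (h : ENNReal.ofReal ρ < limsup (slopes F W c 0) l) (hρ : ρ' < ρ) :
    ENNReal.ofReal ρ' ≤ limsup (slopes F W c a) l := by
  have h1 := frequently_lt_of_lt_limsup (by isBoundedDefault) h
  refine le_limsup_of_frequently_le ?_ (by isBoundedDefault)
  refine (h1.and_eventually ((hl.tendstoW.eventually_gt_atTop 0).and
    ((hl.tendstoW.eventually_gt_atTop (W a)).and
    (hl.tendstoW.eventually_gt_atTop ((F a - ρ' * W a) / (ρ - ρ')))))).mono ?_
  rintro i ⟨h2, h3, h4, h5⟩
  apply ENNReal.ofReal_le_ofReal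
  rw [slopes, hC.F_zero, hC.W_zero, sub_zero, sub_zero,
    ENNReal.ofReal_lt_ofReal_iff_of_nonneg hρ0, lt_div_iff₀ h3] at h2
  rw [le_div_iff₀ (sub_pos.2 h4)]
  rw [div_lt_iff₀ (sub_pos.2 hρ)] at h5
  nlinarith

/-- The slope of `(a, ∞]` does not depend on `a`. -/
theorem limsup_slopes_eq (hC : IsCut C F W) (hl : IsExhausting C W l c) {L a : ℝ}
    (hL : limsup (slopes F W c 0) l = ENNReal.ofReal L) (hL0 : 0 < L) :
    limsup (slopes F W c a) l = ENNReal.ofReal L := by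
  refine le_antisymm (le_of_forall_gt_imp_ge_of_dense fun b hb => ?_)
    (le_of_forall_lt_imp_le_of_dense fun b hb => ?_)
  · by_cases hbt : b = ∞
    · rw [hbt]; exact le_top
    rw [← ENNReal.ofReal_toReal hbt] at hb ⊢
    have h1 := (ENNReal.ofReal_lt_ofReal_iff_of_nonneg hL0.le).1 hb
    refine limsup_slopes_le hl (isCoercive_of_limsup_lt hC hl (ρ := (L + b.toReal) / 2) ?_)
      (add_div_two_lt_right.2 h1)
    rw [hL, ENNReal.ofReal_lt_ofReal_iff_of_nonneg hL0.le]
    exact left_lt_add_div_two.2 h1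
  · have hbt : b ≠ ∞ := (hb.trans_le le_top).ne
    rw [← ENNReal.ofReal_toReal hbt] at hb ⊢
    have h1 := (ENNReal.ofReal_lt_ofReal_iff hL0).1 hb
    refine le_limsup_slopes hC hl (ρ := (b.toReal + L) / 2)
      (by linarith [ENNReal.toReal_nonneg (a := b)]) ?_ (left_lt_add_div_two.2 h1)
    rw [hL, ENNReal.ofReal_lt_ofReal_iff hL0]
    exact add_div_two_lt_right.2 h1

end Limsup

/-! ### Comparison of the two modulars along a dyadic grid of slopes -/

section Comparison

variable {T : Type*} [MeasurableSpace T] {ν : Measure T} {pos : T → ℝ} {D : Set T} {C : Set ℝ}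

/-- The set of the points with position in `(a, b]`. -/
def cell (pos : T → ℝ) (a b : ℝ) : Set T := {t | a < pos t ∧ pos t ≤ b}

theorem measurableSet_cell (hpos : Measurable pos) (a b : ℝ) : MeasurableSet (cell pos a b) :=
  (measurableSet_lt measurable_const hpos).inter (measurableSet_le hpos measurable_const)

theorem lintegral_cell_add (hpos : Measurable pos) (g : T → ℝ≥0∞) {a b c : ℝ} (hab : a ≤ b)
    (hbc : b ≤ c) : ∫⁻ t in cell pos a b, g t ∂ν + ∫⁻ t in cell pos b c, g t ∂ν
      = ∫⁻ t in cell pos a c, g t ∂ν := by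
  rw [← lintegral_union (measurableSet_cell hpos b c)
    (disjoint_left.2 fun t h1 h2 => absurd h1.2 (not_le.2 h2.1))]
  congr 2
  ext t
  constructor
  · rintro (h | h)
    · exact ⟨h.1, h.2.trans hbc⟩
    · exact ⟨hab.trans_lt h.1, h.2⟩
  · intro h
    rcases le_or_gt (pos t) b with h' | h'
    · exact Or.inl ⟨h.1, h'⟩
    · exact Or.inr ⟨h', h.2⟩

theorem sum_lintegral_cell (hpos : Measurable pos) (g : T → ℝ≥0∞) {c : ℕ → ℝ} (hc : Monotone c)
    (M : ℕ) : ∑ i ∈ Finset.range M, ∫⁻ t in cell pos (c i) (c (i + 1)), g t ∂ν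
      = ∫⁻ t in cell pos (c 0) (c M), g t ∂ν := by
  induction M with
  | zero =>
    have : cell pos (c 0) (c 0) = ∅ := by
      ext t; simp [cell]
    simp [this]
  | succ M ih =>
    rw [Finset.sum_range_succ, ih, lintegral_cell_add hpos g (hc (Nat.zero_le M))
      (hc (Nat.le_succ M))]

/-- If the integral of `g` over `(0, c]` is `G c`, then that over `(a, b]` is `G b - G a`. -/
theorem lintegral_cell_eq (hpos : Measurable pos) {g : T → ℝ≥0∞} {G : ℝ → ℝ}
    (hC0 : ∀ x ∈ C, 0 ≤ x) (hG0 : ∀ x ∈ C, 0 ≤ G x)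
    (hG : ∀ c ∈ C, ∫⁻ t in cell pos 0 c, g t ∂ν = ENNReal.ofReal (G c)) {a b : ℝ} (ha : a ∈ C)
    (hb : b ∈ C) (hab : a ≤ b) :
    ∫⁻ t in cell pos a b, g t ∂ν = ENNReal.ofReal (G b - G a) := by
  have h := lintegral_cell_add (ν := ν) hpos g (hC0 a ha) hab
  rw [hG a ha, hG b hb] at h
  rw [ENNReal.ofReal_sub _ (hG0 a ha), ← h, ENNReal.add_sub_cancel_left ENNReal.ofReal_ne_top]

/-- Comparison of integrals over `E` by means of a partition into countably many pieces, over which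
the integrals compare, and a remainder, on which the integrands do. -/
theorem lintegral_le_of_partition {J : ℤ → Set T} (hJ : ∀ n, MeasurableSet (J n))
    (hd : Pairwise (Function.onFun Disjoint J)) {E : Set T} (hE : MeasurableSet E)
    {p q : T → ℝ≥0∞} (h : ∀ n, ∫⁻ t in J n ∩ E, p t ∂ν ≤ ∫⁻ t in J n ∩ E, q t ∂ν)
    (h0 : ∀ᵐ t ∂ν, (∀ n, t ∉ J n) → p t ≤ q t) :
    ∫⁻ t in E, p t ∂ν ≤ ∫⁻ t in E, q t ∂ν := by
  have hU : MeasurableSet (⋃ n, J n) := MeasurableSet.iUnion hJ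
  rw [← lintegral_inter_add_sdiff p E hU, ← lintegral_inter_add_sdiff q E hU]
  refine add_le_add ?_ ?_
  · rw [inter_iUnion, lintegral_iUnion (fun n => hE.inter (hJ n)), lintegral_iUnion
      (fun n => hE.inter (hJ n))]
    · exact ENNReal.tsum_le_tsum fun n => by rw [inter_comm]; exact h n
    all_goals exact fun i j hij => (hd hij).mono inter_subset_right inter_subset_right
  · refine setLIntegral_mono_ae' (hE.diff hU) ?_
    filter_upwards [h0] with t ht htE
    exact ht fun n hn => htE.2 (mem_iUnion.2 ⟨n, hn⟩)

/-- A decreasing function `f` and a decreasing weight `w` on a measure space whose points `t ∈ D`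
have positions `pos t ∈ C`, together with their primitives `F` and `W`. -/
structure IsSystem (ν : Measure T) (pos : T → ℝ) (D : Set T) (C : Set ℝ) (w : T → ℝ)
    (f : T → ℝ≥0∞) (F W : ℝ → ℝ) : Prop where
  cut : IsCut C F W
  ae_mem : ∀ᵐ t ∂ν, t ∈ D
  meas_pos : Measurable pos
  pos_mem : ∀ t ∈ D, pos t ∈ C
  pos_pos : ∀ t ∈ D, 0 < pos t
  w_pos : ∀ t ∈ D, 0 < w t
  w_anti : ∀ s ∈ D, ∀ t ∈ D, pos s ≤ pos t → w t ≤ w s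
  f_anti : ∀ s ∈ D, ∀ t ∈ D, pos s ≤ pos t → f t ≤ f s
  meas_w : AEMeasurable w ν
  meas_f : AEMeasurable f ν
  intF : ∀ c ∈ C, ∫⁻ t in cell pos 0 c, f t ∂ν = ENNReal.ofReal (F c)
  intW : ∀ c ∈ C, ∫⁻ t in cell pos 0 c, ENNReal.ofReal (w t) ∂ν = ENNReal.ofReal (W c)
  cell_pos : ∀ x ∈ C, ∀ t ∈ D, x < pos t → ν (cell pos x (pos t)) ≠ 0
  cell_fin : ∀ x ∈ C, ∀ t ∈ D, x < pos t → ν (cell pos x (pos t)) ≠ ∞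
  exhaust : ∃ e : ℕ → ℝ, (∀ n, e n ∈ C) ∧ ∀ t ∈ D, ∃ n, pos t ≤ e n

variable {w v : T → ℝ} {f : T → ℝ≥0∞} {F W : ℝ → ℝ} {φ : ℝ → ℝ}

/-- The rough Young inequality, integrated. -/
theorem lintegral_young (hφ : IsOrlicz φ) (hf : AEMeasurable f ν) (hv : AEMeasurable v ν)
    (hD : ∀ᵐ t ∂ν, t ∈ D) (hv0 : ∀ t ∈ D, 0 < v t) {l : ℝ} (hl : 0 < l) (E : Set T) :
    ENNReal.ofReal (4 * φ l / l) * ∫⁻ t in E, f t ∂ν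
      ≤ ∫⁻ t in E, persp φ (4 * f t) (v t) ∂ν
        + ENNReal.ofReal (φ l) * ∫⁻ t in E, ENNReal.ofReal (v t) ∂ν := by
  rw [← lintegral_const_mul'' _ hf.restrict, ← lintegral_const_mul'' _ hv.restrict.ennreal_ofReal,
    ← lintegral_add_right' _ (hv.restrict.ennreal_ofReal.const_mul _)]
  refine lintegral_mono_ae ?_
  filter_upwards [ae_restrict_of_ae hD] with t ht
  refine (young hφ (f t) (hv0 t ht) hl).trans (le_of_eq ?_)
  rw [ENNReal.ofReal_mul (hφ.nonneg hl.le)]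

/-- Abel summation: partial sums `d ≥ 0` remain nonnegative if the increments are weighted by a
decreasing `p ≥ 0`. -/
theorem abel_sum_nonneg {p d : ℕ → ℝ} (hp : Antitone p) (hp0 : ∀ i, 0 ≤ p i) (hd0 : d 0 = 0)
    (hd : ∀ i, 0 ≤ d i) (M : ℕ) : 0 ≤ ∑ i ∈ Finset.range M, p i * (d (i + 1) - d i) := by
  have h : p M * d M ≤ ∑ i ∈ Finset.range M, p i * (d (i + 1) - d i) := by
    induction M with
    | zero => simp [hd0]
    | succ M ih =>
      rw [Finset.sum_range_succ]
      have := mul_le_mul_of_nonneg_right (hp (Nat.le_succ M)) (hd (M + 1))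
      nlinarith
  exact (mul_nonneg (hp0 M) (hd M)).trans h

/-- The comparison of `Q` with `P` along a finite grid of slopes. On each cell of the grid Young's
inequality is used with the slope of this cell, and the terms with `v` are absorbed, as
`v ≺ w`. -/
theorem sum_grid_le (hφ : IsOrlicz φ) (S : IsSystem ν pos D C w f F W) (hv : AEMeasurable v ν)
    (hv0 : ∀ t ∈ D, 0 < v t)
    (hvw : ∀ c ∈ C, ∫⁻ t in cell pos 0 c, ENNReal.ofReal (v t) ∂ν
      ≤ ∫⁻ t in cell pos 0 c, ENNReal.ofReal (w t) ∂ν)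
    (hB : ∫⁻ t, persp φ (4 * f t) (v t) ∂ν ≠ ∞) {κ c : ℕ → ℝ} (hκ : Antitone κ)
    (hκ0 : ∀ i, 0 < κ i) (hc : Monotone c) (hc0 : c 0 = 0) (hcC : ∀ i, c i ∈ C)
    (hFW : ∀ i, κ i * (W (c (i + 1)) - W (c i)) ≤ F (c (i + 1)) - F (c i)) (M : ℕ) :
    ∑ i ∈ Finset.range M, φ (2 * κ i) * (W (c (i + 1)) - W (c i))
      ≤ (∫⁻ t, persp φ (4 * f t) (v t) ∂ν).toReal := by
  set B := ∫⁻ t, persp φ (4 * f t) (v t) ∂ν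
  set V : ℝ → ℝ := fun x => (∫⁻ t in cell pos 0 x, ENNReal.ofReal (v t) ∂ν).toReal
  have hVfin : ∀ x ∈ C, ∫⁻ t in cell pos 0 x, ENNReal.ofReal (v t) ∂ν ≠ ∞ := fun x hx =>
    ne_top_of_le_ne_top (by rw [S.intW x hx]; exact ENNReal.ofReal_ne_top) (hvw x hx)
  have hV : ∀ x ∈ C, ∫⁻ t in cell pos 0 x, ENNReal.ofReal (v t) ∂ν = ENNReal.ofReal (V x) :=
    fun x hx => (ENNReal.ofReal_toReal (hVfin x hx)).symm
  have hVW : ∀ x ∈ C, V x ≤ W x := fun x hx => by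
    have h := hvw x hx
    rw [hV x hx, S.intW x hx] at h
    exact (ENNReal.ofReal_le_ofReal_iff (S.cut.W_nonneg hx)).1 h
  set b : ℕ → ℝ≥0∞ := fun i => ∫⁻ t in cell pos (c i) (c (i + 1)), persp φ (4 * f t) (v t) ∂ν
  have hbsum : ∑ i ∈ Finset.range M, b i ≤ B := by
    simp only [b]
    rw [sum_lintegral_cell S.meas_pos _ hc]
    exact setLIntegral_le_lintegral _ _
  have hbfin : ∀ i, b i ≠ ∞ := fun i => ne_top_of_le_ne_top hB (setLIntegral_le_lintegral _ _)
  have hstep : ∀ i, 2 * (φ (2 * κ i) * (W (c (i + 1)) - W (c i)))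
      ≤ (b i).toReal + φ (2 * κ i) * (V (c (i + 1)) - V (c i)) := by
    intro i
    have hκi := hκ0 i
    have hle := hc (Nat.le_succ i)
    have hφi := hφ.pos (2 * κ i) (by positivity)
    have h := lintegral_young hφ S.meas_f hv S.ae_mem hv0 (l := 2 * κ i) (by positivity)
      (cell pos (c i) (c (i + 1)))
    have hΔV : 0 ≤ V (c (i + 1)) - V (c i) := by
      refine sub_nonneg.2 (ENNReal.toReal_mono (hVfin _ (hcC _)) (lintegral_mono_set ?_))
      exact fun t ht => ⟨ht.1, ht.2.trans hle⟩
    rw [lintegral_cell_eq S.meas_pos S.cut.nonneg (fun x hx => S.cut.F_nonneg hx) S.intF (hcC i)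
        (hcC (i + 1)) hle,
      lintegral_cell_eq (G := V) S.meas_pos S.cut.nonneg (fun x _ => ENNReal.toReal_nonneg) hV
        (hcC i) (hcC (i + 1)) hle] at h
    change _ ≤ b i + _ at h
    rw [← ENNReal.ofReal_toReal (hbfin i), ← ENNReal.ofReal_mul (by positivity),
      ← ENNReal.ofReal_mul hφi.le, ← ENNReal.ofReal_add ENNReal.toReal_nonneg (by positivity),
      ENNReal.ofReal_le_ofReal_iff (by positivity)] at h
    refine le_trans ?_ h
    calc 2 * (φ (2 * κ i) * (W (c (i + 1)) - W (c i)))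
        = 4 * φ (2 * κ i) / (2 * κ i) * (κ i * (W (c (i + 1)) - W (c i))) := by
          field_simp; ring
      _ ≤ 4 * φ (2 * κ i) / (2 * κ i) * (F (c (i + 1)) - F (c i)) := by
          gcongr; exact hFW i
  have hsum := Finset.sum_le_sum fun i (_ : i ∈ Finset.range M) => hstep i
  rw [← Finset.mul_sum, Finset.sum_add_distrib, ← ENNReal.toReal_sum fun i _ => hbfin i] at hsum
  have habel := abel_sum_nonneg (p := fun i => φ (2 * κ i)) (d := fun i => W (c i) - V (c i))
    (fun i j hij => hφ.mono (by have := hκ0 j; positivity) (by linarith [hκ hij]))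
    (fun i => hφ.nonneg (by have := hκ0 i; positivity))
    (by
      have : cell pos 0 0 = ∅ := by ext t; simp [cell]
      simp [hc0, S.cut.W_zero, V, this])
    (fun i => sub_nonneg.2 (hVW _ (hcC i))) M
  have e : ∑ i ∈ Finset.range M,
      φ (2 * κ i) * ((W (c (i + 1)) - V (c (i + 1))) - (W (c i) - V (c i)))
      = ∑ i ∈ Finset.range M, φ (2 * κ i) * (W (c (i + 1)) - W (c i))
        - ∑ i ∈ Finset.range M, φ (2 * κ i) * (V (c (i + 1)) - V (c i)) := by
    rw [← Finset.sum_sub_distrib]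
    exact Finset.sum_congr rfl fun i _ => by ring
  rw [e] at habel
  have := ENNReal.toReal_mono hB hbsum
  linarith

/-- A choice of maximizers for the slopes `2 ^ n`. -/
theorem exists_dyadic_argmax (hC : IsCut C F W) (hco : ∀ ρ, 0 < ρ → IsCoercive C F W ρ) :
    ∃ a : ℤ → ℝ, (∀ n, a n ∈ argmax C F W ((2 : ℝ) ^ n)) ∧ Antitone a ∧
      ∀ t, 0 < t → ∃ N : ℕ, a N < t := by
  have hpow : ∀ n : ℤ, (0 : ℝ) < (2 : ℝ) ^ n := fun n => by positivity
  choose a ha using fun n : ℤ => argmax_nonempty hC (hco _ (hpow n))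
  refine ⟨a, ha, fun m n hmn => ?_, fun t ht => ?_⟩
  · rcases hmn.eq_or_lt with rfl | h
    · exact le_rfl
    · exact argmax_anti hC (zpow_lt_zpow_right₀ one_lt_two h) (ha n) (ha m)
  · obtain ⟨μ, -, h⟩ := exists_argmax_lt hC (hco 1 one_pos) ht
    obtain ⟨N, hN⟩ := pow_unbounded_of_one_lt μ (one_lt_two (α := ℝ))
    exact ⟨N, h _ (by rw [zpow_natCast]; exact hN.le) _ (ha N)⟩

/-- If `h` is at most `μ` to the right of the maximizers for the slope `μ`, then
`∫ φ(h) w ≤ ∫ φ(4 f / v) v` for all `v ≺ w`. -/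
theorem lintegral_slope_le (hφ : IsOrlicz φ) (S : IsSystem ν pos D C w f F W)
    (hco : ∀ ρ, 0 < ρ → IsCoercive C F W ρ) (hv : AEMeasurable v ν) (hv0 : ∀ t ∈ D, 0 < v t)
    (hvw : ∀ c ∈ C, ∫⁻ t in cell pos 0 c, ENNReal.ofReal (v t) ∂ν
      ≤ ∫⁻ t in cell pos 0 c, ENNReal.ofReal (w t) ∂ν) {h : T → ℝ≥0∞}
    (hh : ∀ μ, 0 < μ → ∀ x ∈ argmax C F W μ, ∀ᵐ t ∂ν, x < pos t → h t ≤ ENNReal.ofReal μ) :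
    ∫⁻ t, extend φ (h t) * ENNReal.ofReal (w t) ∂ν ≤ ∫⁻ t, persp φ (4 * f t) (v t) ∂ν := by
  by_cases hB : ∫⁻ t, persp φ (4 * f t) (v t) ∂ν = ∞
  · rw [hB]; exact le_top
  set B := ∫⁻ t, persp φ (4 * f t) (v t) ∂ν with hBdef
  obtain ⟨a, ha, hanti, hsmall⟩ := exists_dyadic_argmax S.cut hco
  have hpow : ∀ n : ℤ, (0 : ℝ) < (2 : ℝ) ^ n := fun n => by positivity
  have haC : ∀ n, a n ∈ C := fun n => (ha n).1
  have hhn : ∀ᵐ t ∂ν, ∀ n : ℤ, a n < pos t → h t ≤ ENNReal.ofReal ((2 : ℝ) ^ n) :=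
    ae_all_iff.2 fun n => hh _ (hpow n) _ (ha n)
  set E : ℕ → Set T := fun N => cell pos (a N) (a (-N))
  have hE : ∀ N, MeasurableSet (E N) := fun N => measurableSet_cell S.meas_pos _ _
  have key : ∀ N : ℕ, ∫⁻ t in E N, extend φ (h t) * ENNReal.ofReal (w t) ∂ν ≤ B := by
    intro N
    -- On `(a (N - i), a (N - i - 1)]` one has `h ≤ 2 ^ (N - i)`, while the slope of `F` is only
    -- known to be at least half of this: hence the factor `2` in `φ (2 * κ i)`.
    set κ : ℕ → ℝ := fun i => (2 : ℝ) ^ ((N : ℤ) - i)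
    set c : ℕ → ℝ := fun i => Nat.casesOn i 0 fun i => a ((N : ℤ) - i)
    have hcs : ∀ i : ℕ, c (i + 1) = a ((N : ℤ) - i) := fun i => rfl
    have hcC : ∀ i, c i ∈ C := fun i => by
      cases i with
      | zero => exact S.cut.zero
      | succ i => exact haC _
    have hcmono : Monotone c := monotone_nat_of_le_succ fun i => by
      cases i with
      | zero => exact S.cut.nonneg _ (haC _)
      | succ i =>
        rw [hcs, hcs]
        exact hanti (by push_cast; linarith)
    have hgrid := sum_grid_le hφ S hv hv0 hvw hB (κ := κ) (c := c)
      (fun i j hij => zpow_le_zpow_right₀ one_le_two (by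
        have : (i : ℤ) ≤ j := by exact_mod_cast hij
        linarith))
      (fun i => hpow _) hcmono rfl hcC
      (fun i => by
        rw [hcs]
        have := (ha ((N : ℤ) - i)).2 (c i) (hcC i)
        simp only [κ]
        linarith) (2 * N + 1)
    have hcE : E N = cell pos (c (0 + 1)) (c (2 * N + 1)) := by
      simp only [E]
      rw [hcs, hcs]
      push_cast
      rw [sub_zero, show (N : ℤ) - 2 * N = -N by ring]
    have hφ0 : ∀ i, 0 ≤ φ (2 * κ i) := fun i => hφ.nonneg (mul_nonneg zero_le_two (hpow _).le)
    have hW0 : ∀ i, 0 ≤ W (c (i + 1)) - W (c i) := fun i =>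
      sub_nonneg.2 (S.cut.monoW.monotoneOn (hcC i) (hcC (i + 1)) (hcmono (Nat.le_succ i)))
    have hsum : ∫⁻ t in E N, extend φ (h t) * ENNReal.ofReal (w t) ∂ν
        ≤ ∑ i ∈ Finset.range (2 * N),
          ENNReal.ofReal (φ (2 * κ (i + 1)) * (W (c (i + 1 + 1)) - W (c (i + 1)))) := by
      rw [hcE, ← sum_lintegral_cell S.meas_pos _ (c := fun i => c (i + 1))
        (fun i j hij => hcmono (Nat.succ_le_succ hij)) (2 * N)]
      refine Finset.sum_le_sum fun i _ => ?_
      rw [ENNReal.ofReal_mul (hφ0 _), ← lintegral_cell_eq S.meas_pos S.cut.nonneg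
        (fun x hx => S.cut.W_nonneg hx) S.intW (hcC _) (hcC _) (hcmono (Nat.le_succ _)),
        ← lintegral_const_mul'' _ S.meas_w.restrict.ennreal_ofReal]
      refine setLIntegral_mono_ae' (measurableSet_cell S.meas_pos _ _) ?_
      filter_upwards [hhn] with t ht htc
      refine mul_le_mul_left ?_ _
      rw [← extend_ofReal (mul_nonneg zero_le_two (hpow _).le)]
      refine extend_mono hφ ((ht _ htc.1).trans (ENNReal.ofReal_le_ofReal (le_of_eq ?_)))
      change (2 : ℝ) ^ ((N : ℤ) - (i : ℕ)) = 2 * (2 : ℝ) ^ ((N : ℤ) - ((i + 1 : ℕ) : ℤ))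
      rw [← zpow_one_add₀ two_ne_zero]
      congr 1
      push_cast
      ring
    refine hsum.trans ?_
    rw [← ENNReal.ofReal_sum_of_nonneg fun i _ => mul_nonneg (hφ0 _) (hW0 _),
      ← ENNReal.ofReal_toReal hB]
    apply ENNReal.ofReal_le_ofReal
    rw [Finset.sum_range_succ'] at hgrid
    have := mul_nonneg (hφ0 0) (hW0 0)
    linarith
  have hmono : Monotone E := fun M N hMN t ht =>
    ⟨(hanti (by exact_mod_cast hMN)).trans_lt ht.1,
      ht.2.trans (hanti (by simpa using hMN))⟩
  calc ∫⁻ t, extend φ (h t) * ENNReal.ofReal (w t) ∂ν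
      ≤ ∫⁻ t, (⋃ N, E N).indicator (fun t => extend φ (h t) * ENNReal.ofReal (w t)) t ∂ν := by
        refine lintegral_mono_ae ?_
        filter_upwards [hhn, S.ae_mem] with t ht htD
        by_cases htE : t ∈ ⋃ N, E N
        · rw [indicator_of_mem htE]
        -- beyond all maximizers `h` vanishes
        have hlt : ∀ N : ℕ, a (-N) < pos t := by
          intro N
          by_contra hcon
          obtain ⟨M, hM⟩ := hsmall _ (S.pos_pos t htD)
          refine htE (mem_iUnion.2 ⟨max M N, (hanti ?_).trans_lt hM, (not_lt.1 hcon).trans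
            (hanti ?_)⟩)
          · exact_mod_cast le_max_left M N
          · exact neg_le_neg (by exact_mod_cast le_max_right M N)
        have h0 : h t = 0 := by
          refine le_antisymm (ge_of_tendsto' (x := atTop)
            (f := fun N : ℕ => ENNReal.ofReal ((2 : ℝ) ^ (-(N : ℤ)))) ?_ fun N => ht _ (hlt N))
            zero_le
          have := tendsto_pow_atTop_nhds_zero_of_lt_one (r := (1 / 2 : ℝ)) (by norm_num)
            (by norm_num)
          have := ENNReal.tendsto_ofReal this
          rw [ENNReal.ofReal_zero] at this
          refine this.congr fun N => ?_
          rw [zpow_neg, zpow_natCast, one_div, inv_pow]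
        rw [h0, extend_zero hφ, zero_mul]
        exact zero_le
    _ = ⨆ N, ∫⁻ t in E N, extend φ (h t) * ENNReal.ofReal (w t) ∂ν := by
        rw [lintegral_indicator (MeasurableSet.iUnion hE), setLIntegral_iUnion_of_directed _
          hmono.directed_le]
    _ ≤ B := iSup_le key

/-- If `∫ φ(4 f / v) v < ∞`, then `f` is integrable wherever `v` is. -/
theorem lintegral_ne_top_of_persp (hφ : IsOrlicz φ) (hf : AEMeasurable f ν) (hv : AEMeasurable v ν)
    (hD : ∀ᵐ t ∂ν, t ∈ D) (hv0 : ∀ t ∈ D, 0 < v t)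
    (hB : ∫⁻ t, persp φ (4 * f t) (v t) ∂ν ≠ ∞) {E : Set T}
    (hvE : ∫⁻ t in E, ENNReal.ofReal (v t) ∂ν ≠ ∞) : ∫⁻ t in E, f t ∂ν ≠ ∞ := by
  intro htop
  have h := lintegral_young hφ hf hv hD hv0 one_pos E
  have h1 : ENNReal.ofReal (4 * φ 1 / 1) ≠ 0 := by
    have := hφ.pos 1 one_pos
    simpa using this
  rw [htop, ENNReal.mul_top h1, top_le_iff] at h
  exact ENNReal.add_ne_top.2 ⟨ne_top_of_le_ne_top hB (setLIntegral_le_lintegral _ _),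
    ENNReal.mul_ne_top ENNReal.ofReal_ne_top hvE⟩ h

/-- If `∫ φ(4 f / v) v < ∞` for some `v ≺ w`, then `F / W → 0` at `∞`. -/
theorem isCoercive_of_weight (hφ : IsOrlicz φ) (S : IsSystem ν pos D C w f F W)
    (hv : AEMeasurable v ν) (hv0 : ∀ t ∈ D, 0 < v t)
    (hvw : ∀ c ∈ C, ∫⁻ t in cell pos 0 c, ENNReal.ofReal (v t) ∂ν
      ≤ ∫⁻ t in cell pos 0 c, ENNReal.ofReal (w t) ∂ν)
    (hB : ∫⁻ t, persp φ (4 * f t) (v t) ∂ν ≠ ∞) (hW : ∀ K : ℝ, ∃ B, ∀ x ∈ C, B < x → K < W x)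
    (ρ : ℝ) (hρ : 0 < ρ) : IsCoercive C F W ρ := by
  set B := ∫⁻ t, persp φ (4 * f t) (v t) ∂ν
  have hφρ := hφ.pos ρ hρ
  obtain ⟨b, hb⟩ := hW (B.toReal / φ ρ)
  refine ⟨b, fun x hx hbx => ?_⟩
  have h := (lintegral_young hφ S.meas_f hv S.ae_mem hv0 hρ (cell pos 0 x)).trans
    (add_le_add (setLIntegral_le_lintegral _ _) (mul_le_mul_right (hvw x hx) _))
  have hWx := S.cut.W_nonneg hx
  rw [S.intF x hx, S.intW x hx] at h
  change _ ≤ B + _ at h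
  rw [← ENNReal.ofReal_toReal hB, ← ENNReal.ofReal_mul (by positivity),
    ← ENNReal.ofReal_mul hφρ.le, ← ENNReal.ofReal_add ENNReal.toReal_nonneg (by positivity),
    ENNReal.ofReal_le_ofReal_iff (by positivity)] at h
  have h2 := hb x hx hbx
  rw [div_lt_iff₀ hφρ] at h2
  have h3 : 4 * φ ρ / ρ * F x < 2 * φ ρ * W x := by
    linarith
  have h4 : 4 * φ ρ / ρ * F x = 4 * φ ρ * (F x / ρ) := by ring
  rw [h4] at h3
  have h5 : F x / ρ < W x := by nlinarith
  rw [div_lt_iff₀ hρ] at h5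
  linarith

/-- If `h` is at least `μ` to the left of the maximizers for the slope `μ`, then
`∫ φ(f / (4 v)) v ≤ ∫ φ(h) w` for some `v ≺ w`. This `v` is half the maximum of `w` and of
`f / 2 ^ (n + 1)`, on the cell of the dyadic grid between the maximizers for the slopes
`2 ^ (n + 1)` and `2 ^ n`. The maximum with `w` makes `v` positive, and decreasing across the
end points of cells. -/
theorem exists_weight (hφ : IsOrlicz φ) (S : IsSystem ν pos D C w f F W)
    (hco : ∀ ρ, 0 < ρ → IsCoercive C F W ρ) {h : T → ℝ≥0∞}
    (hh : ∀ μ, 0 < μ → ∀ x ∈ argmax C F W μ, ∀ᵐ t ∂ν, pos t ≤ x → ENNReal.ofReal μ ≤ h t) :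
    ∃ v : T → ℝ, (∀ t ∈ D, 0 < v t) ∧ (∀ s ∈ D, ∀ t ∈ D, pos s ≤ pos t → v t ≤ v s) ∧
      (∀ c ∈ C, ∫⁻ t in cell pos 0 c, ENNReal.ofReal (v t) ∂ν
        ≤ ∫⁻ t in cell pos 0 c, ENNReal.ofReal (w t) ∂ν) ∧
      ∫⁻ t, persp φ (f t / 4) (v t) ∂ν ≤ ∫⁻ t, extend φ (h t) * ENNReal.ofReal (w t) ∂ν := by
  obtain ⟨a, ha, hanti, hsmall⟩ := exists_dyadic_argmax S.cut hco
  have hpow : ∀ n : ℤ, (0 : ℝ) < (2 : ℝ) ^ n := fun n => by positivity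
  have haC : ∀ n, a n ∈ C := fun n => (ha n).1
  have hmW := S.meas_w.ennreal_ofReal
  set J : ℤ → Set T := fun n => cell pos (a (n + 1)) (a n)
  have hJ : ∀ n, MeasurableSet (J n) := fun n => measurableSet_cell S.meas_pos _ _
  have hJlt : ∀ {m n t}, t ∈ J m → t ∈ J n → ¬ m < n := fun {m n t} hm hn hmn =>
    absurd (hn.2.trans (hanti (show m + 1 ≤ n by lia))) (not_le.2 hm.1)
  have hJeq : ∀ {m n t}, t ∈ J m → t ∈ J n → m = n := fun {m n t} hm hn =>
    le_antisymm (not_lt.1 (hJlt hn hm)) (not_lt.1 (hJlt hm hn))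
  have hdisj : Pairwise (Function.onFun Disjoint J) := fun m n hmn =>
    disjoint_left.2 fun t hm hn => hmn (hJeq hm hn)
  have hcover : ∀ t ∈ D, (∀ n, t ∉ J n) → ∀ n, a n < pos t := by
    intro t ht hnot n
    by_contra hcon
    obtain ⟨N, hN⟩ := hsmall _ (S.pos_pos t ht)
    obtain ⟨m, hm, hmax⟩ := Int.exists_greatest_of_bdd (P := fun n => pos t ≤ a n)
      ⟨N, fun z hz => by
        by_contra hlt
        exact absurd (hz.trans (hanti (not_le.1 hlt).le)) (not_le.2 hN)⟩ ⟨n, not_lt.1 hcon⟩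
    refine hnot m ⟨?_, hm⟩
    by_contra hlt
    have := hmax (m + 1) (not_lt.1 hlt)
    lia
  -- the slope bound on cells, integrated
  have hFW : ∀ n y, y ∈ C → a (n + 1) ≤ y →
      ∫⁻ t in cell pos (a (n + 1)) y, f t ∂ν ≤ ENNReal.ofReal (2 * (2 : ℝ) ^ n) *
        ∫⁻ t in cell pos (a (n + 1)) y, ENNReal.ofReal (w t) ∂ν := by
    intro n y hy hle
    rw [lintegral_cell_eq S.meas_pos S.cut.nonneg (fun x hx => S.cut.F_nonneg hx) S.intF (haC _) hy
        hle,
      lintegral_cell_eq S.meas_pos S.cut.nonneg (fun x hx => S.cut.W_nonneg hx) S.intW (haC _) hy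
        hle, ← ENNReal.ofReal_mul (mul_nonneg zero_le_two (hpow n).le)]
    apply ENNReal.ofReal_le_ofReal
    have := (ha (n + 1)).2 y hy
    rw [zpow_add_one₀ two_ne_zero] at this
    linarith
  have hfw : ∀ n, ∀ s ∈ D, ∀ t ∈ D, pos s ≤ a (n + 1) → a (n + 1) < pos t →
      f t / ENNReal.ofReal (2 * (2 : ℝ) ^ n) ≤ ENNReal.ofReal (w s) := by
    intro n s hs t ht hsn hnt
    have hm0 := S.cell_pos _ (haC (n + 1)) t ht hnt
    have hmt := S.cell_fin _ (haC (n + 1)) t ht hnt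
    have hms := measurableSet_cell S.meas_pos (a (n + 1)) (pos t)
    have h1 : f t * ν (cell pos (a (n + 1)) (pos t))
        ≤ ∫⁻ u in cell pos (a (n + 1)) (pos t), f u ∂ν := by
      rw [← setLIntegral_const]
      refine setLIntegral_mono_ae' hms ?_
      filter_upwards [S.ae_mem] with u hu huc
      exact S.f_anti u hu t ht huc.2
    have h2 : ∫⁻ u in cell pos (a (n + 1)) (pos t), ENNReal.ofReal (w u) ∂ν
        ≤ ENNReal.ofReal (w s) * ν (cell pos (a (n + 1)) (pos t)) := by
      rw [← setLIntegral_const]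
      refine setLIntegral_mono_ae' hms ?_
      filter_upwards [S.ae_mem] with u hu huc
      exact ENNReal.ofReal_le_ofReal (S.w_anti s hs u hu (hsn.trans huc.1.le))
    have h3 := h1.trans ((hFW n _ (S.pos_mem t ht) hnt.le).trans (mul_le_mul_right h2 _))
    rw [← mul_assoc] at h3
    refine ENNReal.div_le_of_le_mul' ((ENNReal.mul_le_mul_iff_left hm0 hmt).1 h3)
  set u : T → ℝ≥0∞ := fun t =>
    ⨆ n : ℤ, (J n).indicator (fun t => f t / ENNReal.ofReal (2 * (2 : ℝ) ^ n)) t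
  have hu : ∀ n, ∀ t ∈ J n, u t = f t / ENNReal.ofReal (2 * (2 : ℝ) ^ n) := by
    intro n t ht
    refine le_antisymm (iSup_le fun m => ?_) (le_iSup_of_le n (by rw [indicator_of_mem ht]))
    by_cases hm : t ∈ J m
    · rw [indicator_of_mem hm, hJeq hm ht]
    · rw [indicator_of_notMem hm]; exact zero_le
  have hu0 : ∀ t, (∀ n, t ∉ J n) → u t = 0 := fun t ht => by
    simp only [u]
    exact le_antisymm (iSup_le fun n => by rw [indicator_of_notMem (ht n)]) zero_le
  have hpow2 : ∀ n : ℤ, ENNReal.ofReal (2 * (2 : ℝ) ^ n) ≠ 0 := fun n => by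
    simpa using hpow n
  have hffin : ∀ t ∈ D, f t ≠ ∞ := by
    intro t ht htop
    have hm0 := S.cell_pos 0 S.cut.zero t ht (S.pos_pos t ht)
    have h1 : f t * ν (cell pos 0 (pos t)) ≤ ∫⁻ u in cell pos 0 (pos t), f u ∂ν := by
      rw [← setLIntegral_const]
      refine setLIntegral_mono_ae' (measurableSet_cell S.meas_pos _ _) ?_
      filter_upwards [S.ae_mem] with u hu huc
      exact S.f_anti u hu t ht huc.2
    rw [htop, ENNReal.top_mul hm0, S.intF _ (S.pos_mem t ht)] at h1
    exact ENNReal.ofReal_ne_top (top_le_iff.1 h1)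
  have hufin : ∀ t ∈ D, u t ≠ ∞ := by
    intro t ht
    by_cases hex : ∃ n, t ∈ J n
    · obtain ⟨n, hn⟩ := hex
      rw [hu n t hn]
      exact ENNReal.div_ne_top (hffin t ht) (hpow2 n)
    · push Not at hex
      rw [hu0 t hex]; exact ENNReal.zero_ne_top
  set v : T → ℝ := fun t => max (w t) (u t).toReal / 2
  have hv0 : ∀ t ∈ D, 0 < v t := fun t ht =>
    half_pos (lt_max_of_lt_left (S.w_pos t ht))
  have hvle : ∀ t ∈ D, 2 * ENNReal.ofReal (v t) ≤ ENNReal.ofReal (w t) + u t := by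
    intro t ht
    have e : (2 : ℝ≥0∞) = ENNReal.ofReal 2 := by norm_num
    rw [← ENNReal.ofReal_toReal (hufin t ht), e, ← ENNReal.ofReal_mul zero_le_two,
      ← ENNReal.ofReal_add (S.w_pos t ht).le ENNReal.toReal_nonneg]
    apply ENNReal.ofReal_le_ofReal
    simp only [v]
    rw [mul_div_cancel₀ _ two_ne_zero]
    exact max_le (by linarith [ENNReal.toReal_nonneg (a := u t)])
      (by linarith [S.w_pos t ht])
  have hcellv : ∀ n y, y ∈ C → a (n + 1) ≤ y → y ≤ a n →
      ∫⁻ t in cell pos (a (n + 1)) y, ENNReal.ofReal (v t) ∂ν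
        ≤ ∫⁻ t in cell pos (a (n + 1)) y, ENNReal.ofReal (w t) ∂ν := by
    intro n y hy h1 h2
    have h3 : ∫⁻ t in cell pos (a (n + 1)) y, u t ∂ν
        ≤ ∫⁻ t in cell pos (a (n + 1)) y, ENNReal.ofReal (w t) ∂ν := by
      calc ∫⁻ t in cell pos (a (n + 1)) y, u t ∂ν
          = ∫⁻ t in cell pos (a (n + 1)) y, (ENNReal.ofReal (2 * (2 : ℝ) ^ n))⁻¹ * f t ∂ν := by
            refine setLIntegral_congr_fun (measurableSet_cell S.meas_pos _ _) fun t ht => ?_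
            rw [mul_comm, ← div_eq_mul_inv]
            exact hu n t ⟨ht.1, ht.2.trans h2⟩
        _ = (ENNReal.ofReal (2 * (2 : ℝ) ^ n))⁻¹ * ∫⁻ t in cell pos (a (n + 1)) y, f t ∂ν :=
            lintegral_const_mul'' _ S.meas_f.restrict
        _ ≤ (ENNReal.ofReal (2 * (2 : ℝ) ^ n))⁻¹ * (ENNReal.ofReal (2 * (2 : ℝ) ^ n) *
              ∫⁻ t in cell pos (a (n + 1)) y, ENNReal.ofReal (w t) ∂ν) := by
            gcongr; exact hFW n y hy h1
        _ = ∫⁻ t in cell pos (a (n + 1)) y, ENNReal.ofReal (w t) ∂ν := by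
            rw [← mul_assoc, ENNReal.inv_mul_cancel (hpow2 n) ENNReal.ofReal_ne_top, one_mul]
    have h4 : 2 * ∫⁻ t in cell pos (a (n + 1)) y, ENNReal.ofReal (v t) ∂ν
        ≤ 2 * ∫⁻ t in cell pos (a (n + 1)) y, ENNReal.ofReal (w t) ∂ν := by
      rw [← lintegral_const_mul' _ _ (by norm_num)]
      calc ∫⁻ t in cell pos (a (n + 1)) y, 2 * ENNReal.ofReal (v t) ∂ν
          ≤ ∫⁻ t in cell pos (a (n + 1)) y, (ENNReal.ofReal (w t) + u t) ∂ν := by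
            refine lintegral_mono_ae ?_
            filter_upwards [ae_restrict_of_ae S.ae_mem] with t ht using hvle t ht
        _ = ∫⁻ t in cell pos (a (n + 1)) y, ENNReal.ofReal (w t) ∂ν
            + ∫⁻ t in cell pos (a (n + 1)) y, u t ∂ν := lintegral_add_left' hmW.restrict _
        _ ≤ _ := by rw [two_mul]; exact add_le_add_right h3 _
    exact (ENNReal.mul_le_mul_iff_right two_ne_zero (by norm_num)).1 h4
  have hvw0 : ∀ t ∈ D, (∀ n, t ∉ J n) → v t ≤ w t := by
    intro t ht hnot
    simp only [v]
    rw [hu0 t hnot, ENNReal.toReal_zero, max_eq_left (S.w_pos t ht).le]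
    linarith [S.w_pos t ht]
  have hvcell : ∀ c ∈ C, ∫⁻ t in cell pos 0 c, ENNReal.ofReal (v t) ∂ν
      ≤ ∫⁻ t in cell pos 0 c, ENNReal.ofReal (w t) ∂ν := by
    intro c hc
    refine lintegral_le_of_partition hJ hdisj (measurableSet_cell S.meas_pos _ _) (fun n => ?_) ?_
    · have e : J n ∩ cell pos 0 c = cell pos (a (n + 1)) (min (a n) c) := by
        ext t
        simp only [J, cell, mem_inter_iff, mem_ofPred_eq, le_min_iff]
        exact ⟨fun h => ⟨h.1.1, h.1.2, h.2.2⟩, fun h => ⟨⟨h.1, h.2.1⟩,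
          (S.cut.nonneg _ (haC _)).trans_lt h.1, h.2.2⟩⟩
      rw [e]
      rcases le_or_gt (a (n + 1)) (min (a n) c) with hle | hlt
      · refine hcellv n _ ?_ hle (min_le_left _ _)
        rcases min_choice (a n) c with h | h <;> rw [h]
        · exact haC n
        · exact hc
      · have : cell pos (a (n + 1)) (min (a n) c) = ∅ :=
          eq_empty_of_forall_notMem fun t ht => absurd (ht.1.trans_le ht.2) (not_lt.2 hlt.le)
        simp [this]
    · filter_upwards [S.ae_mem] with t ht hnot
      exact ENNReal.ofReal_le_ofReal (hvw0 t ht hnot)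
  -- `f` vanishes beyond all maximizers
  have hf0 : ∀ᵐ t ∂ν, (∀ n, t ∉ J n) → f t = 0 := by
    obtain ⟨e, heC, he⟩ := S.exhaust
    have hZ : ∀ k, ∀ᵐ t ∂ν, (∀ n, a n < pos t) → pos t ≤ e k → f t = 0 := by
      intro k
      set Z : Set T := {t | (∀ n, a n < pos t) ∧ pos t ≤ e k}
      have hZm : MeasurableSet Z := by
        have : Z = (⋂ n, {t | a n < pos t}) ∩ {t | pos t ≤ e k} := by
          ext t; simp [Z]
        rw [this]
        exact (MeasurableSet.iInter fun n => measurableSet_lt measurable_const S.meas_pos).inter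
          (measurableSet_le S.meas_pos measurable_const)
      have hle : ∀ N : ℕ, ∫⁻ t in Z, f t ∂ν
          ≤ ENNReal.ofReal (2 * (1 / 2 : ℝ) ^ N) * ENNReal.ofReal (W (e k)) := by
        intro N
        rcases le_or_gt (a (-(N : ℤ) + 1)) (e k) with h1 | h1
        · calc ∫⁻ t in Z, f t ∂ν ≤ ∫⁻ t in cell pos (a (-(N : ℤ) + 1)) (e k), f t ∂ν :=
                lintegral_mono_set fun t ht => ⟨ht.1 _, ht.2⟩
            _ ≤ _ := hFW _ _ (heC k) h1
            _ ≤ _ := by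
                rw [zpow_neg, zpow_natCast, one_div, inv_pow, ← S.intW _ (heC k)]
                have hsub : cell pos (a (-(N : ℤ) + 1)) (e k) ⊆ cell pos 0 (e k) := fun t ht =>
                  ⟨(S.cut.nonneg _ (haC _)).trans_lt ht.1, ht.2⟩
                exact mul_le_mul_right (lintegral_mono_set hsub) _
        · have : Z = ∅ := eq_empty_of_forall_notMem fun t ht =>
            absurd ((ht.1 (-(N : ℤ) + 1)).trans_le ht.2) (not_lt.2 h1.le)
          simp [this]
      have h0 : ∫⁻ t in Z, f t ∂ν = 0 := by
        refine le_antisymm (ge_of_tendsto' (x := atTop) ?_ hle) zero_le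
        have h1 := (tendsto_pow_atTop_nhds_zero_of_lt_one (r := (1 / 2 : ℝ)) (by norm_num)
          (by norm_num)).const_mul 2
        have h2 := ENNReal.Tendsto.mul_const (b := ENNReal.ofReal (W (e k)))
          (ENNReal.tendsto_ofReal h1) (Or.inr ENNReal.ofReal_ne_top)
        simpa using h2
      rw [lintegral_eq_zero_iff' S.meas_f.restrict, Filter.EventuallyEq,
        ae_restrict_iff' hZm] at h0
      filter_upwards [h0] with t ht h1 h2 using ht ⟨h1, h2⟩
    filter_upwards [ae_all_iff.2 hZ, S.ae_mem] with t h1 ht hnot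
    obtain ⟨k, hk⟩ := he t ht
    exact h1 k (hcover t ht hnot) hk
  refine ⟨v, hv0, ?_, hvcell, ?_⟩
  · intro s hs t ht hst
    have hws := S.w_anti s hs t ht hst
    refine div_le_div_of_nonneg_right (max_le (hws.trans (le_max_left _ _)) ?_) zero_le_two
    by_cases hex : ∃ n, t ∈ J n
    · obtain ⟨n, hn⟩ := hex
      rw [hu n t hn]
      rcases lt_or_ge (a (n + 1)) (pos s) with h1 | h1
      · refine le_trans ?_ (le_max_right _ _)
        refine ENNReal.toReal_mono (hufin s hs) ?_
        rw [hu n s ⟨h1, hst.trans hn.2⟩]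
        exact ENNReal.div_le_div_right (S.f_anti s hs t ht hst) _
      · refine le_trans ?_ (le_max_left _ _)
        refine ENNReal.toReal_le_of_le_ofReal (S.w_pos s hs).le (hfw n s hs t ht h1 hn.1)
    · push Not at hex
      rw [hu0 t hex, ENNReal.toReal_zero]
      exact (S.w_pos s hs).le.trans (le_max_left _ _)
  · rw [← setLIntegral_univ, ← setLIntegral_univ (fun t => extend φ (h t) * _)]
    refine lintegral_le_of_partition hJ hdisj MeasurableSet.univ (fun n => ?_) ?_
    · rw [inter_univ]
      have hmono := hanti (show n ≤ n + 1 by lia)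
      calc ∫⁻ t in J n, persp φ (f t / 4) (v t) ∂ν
          ≤ ∫⁻ t in J n, ENNReal.ofReal (φ ((2 : ℝ) ^ n)) * ENNReal.ofReal (v t) ∂ν := by
            refine setLIntegral_mono_ae' (hJ n) ?_
            filter_upwards [S.ae_mem] with t ht htJ
            refine mul_le_mul_left ?_ _
            rw [← extend_ofReal (hpow n).le]
            refine extend_mono hφ (ENNReal.div_le_of_le_mul' ?_)
            rw [← ENNReal.ofReal_mul' (hpow n).le]
            -- on the cell, `v ≥ f / 2 ^ (n + 2)`
            have h1 : (u t).toReal / 2 ≤ v t :=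
              div_le_div_of_nonneg_right (le_max_right _ _) zero_le_two
            rw [hu n t htJ, ENNReal.toReal_div,
              ENNReal.toReal_ofReal (mul_nonneg zero_le_two (hpow n).le)] at h1
            rw [← ENNReal.ofReal_toReal (ENNReal.div_ne_top (hffin t ht) four_ne_zero)]
            apply ENNReal.ofReal_le_ofReal
            rw [ENNReal.toReal_div]
            have hp := hpow n
            have h2 : (f t).toReal / (2 * 2 ^ n) / 2 = (f t).toReal / 4 / 2 ^ n := by
              field_simp; norm_num
            rw [h2, div_le_iff₀ hp] at h1
            simpa using h1
        _ = ENNReal.ofReal (φ ((2 : ℝ) ^ n)) * ∫⁻ t in J n, ENNReal.ofReal (v t) ∂ν :=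
            lintegral_const_mul' _ _ ENNReal.ofReal_ne_top
        _ ≤ ENNReal.ofReal (φ ((2 : ℝ) ^ n)) * ∫⁻ t in J n, ENNReal.ofReal (w t) ∂ν :=
            mul_le_mul_right (hcellv n _ (haC n) hmono le_rfl) _
        _ = ∫⁻ t in J n, ENNReal.ofReal (φ ((2 : ℝ) ^ n)) * ENNReal.ofReal (w t) ∂ν :=
            (lintegral_const_mul' _ _ ENNReal.ofReal_ne_top).symm
        _ ≤ ∫⁻ t in J n, extend φ (h t) * ENNReal.ofReal (w t) ∂ν := by
            refine setLIntegral_mono_ae' (hJ n) ?_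
            filter_upwards [hh _ (hpow n) _ (ha n)] with t ht htJ
            refine mul_le_mul_left ?_ _
            rw [← extend_ofReal (hpow n).le]
            exact extend_mono hφ (ht htJ.2)
    · filter_upwards [hf0] with t ht hnot
      rw [ht hnot, ENNReal.zero_div, persp_zero hφ]
      exact zero_le

end Comparison

/-! ### Primitives on the interval `[0, γ)` -/

section Interval

theorem measurableSet_seg (a b : ℝ≥0∞) : MeasurableSet (seg a b) :=
  (measurableSet_lt measurable_const ENNReal.measurable_ofReal).inter
    (measurableSet_lt ENNReal.measurable_ofReal measurable_const)

theorem seg_ofReal {a : ℝ} (ha : 0 ≤ a) (b : ℝ) :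
    seg (ENNReal.ofReal a) (ENNReal.ofReal b) = Ioo a b := by
  ext s
  constructor
  · rintro ⟨h1, h2⟩
    have h1' := (ENNReal.ofReal_lt_ofReal_iff_of_nonneg ha).1 h1
    exact ⟨h1', (ENNReal.ofReal_lt_ofReal_iff_of_nonneg (ha.trans h1'.le)).1 h2⟩
  · rintro ⟨h1, h2⟩
    exact ⟨(ENNReal.ofReal_lt_ofReal_iff_of_nonneg ha).2 h1,
      (ENNReal.ofReal_lt_ofReal_iff_of_nonneg (ha.trans h1.le)).2 h2⟩

theorem lintegral_seg {a : ℝ} (ha : 0 ≤ a) (b : ℝ) (g : ℝ → ℝ≥0∞) :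
    ∫⁻ s in seg (ENNReal.ofReal a) (ENNReal.ofReal b), g s = ∫⁻ s in Ioc a b, g s := by
  rw [seg_ofReal ha]
  exact setLIntegral_congr Ioo_ae_eq_Ioc

theorem lintegral_seg_zero (b : ℝ) (g : ℝ → ℝ≥0∞) :
    ∫⁻ s in seg 0 (ENNReal.ofReal b), g s = ∫⁻ s in Ioc 0 b, g s := by
  rw [← lintegral_seg le_rfl, ENNReal.ofReal_zero]

/-- The end points of intervals: `[0, γ]`, or `[0, ∞)` in case `γ = ∞`. -/
def cutSet (γ : ℝ≥0∞) : Set ℝ := {x | 0 ≤ x ∧ ENNReal.ofReal x ≤ γ}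

/-- The primitive `x ↦ ∫₀ˣ g`. -/
noncomputable def prim (g : ℝ → ℝ≥0∞) (x : ℝ) : ℝ := (∫⁻ s in Ioc 0 x, g s).toReal

variable {γ : ℝ≥0∞} {w : ℝ → ℝ} {f : ℝ → ℝ≥0∞}

theorem cutSet_closed (γ : ℝ≥0∞) : IsClosed (cutSet γ) :=
  isClosed_Ici.inter (isClosed_Iic.preimage ENNReal.continuous_ofReal)

theorem mem_cutSet_of_le {x y : ℝ} (hy : y ∈ cutSet γ) (hx : 0 ≤ x) (h : x ≤ y) : x ∈ cutSet γ :=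
  ⟨hx, (ENNReal.ofReal_le_ofReal h).trans hy.2⟩

theorem mem_cutSet_of_mem_seg {x : ℝ} (hx : x ∈ seg 0 γ) : x ∈ cutSet γ :=
  ⟨(ENNReal.ofReal_pos.1 hx.1).le, hx.2.le⟩

theorem pos_of_mem_seg {x : ℝ} (hx : x ∈ seg 0 γ) : 0 < x := ENNReal.ofReal_pos.1 hx.1

theorem mem_seg_of_lt {x y : ℝ} (hy : y ∈ cutSet γ) (hx : 0 < x) (h : x < y) : x ∈ seg 0 γ :=
  ⟨ENNReal.ofReal_pos.2 hx, lt_of_lt_of_le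
    ((ENNReal.ofReal_lt_ofReal_iff (hx.trans h)).2 h) hy.2⟩

/-- Integrals over cells of `leb γ`, as integrals over half-open intervals. -/
theorem lintegral_cell_leb {a b : ℝ} (ha : 0 ≤ a) (hb : b ∈ cutSet γ) (g : ℝ → ℝ≥0∞) :
    ∫⁻ t in cell id a b, g t ∂(leb γ) = ∫⁻ t in Ioc a b, g t := by
  rw [leb, Measure.restrict_restrict (measurableSet_cell measurable_id a b)]
  refine setLIntegral_congr ?_
  have : ∀ᵐ t : ℝ, t ≠ b := by simp [ae_iff]
  filter_upwards [this] with t ht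
  apply propext
  exact ⟨fun h => ⟨h.1.1, h.1.2⟩, fun h => ⟨⟨h.1, h.2⟩,
    mem_seg_of_lt hb (ha.trans_lt h.1) (lt_of_le_of_ne h.2 ht)⟩⟩

theorem aemeasurable_leb {v : ℝ → ℝ} (hv : AntitoneOn v (seg 0 γ)) :
    AEMeasurable v (leb γ) :=
  aemeasurable_restrict_of_antitoneOn (measurableSet_seg _ _) hv

theorem aemeasurable_Ioc {v : ℝ → ℝ} (hv : AntitoneOn v (seg 0 γ)) {a b : ℝ} (ha : 0 ≤ a)
    (hb : b ∈ cutSet γ) : AEMeasurable v (volume.restrict (Ioc a b)) := by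
  rw [← restrict_Ioo_eq_restrict_Ioc]
  exact aemeasurable_restrict_of_antitoneOn measurableSet_Ioo
    (hv.mono fun t ht => mem_seg_of_lt hb (ha.trans_lt ht.1) ht.2)

theorem IsWeight.lintegral_ne_top (hw : IsWeight γ w) {c : ℝ} (hc : c ∈ cutSet γ) :
    ∫⁻ s in Ioc 0 c, ENNReal.ofReal (w s) ≠ ∞ := by
  rcases hc.1.eq_or_lt with rfl | h0
  · simp
  have hh : c / 2 ∈ seg 0 γ := mem_seg_of_lt hc (half_pos h0) (half_lt_self h0)
  have h1 : ∫⁻ s in Ioc 0 (c / 2), ENNReal.ofReal (w s) ≠ ∞ := by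
    rw [← lintegral_seg_zero]
    exact (hw.locInt _ hh.2).ne
  have h2 : ∫⁻ s in Ioc (c / 2) c, ENNReal.ofReal (w s) ≠ ∞ := by
    rw [setLIntegral_congr (Ioo_ae_eq_Ioc (a := c / 2) (b := c)).symm]
    refine ne_top_of_le_ne_top (b := ∫⁻ _ in Ioo (c / 2) c, ENNReal.ofReal (w (c / 2))) ?_
      (setLIntegral_mono' measurableSet_Ioo fun t ht => ENNReal.ofReal_le_ofReal
        (hw.anti hh (mem_seg_of_lt hc ((half_pos h0).trans ht.1) ht.2) ht.1.le))
    rw [setLIntegral_const]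
    exact ENNReal.mul_ne_top ENNReal.ofReal_ne_top (by simp)
  have h3 : Ioc 0 c = Ioc 0 (c / 2) ∪ Ioc (c / 2) c :=
    (Ioc_union_Ioc_eq_Ioc (half_pos h0).le (half_lt_self h0).le).symm
  rw [h3]
  exact ne_top_of_le_ne_top (ENNReal.add_ne_top.2 ⟨h1, h2⟩) (lintegral_union_le _ _ _)

theorem prim_continuousOn {g : ℝ → ℝ≥0∞} (hg : ∀ c ∈ cutSet γ, ∫⁻ s in Ioc 0 c, g s ≠ ∞)
    (hm : ∀ c ∈ cutSet γ, AEMeasurable g (volume.restrict (Ioc 0 c))) :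
    ContinuousOn (prim g) (cutSet γ) := by
  have hIcc : ∀ c ∈ cutSet γ, ContinuousOn (prim g) (Icc 0 c) := by
    intro c hc
    have hint : IntegrableOn (fun s => (g s).toReal) (Icc 0 c) := by
      rw [integrableOn_Icc_iff_integrableOn_Ioc]
      exact integrable_toReal_of_lintegral_ne_top (hm c hc) (hg c hc)
    refine (intervalIntegral.continuousOn_primitive hint).congr fun x hx => ?_
    have hxC := mem_cutSet_of_le hc hx.1 hx.2
    exact (integral_toReal (hm x hxC) (ae_lt_top' (hm x hxC) (hg x hxC))).symm
  intro x hx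
  by_cases h : ∃ c ∈ cutSet γ, x < c
  · obtain ⟨c, hc, hxc⟩ := h
    refine (hIcc c hc x ⟨hx.1, hxc.le⟩).mono_of_mem_nhdsWithin ?_
    filter_upwards [self_mem_nhdsWithin, mem_nhdsWithin_of_mem_nhds (Iio_mem_nhds hxc)]
      with y hy hyc
    exact ⟨hy.1, le_of_lt hyc⟩
  · push Not at h
    exact (hIcc x hx x ⟨hx.1, le_rfl⟩).mono fun y hy => ⟨hy.1, h y hy⟩

theorem prim_mono {g : ℝ → ℝ≥0∞} (hg : ∀ c ∈ cutSet γ, ∫⁻ s in Ioc 0 c, g s ≠ ∞) :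
    MonotoneOn (prim g) (cutSet γ) := fun _ _ y hy hxy =>
  ENNReal.toReal_mono (hg y hy) (lintegral_mono_set fun _ ht => ⟨ht.1, ht.2.trans hxy⟩)

theorem lintegral_Ioc_eq {g : ℝ → ℝ≥0∞} (hg : ∀ c ∈ cutSet γ, ∫⁻ s in Ioc 0 c, g s ≠ ∞) {a b : ℝ}
    (ha : a ∈ cutSet γ) (hb : b ∈ cutSet γ) (hab : a ≤ b) :
    ∫⁻ s in Ioc a b, g s = ENNReal.ofReal (prim g b - prim g a) := by
  rw [← lintegral_cell_leb ha.1 hb]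
  refine lintegral_cell_eq (G := prim g) measurable_id (fun x hx => hx.1)
    (fun _ _ => ENNReal.toReal_nonneg) (fun c hc => ?_) ha hb hab
  rw [lintegral_cell_leb le_rfl hc, prim, ENNReal.ofReal_toReal (hg c hc)]

/-- The primitive of the weight. -/
noncomputable abbrev primW (w : ℝ → ℝ) : ℝ → ℝ := prim fun s => ENNReal.ofReal (w s)

/-- Bounds for increments of the primitive of an antitone function. -/
theorem prim_sub_le_of_le {g : ℝ → ℝ≥0∞} (hg : ∀ c ∈ cutSet γ, ∫⁻ s in Ioc 0 c, g s ≠ ∞) {a b : ℝ}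
    (ha : a ∈ cutSet γ) (hb : b ∈ cutSet γ) (hab : a ≤ b) {K : ℝ} (hK : 0 ≤ K)
    (h : ∀ t, a < t → t < b → g t ≤ ENNReal.ofReal K) : prim g b - prim g a ≤ K * (b - a) := by
  have h1 := lintegral_Ioc_eq hg ha hb hab
  have h2 : ∫⁻ s in Ioc a b, g s ≤ ENNReal.ofReal (K * (b - a)) := by
    rw [setLIntegral_congr (Ioo_ae_eq_Ioc (a := a) (b := b)).symm, ENNReal.ofReal_mul hK,
      ← Real.volume_Ioo, ← setLIntegral_const]
    exact setLIntegral_mono' measurableSet_Ioo fun t ht => h t ht.1 ht.2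
  rw [h1] at h2
  exact (ENNReal.ofReal_le_ofReal_iff (mul_nonneg hK (sub_nonneg.2 hab))).1 h2

theorem le_prim_sub_of_le {g : ℝ → ℝ≥0∞} (hg : ∀ c ∈ cutSet γ, ∫⁻ s in Ioc 0 c, g s ≠ ∞) {a b : ℝ}
    (ha : a ∈ cutSet γ) (hb : b ∈ cutSet γ) (hab : a ≤ b) {K : ℝ} (hK : 0 ≤ K)
    (h : ∀ t, a < t → t < b → ENNReal.ofReal K ≤ g t) : K * (b - a) ≤ prim g b - prim g a := by
  have h1 := lintegral_Ioc_eq hg ha hb hab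
  have h2 : ENNReal.ofReal (K * (b - a)) ≤ ∫⁻ s in Ioc a b, g s := by
    rw [setLIntegral_congr (Ioo_ae_eq_Ioc (a := a) (b := b)).symm, ENNReal.ofReal_mul hK,
      ← Real.volume_Ioo, ← setLIntegral_const]
    exact setLIntegral_mono' measurableSet_Ioo fun t ht => h t ht.1 ht.2
  rw [h1] at h2
  exact (ENNReal.ofReal_le_ofReal_iff (sub_nonneg.2 (prim_mono hg ha hb hab))).1 h2

theorem isCut_prim (hw : IsWeight γ w) (hf : Antitone f)
    (hF : ∀ c ∈ cutSet γ, ∫⁻ s in Ioc 0 c, f s ≠ ∞) :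
    IsCut (cutSet γ) (prim f) (primW w) where
  closed := cutSet_closed γ
  nonneg := fun _ hx => hx.1
  zero := ⟨le_rfl, by simp⟩
  contF := prim_continuousOn hF fun _ _ => hf.measurable.aemeasurable
  contW := prim_continuousOn (fun _ hc => hw.lintegral_ne_top hc)
    fun _ hc => (aemeasurable_Ioc hw.anti le_rfl hc).ennreal_ofReal
  monoF := prim_mono hF
  monoW := by
    intro a ha b hb hab
    set m := (a + b) / 2
    have ham : a < m := left_lt_add_div_two.2 hab
    have hmb : m < b := add_div_two_lt_right.2 hab
    have hm : m ∈ seg 0 γ := mem_seg_of_lt hb (ha.1.trans_lt ham) hmb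
    have hmC := mem_cutSet_of_mem_seg hm
    have hg : ∀ c ∈ cutSet γ, ∫⁻ s in Ioc 0 c, ENNReal.ofReal (w s) ≠ ∞ :=
      fun _ hc => hw.lintegral_ne_top hc
    have h1 := le_prim_sub_of_le hg ha hmC ham.le (hw.pos m hm).le fun t hat htm =>
      ENNReal.ofReal_le_ofReal (hw.anti (mem_seg_of_lt hmC (ha.1.trans_lt hat) htm) hm htm.le)
    have h2 := prim_mono hg hmC hb hmb.le
    have h3 := mul_pos (hw.pos m hm) (sub_pos.2 ham)
    linarith
  F_zero := by simp [prim]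
  W_zero := by simp [prim]

theorem isSystem_prim (hw : IsWeight γ w) (hf : Antitone f)
    (hF : ∀ c ∈ cutSet γ, ∫⁻ s in Ioc 0 c, f s ≠ ∞) :
    IsSystem (leb γ) id (seg 0 γ) (cutSet γ) w f (prim f) (primW w) where
  cut := isCut_prim hw hf hF
  ae_mem := ae_restrict_mem (measurableSet_seg _ _)
  meas_pos := measurable_id
  pos_mem := fun _ ht => mem_cutSet_of_mem_seg ht
  pos_pos := fun _ ht => pos_of_mem_seg ht
  w_pos := hw.pos
  w_anti := fun _ hs _ ht hst => hw.anti hs ht hst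
  f_anti := fun _ _ _ _ hst => hf hst
  meas_w := aemeasurable_leb hw.anti
  meas_f := hf.measurable.aemeasurable
  intF := fun c hc => by
    rw [lintegral_cell_leb le_rfl hc, prim, ENNReal.ofReal_toReal (hF c hc)]
  intW := fun c hc => by
    rw [lintegral_cell_leb le_rfl hc, primW, prim, ENNReal.ofReal_toReal (hw.lintegral_ne_top hc)]
  cell_pos := fun x hx t ht hxt => by
    have := lintegral_cell_leb (γ := γ) hx.1 (mem_cutSet_of_mem_seg ht) fun _ => 1
    rw [setLIntegral_one, setLIntegral_one] at this
    rw [id, this]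
    simpa using hxt
  cell_fin := fun x hx t ht hxt => by
    have := lintegral_cell_leb (γ := γ) hx.1 (mem_cutSet_of_mem_seg ht) fun _ => 1
    rw [setLIntegral_one, setLIntegral_one] at this
    rw [id, this]
    simp
  exhaust := by
    by_cases hγ : γ = ∞
    · exact ⟨fun n => n, fun n => ⟨n.cast_nonneg, by simp [hγ]⟩, fun t _ => exists_nat_ge t⟩
    · refine ⟨fun _ => γ.toReal, fun _ => ⟨ENNReal.toReal_nonneg, by
        rw [ENNReal.ofReal_toReal hγ]⟩, fun t ht => ⟨0, ?_⟩⟩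
      exact (ENNReal.ofReal_le_iff_le_toReal hγ).1 ht.2.le

theorem seg_zero_top : seg 0 ∞ = Ioi 0 := by
  ext s; simp [seg]

/-- `W(∞) = ∞`. -/
theorem primW_tendsto (hw : IsWeight ∞ w) : Tendsto (primW w) atTop atTop := by
  have hfin : ∀ c ∈ cutSet ∞, ∫⁻ s in Ioc 0 c, ENNReal.ofReal (w s) ≠ ∞ :=
    fun _ hc => hw.lintegral_ne_top hc
  have hmem : ∀ x : ℝ, 0 ≤ x → x ∈ cutSet ∞ := fun x hx => ⟨hx, le_top⟩
  rw [tendsto_atTop_atTop]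
  by_contra hcon
  push Not at hcon
  obtain ⟨K, hK⟩ := hcon
  have hle : ∀ x, 0 ≤ x → primW w x ≤ K := fun x hx => by
    obtain ⟨y, hxy, hy⟩ := hK x
    exact (prim_mono hfin (hmem x hx) (hmem y (hx.trans hxy)) hxy).trans hy.le
  have htot := hw.total rfl
  have hU : seg 0 ∞ = ⋃ n : ℕ, Ioc (0 : ℝ) n := by
    rw [seg_zero_top]
    ext s
    simp only [mem_Ioi, mem_iUnion, mem_Ioc]
    exact ⟨fun h => (exists_nat_ge s).imp fun n hn => ⟨h, hn⟩, fun ⟨_, h⟩ => h.1⟩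
  have hmono : Monotone fun n : ℕ => Ioc (0 : ℝ) n := fun m n hmn =>
    Ioc_subset_Ioc_right (by exact_mod_cast hmn)
  rw [hU, setLIntegral_iUnion_of_directed _ hmono.directed_le] at htot
  have : (⨆ n : ℕ, ∫⁻ s in Ioc (0 : ℝ) n, ENNReal.ofReal (w s)) ≤ ENNReal.ofReal K := by
    refine iSup_le fun n => ?_
    rw [← ENNReal.ofReal_toReal (hfin n (hmem n n.cast_nonneg))]
    exact ENNReal.ofReal_le_ofReal (hle n n.cast_nonneg)
  rw [htot, top_le_iff] at this
  exact ENNReal.ofReal_ne_top this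

theorem isExhausting_top (hw : IsWeight ∞ w) :
    IsExhausting (cutSet ∞) (primW w) atTop (fun t : ℝ => t) where
  mem := by
    filter_upwards [eventually_ge_atTop 0] with t ht using ⟨ht, le_top⟩
  tendsto := tendsto_id
  tendstoW := primW_tendsto hw
  cofinal := fun p hp => by
    obtain ⟨B, hB⟩ := eventually_atTop.1 hp
    exact ⟨B, fun x _ hx => hB x hx.le⟩

theorem exists_primW_gt (hw : IsWeight γ w) (K : ℝ) :
    ∃ B, ∀ x ∈ cutSet γ, B < x → K < primW w x := by
  by_cases hγ : γ = ∞
  · subst hγ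
    obtain ⟨B, hB⟩ := eventually_atTop.1 ((primW_tendsto hw).eventually_gt_atTop K)
    exact ⟨B, fun x _ hx => hB x hx.le⟩
  · refine ⟨γ.toReal, fun x hx hlt => absurd hx.2 (not_le.2 ?_)⟩
    exact (ENNReal.lt_ofReal_iff_toReal_lt hγ).2 hlt

theorem isCoercive_of_ne_top {F W : ℝ → ℝ} (hγ : γ ≠ ∞) (ρ : ℝ) : IsCoercive (cutSet γ) F W ρ :=
  ⟨γ.toReal, fun _ hx hlt => absurd hx.2 (not_le.2
    ((ENNReal.lt_ofReal_iff_toReal_lt hγ).2 hlt))⟩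

end Interval

/-! ### Level functions on the interval `[0, γ)` -/

section LevelFunctions

variable {γ : ℝ≥0∞} {w : ℝ → ℝ} {f : ℝ → ℝ≥0∞}

/-- The standing assumptions on `f` and `w`. -/
structure IsLevelData (γ : ℝ≥0∞) (w : ℝ → ℝ) (f : ℝ → ℝ≥0∞) : Prop where
  weight : IsWeight γ w
  anti : Antitone f
  fin : ∀ c ∈ cutSet γ, ∫⁻ s in Ioc 0 c, f s ≠ ∞

theorem IsLevelData.cut (h : IsLevelData γ w f) : IsCut (cutSet γ) (prim f) (primW w) :=
  isCut_prim h.weight h.anti h.fin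

theorem quot_ofReal (h : IsLevelData γ w f) {a b : ℝ} (ha : a ∈ cutSet γ) (hb : b ∈ cutSet γ)
    (hab : a < b) : quot f w (ENNReal.ofReal a) (ENNReal.ofReal b)
      = ENNReal.ofReal ((prim f b - prim f a) / (primW w b - primW w a)) := by
  rw [quot, lintegral_seg ha.1, lintegral_seg ha.1, lintegral_Ioc_eq h.fin ha hb hab.le,
    lintegral_Ioc_eq (fun c hc => h.weight.lintegral_ne_top hc) ha hb hab.le,
    ENNReal.ofReal_div_of_pos (h.cut.W_sub_pos ha hb hab)]

theorem ratio_ofReal (h : IsLevelData γ w f) {a b : ℝ} (ha : a ∈ cutSet γ) (hb : b ∈ cutSet γ)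
    (hab : a < b) : ratio f w (ENNReal.ofReal a) (ENNReal.ofReal b)
      = ENNReal.ofReal ((prim f b - prim f a) / (primW w b - primW w a)) := by
  rw [ratio, if_neg ENNReal.ofReal_ne_top, quot_ofReal h ha hb hab]

theorem ratio_top (h : IsLevelData ∞ w f) {a : ℝ} (ha : 0 ≤ a) :
    ratio f w (ENNReal.ofReal a) ∞ = limsup (slopes (prim f) (primW w) (fun t => t) a) atTop := by
  rw [ratio, if_pos rfl]
  refine limsup_congr ?_
  filter_upwards [eventually_gt_atTop a] with t ht
  exact quot_ofReal h ⟨ha, le_top⟩ ⟨ha.trans ht.le, le_top⟩ ht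

/-- End points of level intervals are real, except that the right one may be `∞`. -/
theorem IsLevel.exists_left {c d : ℝ≥0∞} (h : IsLevel γ f w c d) :
    ∃ c' ∈ cutSet γ, c = ENNReal.ofReal c' := by
  have hc : c ≠ ∞ := (h.1.trans_le le_top).ne
  refine ⟨c.toReal, ⟨ENNReal.toReal_nonneg, ?_⟩, (ENNReal.ofReal_toReal hc).symm⟩
  rw [ENNReal.ofReal_toReal hc]
  exact h.1.le.trans h.2.1

theorem IsLevel.exists_right {c d : ℝ≥0∞} (h : IsLevel γ f w c d) (hd : d ≠ ∞) :
    ∃ d' ∈ cutSet γ, d = ENNReal.ofReal d' := by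
  refine ⟨d.toReal, ⟨ENNReal.toReal_nonneg, ?_⟩, (ENNReal.ofReal_toReal hd).symm⟩
  rw [ENNReal.ofReal_toReal hd]
  exact h.2.1

theorem IsLevel.isCutLevel (h : IsLevelData γ w f) {a b : ℝ} (ha : a ∈ cutSet γ)
    (hb : b ∈ cutSet γ) (hl : IsLevel γ f w (ENNReal.ofReal a) (ENNReal.ofReal b)) :
    IsCutLevel (cutSet γ) (prim f) (primW w) a b
      ((prim f b - prim f a) / (primW w b - primW w a)) := by
  have hab : a < b := (ENNReal.ofReal_lt_ofReal_iff_of_nonneg ha.1).1 hl.1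
  have hW := h.cut.W_sub_pos ha hb hab
  refine ⟨ha, hb, hab, (div_mul_cancel₀ _ hW.ne').symm, fun x hx hax hxb => ?_⟩
  have h1 := hl.2.2 (ENNReal.ofReal x) ((ENNReal.ofReal_lt_ofReal_iff_of_nonneg ha.1).2 hax)
    (ENNReal.ofReal_le_ofReal hxb)
  rw [ratio_ofReal h ha hx hax, ratio_ofReal h ha hb hab, ENNReal.ofReal_le_ofReal_iff
    (div_nonneg (sub_nonneg.2 (h.cut.monoF ha hb hab.le)) hW.le),
    div_le_iff₀ (h.cut.W_sub_pos ha hx hax)] at h1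
  exact h1

theorem IsCutLevel.isLevel (h : IsLevelData γ w f) {a b R : ℝ}
    (hl : IsCutLevel (cutSet γ) (prim f) (primW w) a b R) :
    IsLevel γ f w (ENNReal.ofReal a) (ENNReal.ofReal b) := by
  refine ⟨(ENNReal.ofReal_lt_ofReal_iff_of_nonneg hl.left.1).2 hl.lt, hl.right.2,
    fun t hat htb => ?_⟩
  have ht : t ≠ ∞ := ne_top_of_le_ne_top ENNReal.ofReal_ne_top htb
  lift t to NNReal using ht
  rw [← ENNReal.ofReal_coe_nnreal] at hat htb ⊢
  have hat' := (ENNReal.ofReal_lt_ofReal_iff_of_nonneg hl.left.1).1 hat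
  have htb' := (ENNReal.ofReal_le_ofReal_iff hl.right.1).1 htb
  have htC := mem_cutSet_of_le hl.right t.coe_nonneg htb'
  rw [ratio_ofReal h hl.left htC hat', ratio_ofReal h hl.left hl.right hl.lt, hl.slope,
    mul_div_cancel_right₀ _ (h.cut.W_sub_pos hl.left hl.right hl.lt).ne']
  apply ENNReal.ofReal_le_ofReal
  rw [div_le_iff₀ (h.cut.W_sub_pos hl.left htC hat')]
  exact hl.le t htC hat' htb'

/-- A level interval `(c, ∞]` does not extend to the left of a maximizer for a slope above
`limsup F / W`. -/
theorem not_isLevel_top (h : IsLevelData γ w f) {ρ σ b c : ℝ} (hσ0 : 0 < σ) (hρσ : ρ < σ)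
    (hco : IsCoercive (cutSet γ) (prim f) (primW w) ρ)
    (hb : b ∈ argmax (cutSet γ) (prim f) (primW w) σ) (hc : c ∈ cutSet γ) (hcb : c < b) :
    ¬ IsLevel γ f w (ENNReal.ofReal c) ∞ := by
  intro hl
  have hγ : γ = ∞ := top_le_iff.1 hl.2.1
  subst hγ
  have h1 := hl.2.2 (ENNReal.ofReal b) ((ENNReal.ofReal_lt_ofReal_iff_of_nonneg hc.1).2 hcb) le_top
  rw [ratio_ofReal h hc hb.1 hcb, ratio_top h hc.1] at h1
  have h2 := limsup_slopes_le (isExhausting_top h.weight) (a := c) hco (left_lt_add_div_two.2 hρσ)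
  have h3 := h1.trans h2
  have h4 : σ ≤ (prim f b - prim f c) / (primW w b - primW w c) := by
    rw [le_div_iff₀ (h.cut.W_sub_pos hc hb.1 hcb)]
    have := hb.2 c hc
    linarith
  rcases le_or_gt ((ρ + σ) / 2) 0 with h5 | h5
  · rw [ENNReal.ofReal_of_nonpos h5, nonpos_iff_eq_zero, ENNReal.ofReal_eq_zero] at h3
    linarith
  · rw [ENNReal.ofReal_le_ofReal_iff h5.le] at h3
    linarith

theorem levelFun_eq_of_forall {t : ℝ} {r : ℝ≥0∞}
    (hex : ∃ a b, IsMaxLevel γ f w a b ∧ t ∈ seg a b)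
    (hall : ∀ a b, IsMaxLevel γ f w a b → t ∈ seg a b → ratio f w a b = r) :
    levelFun γ f w t = r * ENNReal.ofReal (w t) := by
  rw [levelFun, if_pos hex]
  refine le_antisymm (iSup_le fun a => iSup_le fun b => iSup_le fun hab => ?_) ?_
  · rw [hall a b hab.1 hab.2]
  · obtain ⟨a, b, hab⟩ := hex
    refine le_iSup_of_le a (le_iSup_of_le b (le_iSup_of_le hab ?_))
    rw [hall a b hab.1 hab.2]

/-- At a point between two maximizers of `F - σ W`, the level function is `σ w`, provided that
`f` is continuous there. -/
theorem levelFun_eq (h : IsLevelData γ w f) {ρ σ x y t : ℝ} (hσ0 : 0 < σ) (hρσ : ρ < σ)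
    (hco : IsCoercive (cutSet γ) (prim f) (primW w) ρ)
    (hx : x ∈ argmax (cutSet γ) (prim f) (primW w) σ)
    (hy : y ∈ argmax (cutSet γ) (prim f) (primW w) σ) (hxt : x ≤ t) (hty : t ≤ y)
    (ht : t ∈ seg 0 γ) (hcont : ContinuousAt f t) :
    levelFun γ f w t = ENNReal.ofReal σ * ENNReal.ofReal (w t) := by
  obtain ⟨a, ha, b, hb, hab⟩ := exists_argmax_bounds h.cut (hco.mono h.cut hρσ.le)
  have hat : a ≤ t := (hab x hx).1.trans hxt
  have htb : t ≤ b := hty.trans (hab y hy).2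
  have ht0 := pos_of_mem_seg ht
  have htC := mem_cutSet_of_mem_seg ht
  -- the interval between the extreme maximizers is a maximal level interval
  have hmaxab : a < b → IsMaxLevel γ f w (ENNReal.ofReal a) (ENNReal.ofReal b) := by
    intro hlt
    refine ⟨(isCutLevel_argmax ha hb hlt).isLevel h, fun c d hcd hca hbd => ?_⟩
    obtain ⟨c', hc', rfl⟩ := hcd.exists_left
    have hca' : c' ≤ a := (ENNReal.ofReal_le_ofReal_iff ha.1.1).1 hca
    by_cases hd : d = ∞
    · subst hd
      exact absurd hcd (not_isLevel_top h hσ0 hρσ hco hb hc' (hca'.trans_lt hlt))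
    · obtain ⟨d', hd', rfl⟩ := hcd.exists_right hd
      have hbd' : b ≤ d' := (ENNReal.ofReal_le_ofReal_iff hd'.1).1 hbd
      obtain ⟨rfl, rfl⟩ := (hcd.isCutLevel h hc' hd').eq_of_argmax_subset h.cut ha hb hab hlt
        hca' hbd'
      exact ⟨rfl, rfl⟩
  by_cases hex : ∃ a b, IsMaxLevel γ f w a b ∧ t ∈ seg a b
  · refine levelFun_eq_of_forall hex fun c d hcd htcd => ?_
    obtain ⟨c', hc', rfl⟩ := hcd.1.exists_left
    have hct : c' < t := (ENNReal.ofReal_lt_ofReal_iff_of_nonneg hc'.1).1 htcd.1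
    by_cases hd : d = ∞
    · subst hd
      exact absurd hcd.1 (not_isLevel_top h hσ0 hρσ hco hb hc' (hct.trans_le htb))
    · obtain ⟨d', hd', rfl⟩ := hcd.1.exists_right hd
      have htd : t < d' := (ENNReal.ofReal_lt_ofReal_iff_of_nonneg ht0.le).1 htcd.2
      have hcut := hcd.1.isCutLevel h hc' hd'
      rw [ratio_ofReal h hc' hd' hcut.lt]
      congr 1
      refine hcut.slope_eq_of_meets h.cut ha hb (hat.trans_lt htd) (hct.trans_le htb)
        fun h1 h2 => ?_
      have hlt : a < b := h1.trans_lt (hcut.lt.trans_le h2)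
      obtain ⟨e1, e2⟩ := hcd.2 _ _ (hmaxab hlt).1 (ENNReal.ofReal_le_ofReal h1)
        (ENNReal.ofReal_le_ofReal h2)
      exact ⟨(ENNReal.ofReal_eq_ofReal_iff ha.1.1 hc'.1).1 e1,
        (ENNReal.ofReal_eq_ofReal_iff hb.1.1 hd'.1).1 e2⟩
  · -- off all level intervals `t` is itself a maximizer, and `f t = σ w t` as `(F - σ W)' = 0`
    have htmem : t ∈ argmax (cutSet γ) (prim f) (primW w) σ := by
      rcases hat.eq_or_lt with rfl | h1
      · exact ha
      rcases htb.eq_or_lt with rfl | h2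
      · exact hb
      · exact absurd ⟨_, _, hmaxab (h1.trans h2),
          (ENNReal.ofReal_lt_ofReal_iff_of_nonneg ha.1.1).2 h1,
          (ENNReal.ofReal_lt_ofReal_iff_of_nonneg ht0.le).2 h2⟩ hex
    have hwt := h.weight.pos t ht
    have hfW : ∀ c ∈ cutSet γ, ∫⁻ s in Ioc 0 c, ENNReal.ofReal (w s) ≠ ∞ :=
      fun _ hc => h.weight.lintegral_ne_top hc
    have hffin : ∀ s, 0 < s → f s ≠ ∞ := by
      intro s hs htop
      set z := min s t
      have hz : z ∈ cutSet γ := mem_cutSet_of_le htC (le_min hs.le ht0.le) (min_le_right _ _)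
      have hz0 : 0 < z := lt_min hs ht0
      refine h.fin z hz (top_le_iff.1 ?_)
      calc (∞ : ℝ≥0∞) = ∫⁻ _ in Ioc 0 z, ∞ := by
            rw [setLIntegral_const, Real.volume_Ioc, ENNReal.top_mul]
            simpa using hz0
        _ ≤ ∫⁻ u in Ioc 0 z, f u := setLIntegral_mono' measurableSet_Ioc fun u hu => by
            rw [← htop]; exact h.anti (hu.2.trans (min_le_left _ _))
    have hne : ∀ᶠ s in 𝓝[>] t, s ∈ seg 0 γ := by
      have h1 : IsOpen (seg 0 γ) := (isOpen_lt continuous_const ENNReal.continuous_ofReal).inter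
        (isOpen_lt ENNReal.continuous_ofReal continuous_const)
      exact mem_nhdsWithin_of_mem_nhds (h1.mem_nhds ht)
    have hle : f t ≤ ENNReal.ofReal (σ * w t) := by
      refine le_of_tendsto (hcont.tendsto.mono_left (nhdsWithin_le_nhds (s := Ioi t))) ?_
      filter_upwards [hne, self_mem_nhdsWithin] with s hs hts
      have hts' : t < s := hts
      have hsC := mem_cutSet_of_mem_seg hs
      have h1 := le_prim_sub_of_le h.fin htC hsC hts'.le (K := (f s).toReal) ENNReal.toReal_nonneg
        fun u _ hus => by
          rw [ENNReal.ofReal_toReal (hffin s (ht0.trans hts'))]; exact h.anti hus.le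
      have h2 := prim_sub_le_of_le hfW htC hsC hts'.le hwt.le fun u htu hus =>
        ENNReal.ofReal_le_ofReal (h.weight.anti ht (mem_seg_of_lt hsC (ht0.trans htu) hus) htu.le)
      have h3 := htmem.2 s hsC
      have h4 : (f s).toReal * (s - t) ≤ σ * w t * (s - t) := by
        have := mul_le_mul_of_nonneg_left h2 hσ0.le
        change σ * (primW w s - primW w t) ≤ _ at this
        linarith
      rw [← ENNReal.ofReal_toReal (hffin s (ht0.trans hts'))]
      exact ENNReal.ofReal_le_ofReal (le_of_mul_le_mul_right h4 (sub_pos.2 hts'))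
    have hge : ENNReal.ofReal (σ * w t) ≤ f t := by
      refine ge_of_tendsto (hcont.tendsto.mono_left (nhdsWithin_le_nhds (s := Iio t))) ?_
      filter_upwards [self_mem_nhdsWithin, mem_nhdsWithin_of_mem_nhds (Ioi_mem_nhds ht0)]
        with s hst hs0
      have hst' : s < t := hst
      have hs0' : 0 < s := hs0
      have hs := mem_seg_of_lt htC hs0' hst'
      have hsC := mem_cutSet_of_mem_seg hs
      have h1 := prim_sub_le_of_le h.fin hsC htC hst'.le (K := (f s).toReal) ENNReal.toReal_nonneg
        fun u hsu _ => by
          rw [ENNReal.ofReal_toReal (hffin s hs0')]; exact h.anti hsu.le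
      have h2 := le_prim_sub_of_le hfW hsC htC hst'.le hwt.le fun u hsu hut =>
        ENNReal.ofReal_le_ofReal (h.weight.anti (mem_seg_of_lt htC (hs0'.trans hsu) hut) ht hut.le)
      have h3 := htmem.2 s hsC
      have h4 : σ * w t * (t - s) ≤ (f s).toReal * (t - s) := by
        have := mul_le_mul_of_nonneg_left h2 hσ0.le
        change _ ≤ σ * (primW w t - primW w s) at this
        linarith
      rw [← ENNReal.ofReal_toReal (hffin s hs0')]
      exact ENNReal.ofReal_le_ofReal (le_of_mul_le_mul_right h4 (sub_pos.2 hst'))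
    rw [levelFun, if_neg hex, ← ENNReal.ofReal_mul hσ0.le]
    exact le_antisymm hle hge

/-- To the left of a maximizer for the slope `μ`, the level function is at least `μ w`. -/
theorem le_levelFun (h : IsLevelData γ w f) {ρ μ x t : ℝ} (hμ0 : 0 < μ) (hρμ : ρ < μ)
    (hco : IsCoercive (cutSet γ) (prim f) (primW w) ρ)
    (hx : x ∈ argmax (cutSet γ) (prim f) (primW w) μ) (htx : t ≤ x)
    (ht : t ∈ seg 0 γ) (hcont : ContinuousAt f t) :
    ENNReal.ofReal μ * ENNReal.ofReal (w t) ≤ levelFun γ f w t := by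
  have hcoμ := hco.mono h.cut hρμ.le
  obtain ⟨μ', hμ', hlt⟩ := exists_argmax_lt h.cut hcoμ (pos_of_mem_seg ht)
  obtain ⟨z, hz⟩ := argmax_nonempty h.cut (hcoμ.mono h.cut hμ'.le)
  obtain ⟨σ, hσ, x', hx', y', hy', h1, h2⟩ := exists_slope h.cut hcoμ hμ'.le (p := t) (q := t)
    (fun z _ => le_total z t) hz (hlt μ' le_rfl z hz).le hx htx
  rw [levelFun_eq h (hμ0.trans_le hσ.1) (hρμ.trans_le hσ.1) hco hx' hy' h1 h2 ht hcont]
  gcongr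
  exact hσ.1

/-- To the right of a maximizer for the slope `μ`, the level function is at most `μ w`. -/
theorem levelFun_le (h : IsLevelData γ w f)
    (hco : ∀ ρ, 0 < ρ → IsCoercive (cutSet γ) (prim f) (primW w) ρ) {μ x t : ℝ} (hμ0 : 0 < μ)
    (hx : x ∈ argmax (cutSet γ) (prim f) (primW w) μ) (hxt : x < t)
    (ht : t ∈ seg 0 γ) (hcont : ContinuousAt f t) :
    levelFun γ f w t ≤ ENNReal.ofReal μ * ENNReal.ofReal (w t) := by
  have ht0 := pos_of_mem_seg ht
  have htC := mem_cutSet_of_mem_seg ht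
  by_cases hex : ∃ l, 0 < l ∧ l < μ ∧ ∃ y ∈ argmax (cutSet γ) (prim f) (primW w) l, t ≤ y
  · obtain ⟨l, hl0, hlμ, y, hy, hty⟩ := hex
    obtain ⟨σ, hσ, x', hx', y', hy', h1, h2⟩ := exists_slope h.cut (hco l hl0) hlμ.le (p := t)
      (q := t) (fun z _ => le_total z t) hx hxt.le hy hty
    have hσ0 : 0 < σ := hl0.trans_le hσ.1
    rw [levelFun_eq h hσ0 (half_lt_self hσ0) (hco _ (half_pos hσ0)) hx' hy' h1 h2 ht hcont]
    gcongr
    exact hσ.2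
  push Not at hex
  by_cases hmax : ∃ a b, IsMaxLevel γ f w a b ∧ t ∈ seg a b
  · have hz : levelFun γ f w t = 0 * ENNReal.ofReal (w t) := by
      refine levelFun_eq_of_forall hmax fun c d hcd htcd => ?_
      obtain ⟨c', hc', rfl⟩ := hcd.1.exists_left
      have hct : c' < t := (ENNReal.ofReal_lt_ofReal_iff_of_nonneg hc'.1).1 htcd.1
      by_cases hd : d = ∞
      · subst hd
        have hγ : γ = ∞ := top_le_iff.1 hcd.1.2.1
        subst hγ
        rw [ratio_top h hc'.1]
        refine le_antisymm (ENNReal.le_of_forall_pos_le_add fun ε hε _ => ?_) zero_le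
        have hε' : (0 : ℝ) < ε := hε
        rw [zero_add, ← ENNReal.ofReal_coe_nnreal]
        exact limsup_slopes_le (isExhausting_top h.weight) (hco _ (half_pos hε'))
          (half_lt_self hε')
      · obtain ⟨d', hd', rfl⟩ := hcd.1.exists_right hd
        have htd : t < d' := (ENNReal.ofReal_lt_ofReal_iff_of_nonneg ht0.le).1 htcd.2
        have hcut := hcd.1.isCutLevel h hc' hd'
        rw [ratio_ofReal h hc' hd' hcut.lt]
        set R := (prim f d' - prim f c') / (primW w d' - primW w c') with hR
        have hW := h.cut.W_sub_pos hc' hd' hcut.lt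
        have hR0 : 0 ≤ R := div_nonneg (sub_nonneg.2 (h.cut.monoF hc' hd' hcut.lt.le)) hW.le
        rcases hR0.eq_or_lt with h0 | hRpos
        · rw [← h0, ENNReal.ofReal_zero]
        -- for slopes below `R` there is no maximizer in `(c, d)`, so that `F c = F d`
        exfalso
        set ν := min R μ
        have hν0 : 0 < ν := lt_min hRpos hμ0
        have hleft : ∀ l, 0 < l → l < ν → ∀ z ∈ argmax (cutSet γ) (prim f) (primW w) l,
            z ≤ c' := by
          intro l hl0 hlν z hz
          by_contra hcon
          have hzt := hex l hl0 (hlν.trans_le (min_le_right _ _)) z hz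
          have := hcut.slope_eq h.cut hz (not_le.1 hcon) (hzt.trans htd)
          exact absurd (this ▸ hlν.trans_le (min_le_left R μ)) (lt_irrefl _)
        have h5 : prim f d' - prim f c' = R * (primW w d' - primW w c') := hcut.slope
        rw [eq_of_forall_argmax_le h.cut hco hν0 hleft hc' hd' hcut.lt.le, sub_self] at h5
        have h7 := mul_pos hRpos hW
        linarith
    rw [hz, zero_mul]
    exact zero_le
  · have hft : f t = 0 := by
      have h1 : ∀ s ∈ seg 0 γ, t < s → f s = 0 := by
        intro s hs hts
        have hsC := mem_cutSet_of_mem_seg hs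
        have h2 := eq_of_forall_argmax_le h.cut hco hμ0
          (fun l hl0 hlμ z hz => (hex l hl0 hlμ z hz).le) htC hsC hts.le
        have h3 := lintegral_Ioc_eq h.fin htC hsC hts.le
        rw [h2, sub_self, ENNReal.ofReal_zero] at h3
        by_contra hne
        have h4 : f s * volume (Ioc t s) ≤ ∫⁻ u in Ioc t s, f u := by
          rw [← setLIntegral_const]
          exact setLIntegral_mono' measurableSet_Ioc fun u hu => h.anti hu.2
        rw [h3, nonpos_iff_eq_zero, mul_eq_zero, Real.volume_Ioc, ENNReal.ofReal_eq_zero] at h4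
        rcases h4 with h4 | h4
        · exact hne h4
        · linarith
      have hne : ∀ᶠ s in 𝓝[>] t, s ∈ seg 0 γ := by
        have h1 : IsOpen (seg 0 γ) :=
          (isOpen_lt continuous_const ENNReal.continuous_ofReal).inter
            (isOpen_lt ENNReal.continuous_ofReal continuous_const)
        exact mem_nhdsWithin_of_mem_nhds (h1.mem_nhds ht)
      refine le_antisymm (le_of_tendsto
        (hcont.tendsto.mono_left (nhdsWithin_le_nhds (s := Ioi t))) ?_) zero_le
      filter_upwards [hne, self_mem_nhdsWithin] with s hs hts
      exact (h1 s hs hts).le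
    rw [levelFun, if_neg hmax, hft]
    exact zero_le

end LevelFunctions

/-! ### Finiteness of `Q` forces `F / W → 0` -/

section FiniteQ

variable {γ : ℝ≥0∞} {w : ℝ → ℝ} {f : ℝ → ℝ≥0∞} {φ : ℝ → ℝ}

theorem lintegral_Ioi_weight (hw : IsWeight ∞ w) {a : ℝ} (ha : 0 ≤ a) :
    ∫⁻ s in Ioi a, ENNReal.ofReal (w s) = ∞ := by
  have h := hw.total rfl
  rw [seg_zero_top, ← Ioc_union_Ioi_eq_Ioi ha] at h
  have h2 := top_le_iff.1 (h ▸ lintegral_union_le (fun s => ENNReal.ofReal (w s)) (Ioc 0 a) (Ioi a))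
  exact (ENNReal.add_eq_top.1 h2).resolve_left (hw.lintegral_ne_top ⟨ha, le_top⟩)

theorem levelFun_eq_top (hγ : 0 < γ) (hw : IsWeight γ w) (h : ratio f w 0 γ = ∞) {t : ℝ}
    (ht : t ∈ seg 0 γ) : levelFun γ f w t = ∞ := by
  have hmax : IsMaxLevel γ f w 0 γ :=
    ⟨⟨hγ, le_rfl, fun t _ _ => by rw [h]; exact le_top⟩,
      fun c d hcd hc hd => ⟨le_antisymm hc zero_le, le_antisymm hcd.2.1 hd⟩⟩
  rw [levelFun, if_pos ⟨0, γ, hmax, ht⟩]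
  refine top_le_iff.1 (le_iSup_of_le 0 (le_iSup_of_le γ (le_iSup_of_le ⟨hmax, ht⟩ ?_)))
  rw [h, ENNReal.top_mul (by simpa using hw.pos t ht)]

theorem ratio_ne_top (hγ : 0 < γ) (hw : IsWeight γ w)
    (hQ : ∫⁻ t in seg 0 γ, extend φ (levelFun γ f w t / ENNReal.ofReal (w t))
      * ENNReal.ofReal (w t) ≠ ∞) : ratio f w 0 γ ≠ ∞ := by
  intro h
  apply hQ
  have : ∫⁻ t in seg 0 γ, extend φ (levelFun γ f w t / ENNReal.ofReal (w t)) * ENNReal.ofReal (w t)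
      = ∫⁻ _ in seg 0 γ, ∞ := by
    refine setLIntegral_congr_fun (measurableSet_seg _ _) fun t ht => ?_
    simp only [levelFun_eq_top hγ hw h ht]
    rw [ENNReal.top_div_of_ne_top ENNReal.ofReal_ne_top, extend_top,
      ENNReal.top_mul (by simpa using hw.pos t ht)]
  rw [this, setLIntegral_const, ENNReal.top_mul]
  obtain ⟨x, hx0, hxγ⟩ : ∃ x : ℝ, 0 < x ∧ ENNReal.ofReal x ≤ γ := by
    obtain ⟨q, -, h1, h2⟩ := ENNReal.lt_iff_exists_real_btwn.1 hγ
    exact ⟨q, by simpa using h1, h2.le⟩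
  refine (lt_of_lt_of_le ?_ (measure_mono (show Ioo 0 x ⊆ seg 0 γ from fun t ht =>
    mem_seg_of_lt ⟨hx0.le, hxγ⟩ ht.1 ht.2))).ne'
  simpa using hx0

theorem isLevelData_of_ratio_ne_top (hw : IsWeight γ w) (hf : Antitone f)
    (h : ratio f w 0 γ ≠ ∞) : IsLevelData γ w f := by
  have key : ∀ c x, c ≤ x → x ∈ cutSet γ → quot f w 0 (ENNReal.ofReal x) ≠ ∞ →
      ∫⁻ s in Ioc 0 c, f s ≠ ∞ := by
    intro c x hcx hx hq htop
    apply hq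
    have h1 : ∫⁻ s in Ioc 0 x, f s = ∞ := top_le_iff.1
      (htop ▸ lintegral_mono_set (Ioc_subset_Ioc_right hcx))
    rw [quot, lintegral_seg_zero, lintegral_seg_zero, h1, ENNReal.top_div_of_ne_top
      (hw.lintegral_ne_top hx)]
  refine ⟨hw, hf, fun c hc => ?_⟩
  by_cases hγ : γ = ∞
  · subst hγ
    rw [ratio, if_pos rfl] at h
    have h1 := eventually_lt_of_limsup_lt h.lt_top (by isBoundedDefault)
    obtain ⟨x, hx, hcx⟩ := (h1.and (eventually_ge_atTop c)).exists
    exact key c x hcx ⟨hc.1.trans hcx, le_top⟩ hx.ne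
  · rw [ratio, if_neg hγ] at h
    refine key c γ.toReal ((ENNReal.ofReal_le_iff_le_toReal hγ).1 hc.2)
      ⟨ENNReal.toReal_nonneg, by rw [ENNReal.ofReal_toReal hγ]⟩ ?_
    rwa [ENNReal.ofReal_toReal hγ]

/-- If `limsup F / W = L > 0`, then the level function is at least `L w` far out: either `F - L W`
attains its maximum, and there is a maximal level interval `(a, ∞]` of slope `L`, or the
maximizers for slopes above `L` exhaust `[0, ∞)`. -/
theorem exists_le_levelFun (h : IsLevelData ∞ w f) {L : ℝ} (hL0 : 0 < L)
    (hL : ratio f w 0 ∞ = ENNReal.ofReal L) :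
    ∃ a, 0 ≤ a ∧ ∀ t, a < t → ContinuousAt f t →
      ENNReal.ofReal L * ENNReal.ofReal (w t) ≤ levelFun ∞ f w t := by
  have hex := isExhausting_top h.weight
  rw [← ENNReal.ofReal_zero, ratio_top h le_rfl] at hL
  have hco : ∀ ρ, L < ρ → IsCoercive (cutSet ∞) (prim f) (primW w) ρ := fun ρ hρ =>
    isCoercive_of_limsup_lt h.cut hex (by
      rw [hL]; exact (ENNReal.ofReal_lt_ofReal_iff (hL0.trans hρ)).2 hρ)
  rcases (argmax (cutSet ∞) (prim f) (primW w) L).eq_empty_or_nonempty with hem | hne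
  · refine ⟨0, le_rfl, fun t ht hcont => ?_⟩
    obtain ⟨ρ, hρ, hgt⟩ := exists_argmax_gt h.cut hem t
    obtain ⟨x, hx⟩ := argmax_nonempty h.cut (hco ρ hρ)
    refine le_trans ?_ (le_levelFun h (hL0.trans hρ) (add_div_two_lt_right.2 hρ)
      (hco _ (left_lt_add_div_two.2 hρ)) hx (hgt x hx).le
      (by rw [seg_zero_top]; exact ht) hcont)
    gcongr
  · have hbdd : BddBelow (argmax (cutSet ∞) (prim f) (primW w) L) := ⟨0, fun x hx => hx.1.1⟩
    have ha := (argmax_closed h.cut L).csInf_mem hne hbdd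
    set a := sInf (argmax (cutSet ∞) (prim f) (primW w) L)
    have hratio : ∀ c, 0 ≤ c → ratio f w (ENNReal.ofReal c) ∞ = ENNReal.ofReal L := fun c hc => by
      rw [ratio_top h hc]; exact limsup_slopes_eq h.cut hex hL hL0
    have hmax : IsMaxLevel ∞ f w (ENNReal.ofReal a) ∞ := by
      refine ⟨⟨ENNReal.ofReal_lt_top, le_rfl, fun t hat _ => ?_⟩, fun c d hcd hca hd => ?_⟩
      · by_cases ht : t = ∞
        · rw [ht]
        lift t to NNReal using ht
        rw [← ENNReal.ofReal_coe_nnreal] at hat ⊢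
        have hat' := (ENNReal.ofReal_lt_ofReal_iff_of_nonneg ha.1.1).1 hat
        have htC : (t : ℝ) ∈ cutSet ∞ := ⟨t.coe_nonneg, le_top⟩
        rw [hratio a ha.1.1, ratio_ofReal h ha.1 htC hat']
        apply ENNReal.ofReal_le_ofReal
        rw [div_le_iff₀ (h.cut.W_sub_pos ha.1 htC hat')]
        have := ha.2 _ htC
        linarith
      · have hd' := top_le_iff.1 hd
        subst hd'
        obtain ⟨c', hc', rfl⟩ := hcd.exists_left
        have hca' : c' ≤ a := (ENNReal.ofReal_le_ofReal_iff ha.1.1).1 hca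
        refine ⟨?_, rfl⟩
        rcases hca'.eq_or_lt with h1 | h1
        · rw [h1]
        have h2 := hcd.2.2 (ENNReal.ofReal a)
          ((ENNReal.ofReal_lt_ofReal_iff_of_nonneg hc'.1).2 h1) le_top
        rw [hratio c' hc'.1, ratio_ofReal h hc' ha.1 h1, ENNReal.ofReal_le_ofReal_iff hL0.le,
          div_le_iff₀ (h.cut.W_sub_pos hc' ha.1 h1)] at h2
        have h3 : c' ∈ argmax (cutSet ∞) (prim f) (primW w) L :=
          ⟨hc', fun y hy => (ha.2 y hy).trans (by linarith)⟩
        exact absurd (csInf_le hbdd h3) (not_le.2 h1)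
    refine ⟨a, ha.1.1, fun t ht _ => ?_⟩
    have htmem : t ∈ seg (ENNReal.ofReal a) ∞ :=
      ⟨(ENNReal.ofReal_lt_ofReal_iff_of_nonneg ha.1.1).2 ht, ENNReal.ofReal_lt_top⟩
    rw [levelFun, if_pos ⟨_, _, hmax, htmem⟩, ← hratio a ha.1.1]
    exact le_iSup_of_le _ (le_iSup_of_le _ (le_iSup_of_le ⟨hmax, htmem⟩ le_rfl))

theorem ae_continuousAt (hf : Antitone f) (μ : Measure ℝ) [NullSingletonClass μ] :
    ∀ᵐ t ∂μ, ContinuousAt f t := by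
  have h := hf.countable_not_continuousAt.measure_zero μ
  rw [← ae_iff] at h
  exact h

/-- If `∫ φ(f⁰ / w) w < ∞`, then `F / W → 0` at `∞`. -/
theorem isCoercive_of_levelFun (hφ : IsOrlicz φ) (h : IsLevelData γ w f)
    (hr : ratio f w 0 γ ≠ ∞)
    (hQ : ∫⁻ t in seg 0 γ, extend φ (levelFun γ f w t / ENNReal.ofReal (w t))
      * ENNReal.ofReal (w t) ≠ ∞) (ρ : ℝ) (hρ : 0 < ρ) :
    IsCoercive (cutSet γ) (prim f) (primW w) ρ := by
  by_cases hγ : γ = ∞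
  swap
  · exact isCoercive_of_ne_top hγ ρ
  subst hγ
  have hL : ratio f w 0 ∞ = 0 := by
    by_contra hne
    have hL0 := ENNReal.toReal_pos hne hr
    obtain ⟨a, ha, hle⟩ := exists_le_levelFun h hL0 (ENNReal.ofReal_toReal hr).symm
    set L := (ratio f w 0 ∞).toReal
    apply hQ
    refine top_le_iff.1 ?_
    calc (∞ : ℝ≥0∞) = ∫⁻ t in Ioi a, ENNReal.ofReal (φ L) * ENNReal.ofReal (w t) := by
          rw [lintegral_const_mul' _ _ ENNReal.ofReal_ne_top, lintegral_Ioi_weight h.weight ha,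
            ENNReal.mul_top (by simpa using hφ.pos L hL0)]
      _ ≤ ∫⁻ t in Ioi a, extend φ (levelFun ∞ f w t / ENNReal.ofReal (w t))
            * ENNReal.ofReal (w t) := by
          refine setLIntegral_mono_ae' measurableSet_Ioi ?_
          filter_upwards [ae_continuousAt h.anti volume] with t hcont ht
          refine mul_le_mul_left ?_ _
          rw [← extend_ofReal hL0.le]
          refine extend_mono hφ ?_
          have hwt := h.weight.pos t (by rw [seg_zero_top]; exact ha.trans_lt ht)
          rw [ENNReal.le_div_iff_mul_le (Or.inl (by simpa using hwt))
            (Or.inl ENNReal.ofReal_ne_top)]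
          exact hle t ht hcont
      _ ≤ _ := lintegral_mono_set (by
          rw [seg_zero_top]; exact Ioi_subset_Ioi ha)
  rw [← ENNReal.ofReal_zero, ratio_top h le_rfl] at hL
  refine isCoercive_of_limsup_lt h.cut (isExhausting_top h.weight) ?_
  rw [hL]
  exact (ENNReal.ofReal_lt_ofReal_iff hρ).2 hρ

end FiniteQ

/-! ### The spaces of functions -/

section Functions

variable {γ : ℝ≥0∞} {w : ℝ → ℝ} {φ : ℝ → ℝ}

theorem lintegral_seg_half (t : ℝ≥0∞) (g : ℝ → ℝ≥0∞) :
    ∫⁻ s in seg 0 t, g (s / 2) ≤ 2 * ∫⁻ s in seg 0 t, g s := by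
  have hm := measurableSet_seg 0 t
  rw [← lintegral_indicator hm, ← lintegral_indicator hm]
  calc ∫⁻ s, (seg 0 t).indicator (fun s => g (s / 2)) s
      ≤ ∫⁻ s, (seg 0 t).indicator g (s / 2) := by
        refine lintegral_mono fun s => ?_
        by_cases hs : s ∈ seg 0 t
        · have h2 : s / 2 ∈ seg 0 t := by
            have h0 := pos_of_mem_seg hs
            exact ⟨ENNReal.ofReal_pos.2 (half_pos h0),
              (ENNReal.ofReal_le_ofReal (half_le_self h0.le)).trans_lt hs.2⟩
          rw [indicator_of_mem hs, indicator_of_mem h2]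
        · rw [indicator_of_notMem hs]; exact zero_le
    _ = ∫⁻ s, (seg 0 t).indicator g s ∂(Measure.map (Homeomorph.mulLeft₀ (2⁻¹ : ℝ)
          (by norm_num)).toMeasurableEquiv volume) := by
        rw [lintegral_map_equiv]
        refine lintegral_congr fun s => ?_
        congr 1
        simp [div_eq_inv_mul]
    _ = 2 * ∫⁻ s, (seg 0 t).indicator g s := by
        have h := Real.map_volume_mul_left (a := (2⁻¹ : ℝ)) (by norm_num)
        have e : (Homeomorph.mulLeft₀ (2⁻¹ : ℝ) (by norm_num)).toMeasurableEquiv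
            = ((2⁻¹ : ℝ) * ·) := rfl
        rw [e, h, lintegral_smul_measure]
        norm_num

theorem leb_univ_le (γ : ℝ≥0∞) : leb γ univ ≤ γ := by
  rw [leb, Measure.restrict_apply_univ]
  by_cases hγ : γ = ∞
  · rw [hγ]; exact le_top
  · have : seg 0 γ = Ioo 0 γ.toReal := by
      rw [← seg_ofReal le_rfl, ENNReal.ofReal_toReal hγ, ENNReal.ofReal_zero]
    rw [this, Real.volume_Ioo, sub_zero, ENNReal.ofReal_toReal hγ]

/-- The halved weight `t ↦ v (t / 2) / 4 + v' (t / 2) / 4` is admissible. -/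
theorem IsAdmissible.half {v v' : ℝ → ℝ} (hv : IsAdmissible γ w v) (hv' : IsAdmissible γ w v') :
    IsAdmissible γ w (fun t => v (t / 2) / 4 + v' (t / 2) / 4) := by
  have hhalf : ∀ t ∈ seg 0 γ, t / 2 ∈ seg 0 γ := fun t ht => by
    have h0 := pos_of_mem_seg ht
    exact ⟨ENNReal.ofReal_pos.2 (half_pos h0),
      (ENNReal.ofReal_le_ofReal (half_le_self h0.le)).trans_lt ht.2⟩
  refine ⟨fun t ht => ?_, fun s hs t ht hst => ?_, fun t ht => ?_⟩
  · have h1 := hv.pos _ (hhalf t ht)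
    have h2 := hv'.pos _ (hhalf t ht)
    positivity
  · have h1 := hv.anti (hhalf s hs) (hhalf t ht) (by linarith)
    have h2 := hv'.anti (hhalf s hs) (hhalf t ht) (by linarith)
    show _ ≤ v (s / 2) / 4 + v' (s / 2) / 4
    linarith
  · have hle : ∀ u : ℝ → ℝ, IsAdmissible γ w u →
        ∫⁻ s in seg 0 t, ENNReal.ofReal (u (s / 2)) ≤ 2 * ∫⁻ s in seg 0 t, ENNReal.ofReal (w s) :=
      fun u hu => (lintegral_seg_half t fun s => ENNReal.ofReal (u s)).trans
        (mul_le_mul_right (hu.submaj t ht) _)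
    have hm : ∀ u : ℝ → ℝ, IsAdmissible γ w u →
        AEMeasurable (fun s => ENNReal.ofReal (u (s / 2))) (volume.restrict (seg 0 t)) := by
      intro u hu
      refine (aemeasurable_restrict_of_antitoneOn (measurableSet_seg _ _)
        fun a ha b hb hab => ?_).ennreal_ofReal
      have hsub : seg 0 t ⊆ seg 0 γ := fun x hx => ⟨hx.1, hx.2.trans ht⟩
      exact hu.anti (hhalf a (hsub ha)) (hhalf b (hsub hb)) (by linarith)
    have h4 : ∀ u : ℝ → ℝ, ∀ s, ENNReal.ofReal (u s / 4) = 4⁻¹ * ENNReal.ofReal (u s) := by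
      intro u s
      rw [div_eq_inv_mul, ENNReal.ofReal_mul (by norm_num), ENNReal.ofReal_inv_of_pos (by norm_num)]
      norm_num
    calc ∫⁻ s in seg 0 t, ENNReal.ofReal (v (s / 2) / 4 + v' (s / 2) / 4)
        ≤ ∫⁻ s in seg 0 t, (4⁻¹ * ENNReal.ofReal (v (s / 2)) + 4⁻¹ * ENNReal.ofReal (v' (s / 2))) :=
          lintegral_mono fun s => by
            rw [← h4, ← h4]; exact ENNReal.ofReal_add_le
      _ = (4⁻¹ * ∫⁻ s in seg 0 t, ENNReal.ofReal (v (s / 2)))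
          + 4⁻¹ * ∫⁻ s in seg 0 t, ENNReal.ofReal (v' (s / 2)) := by
          rw [lintegral_add_left' ((hm v hv).const_mul _), lintegral_const_mul'' _ (hm v hv),
            lintegral_const_mul'' _ (hm v' hv')]
      _ ≤ 4⁻¹ * (2 * ∫⁻ s in seg 0 t, ENNReal.ofReal (w s))
          + 4⁻¹ * (2 * ∫⁻ s in seg 0 t, ENNReal.ofReal (w s)) := by
          gcongr
          · exact hle v hv
          · exact hle v' hv'
      _ = ∫⁻ s in seg 0 t, ENNReal.ofReal (w s) := by
          rw [← mul_add, ← two_mul, ← mul_assoc, ← mul_assoc, mul_assoc (4⁻¹ : ℝ≥0∞)]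
          norm_num
          rw [ENNReal.inv_mul_cancel (by norm_num) (by norm_num), one_mul]

theorem IsWeight.isAdmissible (hw : IsWeight γ w) : IsAdmissible γ w w :=
  ⟨hw.pos, hw.anti, fun _ _ => le_rfl⟩

theorem isFrame_leb (hw : IsWeight γ w) :
    IsFrame (leb γ) ENNReal.ofReal (fun t => t / 2) (seg 0 γ) {v | IsAdmissible γ w v} where
  ae_mem := ae_restrict_mem (measurableSet_seg _ _)
  pos := fun _ hv => hv.pos
  meas := fun _ hv => aemeasurable_leb hv.anti
  measτ := ENNReal.measurable_ofReal
  ne_top := fun _ => ENNReal.ofReal_ne_top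
  small := by
    filter_upwards [ae_restrict_mem (measurableSet_seg 0 γ)] with t ht
    exact ⟨ENNReal.ofReal t, ht.1, fun S hS => hS.le⟩
  bdd := by
    intro htop v hv
    have hγ : γ = ∞ := top_le_iff.1 (htop ▸ leb_univ_le γ)
    subst hγ
    have h1 : (1 : ℝ) ∈ seg 0 ∞ := by rw [seg_zero_top]; exact zero_lt_one' ℝ
    refine ⟨v 1, hv.pos 1 h1, top_le_iff.1 ?_⟩
    calc (∞ : ℝ≥0∞) = leb ∞ (Ioi 1) := by
          rw [leb, Measure.restrict_apply measurableSet_Ioi, seg_zero_top,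
            inter_eq_left.2 (Ioi_subset_Ioi zero_le_one), Real.volume_Ioi]
      _ ≤ leb ∞ {t | v t ≤ v 1} := measure_mono fun t ht =>
          hv.anti h1 (by rw [seg_zero_top]; exact zero_lt_one.trans (show (1 : ℝ) < t from ht))
            (le_of_lt ht)
  half_mem := fun t ht => by
    have h0 := pos_of_mem_seg ht
    exact ⟨ENNReal.ofReal_pos.2 (half_pos h0),
      (ENNReal.ofReal_le_ofReal (half_le_self h0.le)).trans_lt ht.2⟩
  half_level := fun t => by
    rcases le_total 0 t with h | h
    · rw [← ENNReal.ofReal_add (by positivity) (by positivity), add_halves]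
    · rw [ENNReal.ofReal_of_nonpos (by linarith : t / 2 ≤ 0), add_zero]; exact zero_le
  half_lintegral := lintegral_seg_half γ
  half_weight := fun v hv v' hv' => IsAdmissible.half hv hv'
  low := by
    intro m hm hmγ
    refine ⟨_, hw.isAdmissible.half hw.isAdmissible, ?_⟩
    rcases eq_or_ne m 0 with rfl | hm0
    · exact ⟨1, zero_lt_one, Eventually.of_forall fun t ht => absurd ht not_lt_zero⟩
    have hM : 0 < m.toReal := ENNReal.toReal_pos hm0 hm
    have hMC : m.toReal ∈ cutSet γ :=
      ⟨hM.le, by rw [ENNReal.ofReal_toReal hm]; exact hmγ.trans (leb_univ_le γ)⟩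
    have hh := mem_seg_of_lt hMC (half_pos hM) (half_lt_self hM)
    refine ⟨w (m.toReal / 2) / 2, half_pos (hw.pos _ hh), ?_⟩
    filter_upwards [ae_restrict_mem (measurableSet_seg 0 γ)] with t ht htm
    have h0 := pos_of_mem_seg ht
    have htM : t < m.toReal := (ENNReal.ofReal_lt_iff_lt_toReal h0.le hm).1 htm
    have := hw.anti (mem_seg_of_lt hMC (half_pos h0) (by linarith)) hh (by linarith)
    linarith
  fin := by
    intro m hm
    have hsub : {t : ℝ | ENNReal.ofReal t < m} ∩ seg 0 γ ⊆ Ioo 0 m.toReal := fun t ht => by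
      have h0 := pos_of_mem_seg ht.2
      exact ⟨h0, (ENNReal.ofReal_lt_iff_lt_toReal h0.le hm).1 ht.1⟩
    rw [leb, Measure.restrict_apply (measurableSet_lt ENNReal.measurable_ofReal measurable_const)]
    exact ne_top_of_le_ne_top (by simp) (measure_mono hsub)

/-- `v ≺ w` also holds at the end point `γ`. -/
theorem IsAdmissible.lintegral_cell_le {v : ℝ → ℝ} (hγ : 0 < γ) (hv : IsAdmissible γ w v) {c : ℝ}
    (hc : c ∈ cutSet γ) : ∫⁻ t in cell id 0 c, ENNReal.ofReal (v t) ∂(leb γ)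
      ≤ ∫⁻ t in cell id 0 c, ENNReal.ofReal (w t) ∂(leb γ) := by
  rw [lintegral_cell_leb le_rfl hc, lintegral_cell_leb le_rfl hc, ← lintegral_seg_zero,
    ← lintegral_seg_zero]
  rcases hc.2.eq_or_lt with he | hlt
  · obtain ⟨u, hu, hmem, hlim⟩ := exists_seq_strictMono_tendsto' hγ
    have hU : seg 0 γ = ⋃ n, seg 0 (u n) := by
      ext s
      simp only [mem_iUnion]
      constructor
      · intro hs
        obtain ⟨n, hn⟩ := (hlim.eventually (lt_mem_nhds hs.2)).exists
        exact ⟨n, hs.1, hn⟩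
      · rintro ⟨n, hn⟩
        exact ⟨hn.1, hn.2.trans (hmem n).2⟩
    have hmono : Monotone fun n => seg 0 (u n) := fun m n hmn s hs =>
      ⟨hs.1, hs.2.trans_le (hu.monotone hmn)⟩
    rw [he, hU, setLIntegral_iUnion_of_directed _ hmono.directed_le]
    refine iSup_le fun n => (hv.submaj _ (hmem n).2).trans ?_
    exact lintegral_mono_set (subset_iUnion (fun n => seg 0 (u n)) n)
  · exact hv.submaj _ hlt

theorem rearr_antitone (f : ℝ →ₘ[leb γ] ℝ) : Antitone (rearr f) := fun _ _ hst =>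
  rearrAt_anti f (ENNReal.ofReal_le_ofReal hst)

theorem rearr_four_smul (f : ℝ →ₘ[leb γ] ℝ) (t : ℝ) :
    rearr ((4 : ℝ) • f) t = 4 * rearr f t := by
  have h := rearrAt_smul f (four_pos (α := ℝ)) (ENNReal.ofReal t)
  rw [show ENNReal.ofReal 4 = 4 by norm_num] at h
  exact h

theorem modP_eq_genMod (φ : ℝ → ℝ) (γ : ℝ≥0∞) (w : ℝ → ℝ) :
    modP φ γ w = genMod φ ENNReal.ofReal {v | IsAdmissible γ w v} := rfl

theorem modQ_le_modP (hφ : IsOrlicz φ) (hγ : 0 < γ) (hw : IsWeight γ w) (f : ℝ →ₘ[leb γ] ℝ) :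
    modQ φ γ w f ≤ modP φ γ w ((4 : ℝ) • f) := by
  refine le_iInf₂ fun v hv => ?_
  simp only [rearr_four_smul]
  change _ ≤ ∫⁻ t, persp φ (4 * rearr f t) (v t) ∂(leb γ)
  by_cases hB : ∫⁻ t, persp φ (4 * rearr f t) (v t) ∂(leb γ) = ∞
  · rw [hB]; exact le_top
  have hf := rearr_antitone f
  have hvm := aemeasurable_leb hv.anti
  have hcell := fun c (hc : c ∈ cutSet γ) => hv.lintegral_cell_le hγ hc
  have hD : ∀ᵐ t ∂(leb γ), t ∈ seg 0 γ := ae_restrict_mem (measurableSet_seg _ _)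
  have hfin : ∀ c ∈ cutSet γ, ∫⁻ s in Ioc 0 c, rearr f s ≠ ∞ := by
    intro c hc
    rw [← lintegral_cell_leb le_rfl hc]
    refine lintegral_ne_top_of_persp hφ hf.measurable.aemeasurable hvm hD hv.pos hB ?_
    refine ne_top_of_le_ne_top ?_ (hcell c hc)
    rw [lintegral_cell_leb le_rfl hc]
    exact hw.lintegral_ne_top hc
  have hS := isSystem_prim hw hf hfin
  have hco := isCoercive_of_weight hφ hS hvm hv.pos hcell hB (exists_primW_gt hw)
  refine lintegral_slope_le hφ hS hco hvm hv.pos hcell fun μ hμ x hx => ?_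
  filter_upwards [hD, ae_restrict_of_ae (ae_continuousAt hf volume)] with t ht hcont hxt
  exact ENNReal.div_le_of_le_mul (levelFun_le ⟨hw, hf, hfin⟩ hco hμ hx hxt ht hcont)

theorem modP_le_modQ (hφ : IsOrlicz φ) (hγ : 0 < γ) (hw : IsWeight γ w) (f : ℝ →ₘ[leb γ] ℝ) :
    modP φ γ w f ≤ modQ φ γ w ((4 : ℝ) • f) := by
  by_cases hQ : modQ φ γ w ((4 : ℝ) • f) = ∞
  · rw [hQ]; exact le_top
  set g := rearr ((4 : ℝ) • f)
  have hg : Antitone g := rearr_antitone _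
  have hr := ratio_ne_top hγ hw hQ
  have hdata := isLevelData_of_ratio_ne_top hw hg hr
  have hco := isCoercive_of_levelFun hφ hdata hr hQ
  have hS := isSystem_prim hw hg hdata.fin
  obtain ⟨v, hv0, hva, hvc, hle⟩ := exists_weight hφ hS hco
    (h := fun t => levelFun γ g w t / ENNReal.ofReal (w t)) fun μ hμ x hx => by
      filter_upwards [ae_restrict_mem (measurableSet_seg 0 γ),
        ae_restrict_of_ae (ae_continuousAt hg volume)] with t ht hcont htx
      rw [ENNReal.le_div_iff_mul_le (Or.inl (by simpa using hw.pos t ht))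
        (Or.inl ENNReal.ofReal_ne_top)]
      exact le_levelFun hdata hμ (half_lt_self hμ) (hco _ (half_pos hμ)) hx htx ht hcont
  have hadm : IsAdmissible γ w v := by
    refine ⟨hv0, fun s hs t ht hst => hva s hs t ht hst, fun t ht => ?_⟩
    have ht' : t ≠ ∞ := (ht.trans_le le_top).ne
    have htC : t.toReal ∈ cutSet γ :=
      ⟨ENNReal.toReal_nonneg, by rw [ENNReal.ofReal_toReal ht']; exact ht.le⟩
    have := hvc _ htC
    rwa [lintegral_cell_leb le_rfl htC, lintegral_cell_leb le_rfl htC, ← lintegral_seg_zero,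
      ← lintegral_seg_zero, ENNReal.ofReal_toReal ht'] at this
  refine (iInf₂_le v hadm).trans (le_trans (le_of_eq ?_) hle)
  refine lintegral_congr fun t => ?_
  simp only [g]
  have h4 : 4 * rearr f t / 4 = rearr f t := by
    rw [mul_comm, ENNReal.mul_div_cancel_right (by norm_num) (by norm_num)]
  rw [rearr_four_smul, h4]
  rfl

end Functions

section Elements

variable {Ω : Type*} [MeasurableSpace Ω] {μ : Measure Ω}

theorem finiteElements_subset {ρ ρ' : (Ω →ₘ[μ] ℝ) → ℝ≥0∞}
    (h : ∀ f, ρ' f ≤ ρ ((4 : ℝ) • f)) : finiteElements ρ ⊆ finiteElements ρ' := by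
  intro f hf k hk
  refine (h _).trans_lt ?_
  rw [smul_smul]
  exact hf _ (by positivity)

end Elements

theorem spaceM_parts_eq {φ : ℝ → ℝ} (hφ : IsOrlicz φ) {γ : ℝ≥0∞} {w : ℝ → ℝ} (hγ : 0 < γ)
    (hw : IsWeight γ w) :
    orderContinuousPart (spaceM φ γ w) (normM φ γ w) = simpleClosure (spaceM φ γ w) (normM φ γ w) ∧
      simpleClosure (spaceM φ γ w) (normM φ γ w) = finiteElements (modP φ γ w) ∧
      finiteElements (modP φ γ w) = finiteElements (modQ φ γ w) := by
  have hF := isFrame_leb hw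
  rw [spaceM, normM, modP_eq_genMod]
  have h1 := finiteElements_subset_orderContinuousPart hφ hF
  have h2 := orderContinuousPart_subset_simpleClosure (ν := leb γ) (τ := ENNReal.ofReal)
    (A := {v | IsAdmissible γ w v}) hφ
  have h3 := simpleClosure_subset_finiteElements hφ hF
  exact ⟨h2.antisymm (h3.trans h1), h3.antisymm (h1.trans h2),
    (finiteElements_subset (modQ_le_modP hφ hγ hw)).antisymm
      (finiteElements_subset (modP_le_modQ hφ hγ hw))⟩

/-! ### Partial sums -/

section Sums

/-- The end points of intervals of indices: `ℕ` as a subset of the line. -/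
def natSet : Set ℝ := range ((↑) : ℕ → ℝ)

/-- The partial sums of `g`, as a function on the line: `∑_{j < n} g j` at the point `n`. -/
noncomputable def psum (g : ℕ → ℝ≥0∞) (x : ℝ) : ℝ := (∑ j ∈ Finset.range ⌊x⌋₊, g j).toReal

/-- The partial sums of the weight. -/
noncomputable abbrev psumW (w : ℕ → ℝ) : ℝ → ℝ := psum fun j => ENNReal.ofReal (w j)

/-- The right end point of the unit interval `(j, j + 1]` that stands for the index `j`. -/
def idxPos (j : ℕ) : ℝ := j + 1

variable {w v : ℕ → ℝ} {f g : ℕ → ℝ≥0∞} {φ : ℝ → ℝ}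

theorem natCast_mem_natSet (n : ℕ) : (n : ℝ) ∈ natSet := ⟨n, rfl⟩

theorem psum_natCast (g : ℕ → ℝ≥0∞) (n : ℕ) :
    psum g n = (∑ j ∈ Finset.range n, g j).toReal := by
  rw [psum, Nat.floor_natCast]

theorem sum_Ico_eq (hg : ∀ j, g j ≠ ∞) {a b : ℕ} (hab : a ≤ b) :
    ∑ j ∈ Finset.Ico a b, g j = ENNReal.ofReal (psum g b - psum g a) := by
  have hfin : ∀ n, ∑ j ∈ Finset.range n, g j ≠ ∞ := fun n => ENNReal.sum_ne_top.2 fun j _ => hg j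
  rw [psum_natCast, psum_natCast, ENNReal.ofReal_sub _ ENNReal.toReal_nonneg,
    ENNReal.ofReal_toReal (hfin a), ENNReal.ofReal_toReal (hfin b),
    ← Finset.sum_range_add_sum_Ico g hab, ENNReal.add_sub_cancel_left (hfin a)]

theorem psum_succ_sub (hg : ∀ j, g j ≠ ∞) (j : ℕ) :
    g j = ENNReal.ofReal (psum g (j + 1 : ℕ) - psum g j) := by
  rw [← sum_Ico_eq hg (Nat.le_succ j), Nat.Ico_succ_singleton, Finset.sum_singleton]

theorem psum_natCast_mono (hg : ∀ j, g j ≠ ∞) {a b : ℕ} (hab : a ≤ b) :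
    psum g a ≤ psum g b := by
  rw [psum_natCast, psum_natCast]
  exact ENNReal.toReal_mono (ENNReal.sum_ne_top.2 fun j _ => hg j)
    (Finset.sum_le_sum_of_subset (Finset.range_mono hab))

theorem continuousOn_natSet (F : ℝ → ℝ) : ContinuousOn F natSet := by
  have : DiscreteTopology natSet :=
    Nat.isClosedEmbedding_coe_real.isEmbedding.toHomeomorph.symm.isEmbedding.discreteTopology
  rw [continuousOn_iff_continuous_domRestrict]
  exact continuous_of_discreteTopology

/-- The indices in a cell. -/
theorem cell_idxPos (a b : ℕ) : cell idxPos a b = (Finset.Ico a b : Set ℕ) := by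
  ext j
  simp only [cell, idxPos, mem_ofPred_eq, Finset.coe_Ico, mem_Ico]
  norm_cast
  rw [Nat.lt_succ_iff, Nat.succ_le_iff]

theorem lintegral_cell_idxPos (g : ℕ → ℝ≥0∞) (a b : ℕ) :
    ∫⁻ j in cell idxPos a b, g j ∂Measure.count = ∑ j ∈ Finset.Ico a b, g j := by
  rw [cell_idxPos, lintegral_finset]
  simp

theorem isCut_psum (hw : IsSeqWeight w) (hf : ∀ j, f j ≠ ∞) :
    IsCut natSet (psum f) (psumW w) where
  closed := Nat.isClosedEmbedding_coe_real.isClosed_range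
  nonneg := by rintro _ ⟨n, rfl⟩; exact n.cast_nonneg
  zero := ⟨0, Nat.cast_zero⟩
  contF := continuousOn_natSet _
  contW := continuousOn_natSet _
  monoF := by
    rintro _ ⟨a, rfl⟩ _ ⟨b, rfl⟩ hab
    exact psum_natCast_mono hf (Nat.cast_le.1 hab)
  monoW := by
    rintro _ ⟨a, rfl⟩ _ ⟨b, rfl⟩ hab
    have hab' : a < b := Nat.cast_lt.1 hab
    have h := sum_Ico_eq (g := fun j => ENNReal.ofReal (w j)) (fun _ => ENNReal.ofReal_ne_top)
      hab'.le
    have h1 : 0 < ∑ j ∈ Finset.Ico a b, ENNReal.ofReal (w j) :=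
      (ENNReal.ofReal_pos.2 (hw.pos a)).trans_le
        (Finset.single_le_sum (f := fun j => ENNReal.ofReal (w j)) (fun _ _ => zero_le)
          (Finset.left_mem_Ico.2 hab'))
    rw [h, ENNReal.ofReal_pos] at h1
    exact sub_pos.1 h1
  F_zero := by simp [psum]
  W_zero := by simp [psum]

theorem isSystem_psum (hw : IsSeqWeight w) (hf : Antitone f) (hfin : ∀ j, f j ≠ ∞) :
    IsSystem Measure.count idxPos univ natSet w f (psum f) (psumW w) where
  cut := isCut_psum hw hfin
  ae_mem := Eventually.of_forall fun _ => mem_univ _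
  meas_pos := measurable_of_countable _
  pos_mem := fun j _ => ⟨j + 1, by simp [idxPos]⟩
  pos_pos := fun j _ => by unfold idxPos; positivity
  w_pos := fun j _ => hw.pos j
  w_anti := fun i _ j _ hij => hw.anti (by simpa [idxPos] using hij)
  f_anti := fun i _ j _ hij => hf (by simpa [idxPos] using hij)
  meas_w := (measurable_of_countable _).aemeasurable
  meas_f := (measurable_of_countable _).aemeasurable
  intF := by
    rintro _ ⟨n, rfl⟩
    have := sum_Ico_eq hfin n.zero_le
    rw [← lintegral_cell_idxPos] at this
    simpa [psum] using this
  intW := by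
    rintro _ ⟨n, rfl⟩
    have := sum_Ico_eq (g := fun j => ENNReal.ofReal (w j)) (fun _ => ENNReal.ofReal_ne_top)
      n.zero_le
    rw [← lintegral_cell_idxPos] at this
    simpa [psum] using this
  cell_pos := by
    rintro _ ⟨n, rfl⟩ j - hj
    rw [Ne, Measure.count_eq_zero_iff]
    exact Nonempty.ne_empty ⟨j, hj, le_rfl⟩
  cell_fin := by
    rintro _ ⟨n, rfl⟩ j - hj
    have : cell idxPos n (idxPos j) = (Finset.Ico n (j + 1) : Set ℕ) := by
      rw [← cell_idxPos]; simp [idxPos]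
    rw [this]
    exact (Measure.count_apply_lt_top.2 (Finset.finite_toSet _)).ne
  exhaust := ⟨fun n => n, fun n => ⟨n, rfl⟩, fun j _ => ⟨j + 1, by simp [idxPos]⟩⟩

theorem psumW_tendsto (hw : IsSeqWeight w) : Tendsto (fun n : ℕ => psumW w n) atTop atTop := by
  have h := ENNReal.tendsto_nat_tsum fun j => ENNReal.ofReal (w j)
  rw [hw.total] at h
  refine tendsto_atTop.2 fun K => ?_
  filter_upwards [h.eventually (lt_mem_nhds (ENNReal.ofReal_lt_top (r := K)))] with n hn
  have e : psumW w n = _ := psum_natCast _ n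
  rw [e]
  exact (ENNReal.ofReal_le_iff_le_toReal (ENNReal.sum_ne_top.2
    fun _ _ => ENNReal.ofReal_ne_top)).1 hn.le

theorem isExhausting_natSet (hw : IsSeqWeight w) :
    IsExhausting natSet (psumW w) atTop ((↑) : ℕ → ℝ) where
  mem := Eventually.of_forall natCast_mem_natSet
  tendsto := tendsto_natCast_atTop_atTop
  tendstoW := psumW_tendsto hw
  cofinal := fun p hp => by
    obtain ⟨N, hN⟩ := eventually_atTop.1 hp
    refine ⟨N, ?_⟩
    rintro _ ⟨n, rfl⟩ hn
    exact hN n (Nat.cast_lt.1 hn).le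

theorem exists_psumW_gt (hw : IsSeqWeight w) (K : ℝ) :
    ∃ B, ∀ x ∈ natSet, B < x → K < psumW w x :=
  (isExhausting_natSet hw).cofinal _ ((psumW_tendsto hw).eventually_gt_atTop K)

theorem lt_succ_iff_of_mem {x : ℝ} (hx : x ∈ natSet) (j : ℕ) : x < idxPos j ↔ x ≤ j := by
  obtain ⟨n, rfl⟩ := hx
  unfold idxPos
  norm_cast
  exact Nat.lt_succ_iff

end Sums

/-! ### Level sequences -/

section LevelSequences

variable {w : ℕ → ℝ} {f : ℕ → ℝ≥0∞} {φ : ℝ → ℝ}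

/-- The standing assumptions on `f` and `w`. -/
structure IsSeqLevelData (w : ℕ → ℝ) (f : ℕ → ℝ≥0∞) : Prop where
  weight : IsSeqWeight w
  fin : ∀ j, f j ≠ ∞

theorem IsSeqLevelData.cut (h : IsSeqLevelData w f) : IsCut natSet (psum f) (psumW w) :=
  isCut_psum h.weight h.fin

theorem seqQuot_eq (h : IsSeqLevelData w f) {a b : ℕ} (hab : a < b) :
    seqQuot f w a b = ENNReal.ofReal ((psum f b - psum f a) / (psumW w b - psumW w a)) := by
  rw [seqQuot, sum_Ico_eq h.fin hab.le, sum_Ico_eq (fun _ => ENNReal.ofReal_ne_top) hab.le,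
    ENNReal.ofReal_div_of_pos (h.cut.W_sub_pos (natCast_mem_natSet a) (natCast_mem_natSet b)
      (Nat.cast_lt.2 hab))]

theorem seqRatio_coe (h : IsSeqLevelData w f) {a b : ℕ} (hab : a < b) :
    seqRatio f w a b = ENNReal.ofReal ((psum f b - psum f a) / (psumW w b - psumW w a)) := by
  rw [seqRatio, if_neg (ENat.natCast_ne_top b), ENat.toNat_natCast, seqQuot_eq h hab]

theorem seqRatio_top (h : IsSeqLevelData w f) (a : ℕ) :
    seqRatio f w a ⊤ = limsup (slopes (psum f) (psumW w) ((↑) : ℕ → ℝ) a) atTop := by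
  rw [seqRatio, if_pos rfl]
  refine limsup_congr ?_
  filter_upwards [eventually_gt_atTop a] with n hn
  exact seqQuot_eq h hn

theorem IsSeqLevel.isCutLevel (h : IsSeqLevelData w f) {a b : ℕ} (hl : IsSeqLevel f w a b) :
    IsCutLevel natSet (psum f) (psumW w) a b
      ((psum f b - psum f a) / (psumW w b - psumW w a)) := by
  have hab : a < b := Nat.cast_lt.1 hl.1
  have ha := natCast_mem_natSet a
  have hb := natCast_mem_natSet b
  have hab' : (a : ℝ) < b := Nat.cast_lt.2 hab
  have hW := h.cut.W_sub_pos ha hb hab'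
  refine ⟨ha, hb, hab', (div_mul_cancel₀ _ hW.ne').symm, ?_⟩
  rintro _ ⟨n, rfl⟩ han hnb
  have han' : a < n := Nat.cast_lt.1 han
  have h1 := hl.2 n (Nat.cast_lt.2 han') (Nat.cast_le.2 (Nat.cast_le.1 hnb))
  rw [seqRatio_coe h han', seqRatio_coe h hab, ENNReal.ofReal_le_ofReal_iff
    (div_nonneg (sub_nonneg.2 (h.cut.monoF ha hb hab'.le)) hW.le),
    div_le_iff₀ (h.cut.W_sub_pos ha (natCast_mem_natSet n) han)] at h1
  exact h1

theorem IsCutLevel.isSeqLevel (h : IsSeqLevelData w f) {a b : ℕ} {R : ℝ}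
    (hl : IsCutLevel natSet (psum f) (psumW w) a b R) : IsSeqLevel f w a b := by
  have hab : a < b := Nat.cast_lt.1 hl.lt
  refine ⟨Nat.cast_lt.2 hab, fun t hat htb => ?_⟩
  lift t to ℕ using ne_top_of_le_ne_top (ENat.natCast_ne_top b) htb
  have hat' : a < t := Nat.cast_lt.1 hat
  have hat'' : (a : ℝ) < t := Nat.cast_lt.2 hat'
  have htb' : t ≤ b := Nat.cast_le.1 htb
  have htC := natCast_mem_natSet t
  rw [seqRatio_coe h hat', seqRatio_coe h hab, hl.slope,
    mul_div_cancel_right₀ _ (h.cut.W_sub_pos hl.left hl.right hl.lt).ne']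
  apply ENNReal.ofReal_le_ofReal
  rw [div_le_iff₀ (h.cut.W_sub_pos hl.left htC hat'')]
  exact hl.le t htC hat'' (Nat.cast_le.2 htb')

theorem not_isSeqLevel_top (h : IsSeqLevelData w f) {ρ σ : ℝ} {b c : ℕ} (hσ0 : 0 < σ)
    (hρσ : ρ < σ) (hco : IsCoercive natSet (psum f) (psumW w) ρ)
    (hb : (b : ℝ) ∈ argmax natSet (psum f) (psumW w) σ) (hcb : c < b) :
    ¬ IsSeqLevel f w c ⊤ := by
  intro hl
  have h1 := hl.2 b (Nat.cast_lt.2 hcb) le_top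
  have hcb' : (c : ℝ) < b := Nat.cast_lt.2 hcb
  rw [seqRatio_coe h hcb, seqRatio_top h c] at h1
  have h2 := limsup_slopes_le (isExhausting_natSet h.weight) (a := c) hco
    (left_lt_add_div_two.2 hρσ)
  have h3 := h1.trans h2
  have h4 : σ ≤ (psum f b - psum f c) / (psumW w b - psumW w c) := by
    rw [le_div_iff₀ (h.cut.W_sub_pos (natCast_mem_natSet c) hb.1 hcb')]
    have := hb.2 c (natCast_mem_natSet c)
    linarith
  rcases le_or_gt ((ρ + σ) / 2) 0 with h5 | h5
  · rw [ENNReal.ofReal_of_nonpos h5, nonpos_iff_eq_zero, ENNReal.ofReal_eq_zero] at h3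
    linarith
  · rw [ENNReal.ofReal_le_ofReal_iff h5.le] at h3
    linarith

theorem levelSeq_eq_of_forall {j : ℕ} {r : ℝ≥0∞}
    (hex : ∃ (a : ℕ) (b : ℕ∞), IsSeqMaxLevel f w a b ∧ a ≤ j ∧ (j : ℕ∞) < b)
    (hall : ∀ (a : ℕ) (b : ℕ∞), IsSeqMaxLevel f w a b → a ≤ j → (j : ℕ∞) < b →
      seqRatio f w a b = r) :
    levelSeq f w j = r * ENNReal.ofReal (w j) := by
  rw [levelSeq, if_pos hex]
  refine le_antisymm (iSup_le fun a => iSup_le fun b => iSup_le fun hab => ?_) ?_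
  · rw [hall a b hab.1 hab.2.1 hab.2.2]
  · obtain ⟨a, b, hab⟩ := hex
    refine le_iSup_of_le a (le_iSup_of_le b (le_iSup_of_le hab ?_))
    rw [hall a b hab.1 hab.2.1 hab.2.2]

/-- At an index between two maximizers of `F - σ W`, the level sequence is `σ w`. -/
theorem levelSeq_eq (h : IsSeqLevelData w f) {ρ σ x y : ℝ} {j : ℕ} (hσ0 : 0 < σ) (hρσ : ρ < σ)
    (hco : IsCoercive natSet (psum f) (psumW w) ρ)
    (hx : x ∈ argmax natSet (psum f) (psumW w) σ)
    (hy : y ∈ argmax natSet (psum f) (psumW w) σ) (hxj : x ≤ j) (hjy : idxPos j ≤ y) :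
    levelSeq f w j = ENNReal.ofReal σ * ENNReal.ofReal (w j) := by
  obtain ⟨a', ha, b', hb, hab⟩ := exists_argmax_bounds h.cut (hco.mono h.cut hρσ.le)
  obtain ⟨a, rfl⟩ := ha.1
  obtain ⟨b, rfl⟩ := hb.1
  have haj : a ≤ j := Nat.cast_le.1 ((hab x hx).1.trans hxj)
  have hjb : j < b := by
    have := hjy.trans (hab y hy).2
    unfold idxPos at this
    exact_mod_cast this
  have hlt : (a : ℝ) < b := Nat.cast_lt.2 (haj.trans_lt hjb)
  have hmaxab : IsSeqMaxLevel f w a b := by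
    refine ⟨(isCutLevel_argmax ha hb hlt).isSeqLevel h, fun c d hcd hca hbd => ?_⟩
    by_cases hd : d = ⊤
    · subst hd
      exact absurd hcd (not_isSeqLevel_top h hσ0 hρσ hco hb (hca.trans_lt (haj.trans_lt hjb)))
    · lift d to ℕ using hd
      obtain ⟨e1, e2⟩ := (hcd.isCutLevel h).eq_of_argmax_subset h.cut ha hb hab hlt
        (Nat.cast_le.2 hca) (Nat.cast_le.2 (Nat.cast_le.1 hbd))
      exact ⟨Nat.cast_injective e1, congrArg _ (Nat.cast_injective e2)⟩
  refine levelSeq_eq_of_forall ⟨a, b, hmaxab, haj, Nat.cast_lt.2 hjb⟩ fun c d hcd hcj hjd => ?_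
  by_cases hd : d = ⊤
  · subst hd
    exact absurd hcd.1 (not_isSeqLevel_top h hσ0 hρσ hco hb (hcj.trans_lt hjb))
  · lift d to ℕ using hd
    have hjd' : j < d := Nat.cast_lt.1 hjd
    rw [seqRatio_coe h (hcj.trans_lt hjd')]
    congr 1
    refine (hcd.1.isCutLevel h).slope_eq_of_meets h.cut ha hb
      (Nat.cast_lt.2 (haj.trans_lt hjd')) (Nat.cast_lt.2 (hcj.trans_lt hjb)) fun h1 h2 => ?_
    obtain ⟨e1, e2⟩ := hcd.2 _ _ hmaxab.1 (Nat.cast_le.1 h1)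
      (Nat.cast_le.2 (Nat.cast_le.1 h2))
    exact ⟨congrArg _ e1, congrArg _ (Nat.cast_injective e2 : b = d)⟩

theorem le_or_idxPos_le (j : ℕ) : ∀ z ∈ natSet, z ≤ j ∨ idxPos j ≤ z := fun _ hz =>
  (lt_or_ge _ (idxPos j)).imp_left (lt_succ_iff_of_mem hz j).1

/-- To the left of a maximizer for the slope `μ`, the level sequence is at least `μ w`. -/
theorem le_levelSeq (h : IsSeqLevelData w f) {ρ μ x : ℝ} {j : ℕ} (hμ0 : 0 < μ) (hρμ : ρ < μ)
    (hco : IsCoercive natSet (psum f) (psumW w) ρ)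
    (hx : x ∈ argmax natSet (psum f) (psumW w) μ) (hjx : idxPos j ≤ x) :
    ENNReal.ofReal μ * ENNReal.ofReal (w j) ≤ levelSeq f w j := by
  have hcoμ := hco.mono h.cut hρμ.le
  obtain ⟨μ', hμ', hlt⟩ := exists_argmax_lt h.cut hcoμ
    (show 0 < idxPos j by unfold idxPos; positivity)
  obtain ⟨z, hz⟩ := argmax_nonempty h.cut (hcoμ.mono h.cut hμ'.le)
  obtain ⟨σ, hσ, x', hx', y', hy', h1, h2⟩ := exists_slope h.cut hcoμ hμ'.le
    (le_or_idxPos_le j) hz ((lt_succ_iff_of_mem hz.1 j).1 (hlt μ' le_rfl z hz)) hx hjx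
  rw [levelSeq_eq h (hμ0.trans_le hσ.1) (hρμ.trans_le hσ.1) hco hx' hy' h1 h2]
  gcongr
  exact hσ.1

/-- To the right of a maximizer for the slope `μ`, the level sequence is at most `μ w`. -/
theorem levelSeq_le (h : IsSeqLevelData w f)
    (hco : ∀ ρ, 0 < ρ → IsCoercive natSet (psum f) (psumW w) ρ) {μ x : ℝ} {j : ℕ} (hμ0 : 0 < μ)
    (hx : x ∈ argmax natSet (psum f) (psumW w) μ) (hxj : x < idxPos j) :
    levelSeq f w j ≤ ENNReal.ofReal μ * ENNReal.ofReal (w j) := by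
  have hxj' := (lt_succ_iff_of_mem hx.1 j).1 hxj
  by_cases hex : ∃ l, 0 < l ∧ l < μ ∧ ∃ y ∈ argmax natSet (psum f) (psumW w) l, idxPos j ≤ y
  · obtain ⟨l, hl0, hlμ, y, hy, hjy⟩ := hex
    obtain ⟨σ, hσ, x', hx', y', hy', h1, h2⟩ := exists_slope h.cut (hco l hl0) hlμ.le
      (le_or_idxPos_le j) hx hxj' hy hjy
    have hσ0 : 0 < σ := hl0.trans_le hσ.1
    rw [levelSeq_eq h hσ0 (half_lt_self hσ0) (hco _ (half_pos hσ0)) hx' hy' h1 h2]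
    gcongr
    exact hσ.2
  push Not at hex
  have hexj : ∀ l, 0 < l → l < μ → ∀ z ∈ argmax natSet (psum f) (psumW w) l, z ≤ j :=
    fun l hl0 hlμ z hz => (lt_succ_iff_of_mem hz.1 j).1 (hex l hl0 hlμ z hz)
  by_cases hmax : ∃ (a : ℕ) (b : ℕ∞), IsSeqMaxLevel f w a b ∧ a ≤ j ∧ (j : ℕ∞) < b
  · have hz : levelSeq f w j = 0 * ENNReal.ofReal (w j) := by
      refine levelSeq_eq_of_forall hmax fun c d hcd hcj hjd => ?_
      by_cases hd : d = ⊤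
      · subst hd
        rw [seqRatio_top h c]
        refine le_antisymm (ENNReal.le_of_forall_pos_le_add fun ε hε _ => ?_) zero_le
        have hε' : (0 : ℝ) < ε := hε
        rw [zero_add, ← ENNReal.ofReal_coe_nnreal]
        exact limsup_slopes_le (isExhausting_natSet h.weight) (hco _ (half_pos hε'))
          (half_lt_self hε')
      · lift d to ℕ using hd
        have hjd' : j < d := Nat.cast_lt.1 hjd
        have hcd' : c < d := hcj.trans_lt hjd'
        have hcut := hcd.1.isCutLevel h
        rw [seqRatio_coe h hcd']
        set R := (psum f d - psum f c) / (psumW w d - psumW w c) with hR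
        have hW := h.cut.W_sub_pos hcut.left hcut.right hcut.lt
        have hR0 : 0 ≤ R :=
          div_nonneg (sub_nonneg.2 (h.cut.monoF hcut.left hcut.right hcut.lt.le)) hW.le
        rcases hR0.eq_or_lt with h0 | hRpos
        · rw [← h0, ENNReal.ofReal_zero]
        -- for slopes below `R` there is no maximizer in `(c, d)`, so that `F c = F d`
        exfalso
        set ν := min R μ
        have hν0 : 0 < ν := lt_min hRpos hμ0
        have hleft : ∀ l, 0 < l → l < ν → ∀ z ∈ argmax natSet (psum f) (psumW w) l, z ≤ c := by
          intro l hl0 hlν z hz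
          by_contra hcon
          have hzj := hexj l hl0 (hlν.trans_le (min_le_right _ _)) z hz
          have := hcut.slope_eq h.cut hz (not_le.1 hcon) (hzj.trans_lt (Nat.cast_lt.2 hjd'))
          exact absurd (this ▸ hlν.trans_le (min_le_left R μ)) (lt_irrefl _)
        have h5 : psum f d - psum f c = R * (psumW w d - psumW w c) := hcut.slope
        rw [eq_of_forall_argmax_le h.cut hco hν0 hleft hcut.left hcut.right hcut.lt.le,
          sub_self] at h5
        have h7 := mul_pos hRpos hW
        linarith
    rw [hz, zero_mul]
    exact zero_le
  · have hfj : f j = 0 := by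
      rw [psum_succ_sub h.fin j, eq_of_forall_argmax_le h.cut hco hμ0 hexj
        (natCast_mem_natSet j) (natCast_mem_natSet (j + 1)) (by exact_mod_cast Nat.le_succ j),
        sub_self, ENNReal.ofReal_zero]
    rw [levelSeq, if_neg hmax, hfj]
    exact zero_le

theorem levelSeq_eq_top (hw : IsSeqWeight w) (h : seqRatio f w 0 ⊤ = ∞) (j : ℕ) :
    levelSeq f w j = ∞ := by
  have hmax : IsSeqMaxLevel f w 0 ⊤ :=
    ⟨⟨ENat.natCast_lt_top 0, fun t _ _ => by rw [h]; exact le_top⟩,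
      fun c d _ hc hd => ⟨Nat.le_zero.1 hc, top_le_iff.1 hd⟩⟩
  have hj : (j : ℕ∞) < ⊤ := ENat.natCast_lt_top j
  rw [levelSeq, if_pos ⟨0, ⊤, hmax, j.zero_le, hj⟩]
  refine top_le_iff.1 (le_iSup_of_le 0 (le_iSup_of_le ⊤ (le_iSup_of_le ⟨hmax, j.zero_le, hj⟩ ?_)))
  rw [h, ENNReal.top_mul (by simpa using hw.pos j)]

theorem seqRatio_ne_top (hw : IsSeqWeight w)
    (hQ : ∑' j, extend φ (levelSeq f w j / ENNReal.ofReal (w j)) * ENNReal.ofReal (w j) ≠ ∞) :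
    seqRatio f w 0 ⊤ ≠ ∞ := by
  intro h
  refine hQ (top_le_iff.1 (le_trans (le_of_eq ?_) (ENNReal.le_tsum 0)))
  rw [levelSeq_eq_top hw h, ENNReal.top_div_of_ne_top ENNReal.ofReal_ne_top, extend_top,
    ENNReal.top_mul (by simpa using hw.pos 0)]

theorem isSeqLevelData_of_seqRatio_ne_top (hw : IsSeqWeight w) (h : seqRatio f w 0 ⊤ ≠ ∞) :
    IsSeqLevelData w f := by
  refine ⟨hw, fun j htop => ?_⟩
  rw [seqRatio, if_pos rfl] at h
  have h1 := eventually_lt_of_limsup_lt h.lt_top (by isBoundedDefault)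
  obtain ⟨n, hn, hjn⟩ := (h1.and (eventually_gt_atTop j)).exists
  refine hn.ne ?_
  rw [seqQuot, ENNReal.sum_eq_top.2 ⟨j, Finset.mem_Ico.2 ⟨j.zero_le, hjn⟩, htop⟩,
    ENNReal.top_div_of_ne_top (ENNReal.sum_ne_top.2 fun _ _ => ENNReal.ofReal_ne_top)]

/-- The analogue of `exists_le_levelFun` for sequences. -/
theorem exists_le_levelSeq (h : IsSeqLevelData w f) {L : ℝ} (hL0 : 0 < L)
    (hL : seqRatio f w 0 ⊤ = ENNReal.ofReal L) :
    ∃ a : ℕ, ∀ j, a ≤ j → ENNReal.ofReal L * ENNReal.ofReal (w j) ≤ levelSeq f w j := by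
  have hex := isExhausting_natSet h.weight
  rw [seqRatio_top h 0, Nat.cast_zero] at hL
  have hco : ∀ ρ, L < ρ → IsCoercive natSet (psum f) (psumW w) ρ := fun ρ hρ =>
    isCoercive_of_limsup_lt h.cut hex (by
      rw [hL]; exact (ENNReal.ofReal_lt_ofReal_iff (hL0.trans hρ)).2 hρ)
  rcases (argmax natSet (psum f) (psumW w) L).eq_empty_or_nonempty with hem | hne
  · refine ⟨0, fun j _ => ?_⟩
    obtain ⟨ρ, hρ, hgt⟩ := exists_argmax_gt h.cut hem (idxPos j)
    obtain ⟨x, hx⟩ := argmax_nonempty h.cut (hco ρ hρ)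
    refine le_trans ?_ (le_levelSeq h (hL0.trans hρ) (add_div_two_lt_right.2 hρ)
      (hco _ (left_lt_add_div_two.2 hρ)) hx (hgt x hx).le)
    gcongr
  · have hbdd : BddBelow (argmax natSet (psum f) (psumW w) L) :=
      ⟨0, fun x hx => h.cut.nonneg x hx.1⟩
    have ha := (argmax_closed h.cut L).csInf_mem hne hbdd
    obtain ⟨a, hae⟩ := ha.1
    rw [← hae] at ha
    have hratio : ∀ c : ℕ, seqRatio f w c ⊤ = ENNReal.ofReal L := fun c => by
      rw [seqRatio_top h]; exact limsup_slopes_eq h.cut hex hL hL0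
    have hmax : IsSeqMaxLevel f w a ⊤ := by
      refine ⟨⟨ENat.natCast_lt_top a, fun t hat _ => ?_⟩, fun c d hcd hca hd => ?_⟩
      · by_cases ht : t = ⊤
        · rw [ht]
        lift t to ℕ using ht
        have hat' : a < t := Nat.cast_lt.1 hat
        have hat'' : (a : ℝ) < t := Nat.cast_lt.2 hat'
        rw [hratio a, seqRatio_coe h hat']
        apply ENNReal.ofReal_le_ofReal
        rw [div_le_iff₀ (h.cut.W_sub_pos ha.1 (natCast_mem_natSet t) hat'')]
        have := ha.2 _ (natCast_mem_natSet t)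
        linarith
      · have hd' := top_le_iff.1 hd
        subst hd'
        refine ⟨?_, rfl⟩
        rcases hca.eq_or_lt with h1 | h1
        · exact h1
        have h1' : (c : ℝ) < a := Nat.cast_lt.2 h1
        have h2 := hcd.2 a (Nat.cast_lt.2 h1) le_top
        rw [hratio c, seqRatio_coe h h1, ENNReal.ofReal_le_ofReal_iff hL0.le,
          div_le_iff₀ (h.cut.W_sub_pos (natCast_mem_natSet c) ha.1 h1')] at h2
        have h3 : (c : ℝ) ∈ argmax natSet (psum f) (psumW w) L :=
          ⟨natCast_mem_natSet c, fun y hy => (ha.2 y hy).trans (by linarith)⟩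
        exact absurd (hae.le.trans (csInf_le hbdd h3)) (not_le.2 h1')
    refine ⟨a, fun j hj => ?_⟩
    have hj' : (j : ℕ∞) < ⊤ := ENat.natCast_lt_top j
    rw [levelSeq, if_pos ⟨a, ⊤, hmax, hj, hj'⟩, ← hratio a]
    exact le_iSup_of_le a (le_iSup_of_le ⊤ (le_iSup_of_le ⟨hmax, hj, hj'⟩ le_rfl))

/-- If `∑ φ(x⁰ / w) w < ∞`, then `F / W → 0` at `∞`. -/
theorem isCoercive_of_levelSeq (hφ : IsOrlicz φ) (h : IsSeqLevelData w f)
    (hr : seqRatio f w 0 ⊤ ≠ ∞)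
    (hQ : ∑' j, extend φ (levelSeq f w j / ENNReal.ofReal (w j)) * ENNReal.ofReal (w j) ≠ ∞)
    (ρ : ℝ) (hρ : 0 < ρ) : IsCoercive natSet (psum f) (psumW w) ρ := by
  have hL : seqRatio f w 0 ⊤ = 0 := by
    by_contra hne
    have hL0 := ENNReal.toReal_pos hne hr
    obtain ⟨a, hle⟩ := exists_le_levelSeq h hL0 (ENNReal.ofReal_toReal hr).symm
    set L := (seqRatio f w 0 ⊤).toReal
    apply hQ
    have htail : ∑' j, ENNReal.ofReal (w (j + a)) = ∞ := by
      have h1 := h.weight.total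
      rw [← ENNReal.summable.sum_add_tsum_nat_add' (k := a)] at h1
      exact (ENNReal.add_eq_top.1 h1).resolve_left
        (ENNReal.sum_ne_top.2 fun _ _ => ENNReal.ofReal_ne_top)
    refine top_le_iff.1 ?_
    calc (∞ : ℝ≥0∞) = ∑' j, ENNReal.ofReal (φ L) * ENNReal.ofReal (w (j + a)) := by
          rw [ENNReal.tsum_mul_left, htail, ENNReal.mul_top (by simpa using hφ.pos L hL0)]
      _ ≤ ∑' j, extend φ (levelSeq f w (j + a) / ENNReal.ofReal (w (j + a)))
            * ENNReal.ofReal (w (j + a)) := by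
          refine ENNReal.tsum_le_tsum fun j => mul_le_mul_left ?_ _
          rw [← extend_ofReal hL0.le]
          refine extend_mono hφ ?_
          rw [ENNReal.le_div_iff_mul_le (Or.inl (by simpa using h.weight.pos (j + a)))
            (Or.inl ENNReal.ofReal_ne_top)]
          exact hle _ (Nat.le_add_left a j)
      _ ≤ _ := ENNReal.tsum_comp_le_tsum_of_injective (add_left_injective a)
          fun j => extend φ (levelSeq f w j / ENNReal.ofReal (w j)) * ENNReal.ofReal (w j)
  rw [seqRatio_top h, Nat.cast_zero] at hL
  refine isCoercive_of_limsup_lt h.cut (isExhausting_natSet h.weight) ?_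
  rw [hL]
  exact ENNReal.ofReal_pos.2 hρ

end LevelSequences

/-! ### The spaces of sequences -/

section Sequences

variable {w : ℕ → ℝ} {φ : ℝ → ℝ}

/-- The counting measure takes no values in `(j, j + 1)`. -/
theorem seqRearr_eq (x : ℕ →ₘ[Measure.count] ℝ) (j : ℕ) : seqRearr x j = rearrAt x j := by
  have key : ∀ S : Set ℕ, Measure.count S < (j : ℝ≥0∞) + 1 ↔ Measure.count S ≤ (j : ℝ≥0∞) := by
    intro S
    by_cases hS : S.Finite
    · rw [Measure.count_apply_finite S hS]
      norm_cast
      exact Nat.lt_succ_iff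
    · rw [Measure.count_apply_infinite hS]
      simp
  have h : ∀ r : ℝ, distribution x r < (j : ℝ≥0∞) + 1 ↔ distribution x r ≤ (j : ℝ≥0∞) :=
    fun r => key _
  simp only [seqRearr, rearrAt, h]

theorem seqRearr_antitone (x : ℕ →ₘ[Measure.count] ℝ) : Antitone (seqRearr x) := fun i j hij => by
  rw [seqRearr_eq, seqRearr_eq]
  exact rearrAt_anti x (Nat.cast_le.2 hij)

theorem seqRearr_four_smul (x : ℕ →ₘ[Measure.count] ℝ) (j : ℕ) :
    seqRearr ((4 : ℝ) • x) j = 4 * seqRearr x j := by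
  have h := rearrAt_smul x (four_pos (α := ℝ)) (j : ℝ≥0∞)
  rw [show ENNReal.ofReal 4 = 4 by norm_num] at h
  rw [seqRearr_eq, seqRearr_eq, h]

theorem seqModP_eq_genMod (φ : ℝ → ℝ) (w : ℕ → ℝ) :
    seqModP φ w = genMod φ (fun j : ℕ => (j : ℝ≥0∞)) {v | IsSeqAdmissible w v} := by
  funext x
  refine iInf_congr fun v => iInf_congr fun _ => ?_
  rw [lintegral_count]
  simp only [seqRearr_eq]
  rfl

theorem tsum_half (g : ℕ → ℝ≥0∞) : ∑' j, g (j / 2) = 2 * ∑' j, g j := by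
  rw [← tsum_even_add_odd (f := fun j => g (j / 2)) ENNReal.summable ENNReal.summable, two_mul]
  congr 1
  · refine tsum_congr fun j => ?_
    rw [Nat.mul_div_cancel_left j two_pos]
  · refine tsum_congr fun j => ?_
    congr 1
    omega

theorem sum_half_le {v : ℕ → ℝ} (hv : ∀ j, 0 < v j) (n : ℕ) :
    ∑ j ∈ Finset.range n, v (j / 2) ≤ 2 * ∑ j ∈ Finset.range n, v j := by
  have h : ∀ m, ∑ j ∈ Finset.range (2 * m), v (j / 2) = 2 * ∑ j ∈ Finset.range m, v j := by
    intro m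
    induction m with
    | zero => simp
    | succ m ih =>
      rw [show 2 * (m + 1) = 2 * m + 1 + 1 by ring, Finset.sum_range_succ, Finset.sum_range_succ,
        ih, Finset.sum_range_succ, show (2 * m + 1) / 2 = m by omega,
        show 2 * m / 2 = m by omega]
      ring
  rw [← h]
  exact Finset.sum_le_sum_of_subset_of_nonneg (Finset.range_mono (by omega))
    fun j _ _ => (hv _).le

/-- The halved weight `j ↦ v (j / 2) / 4 + v' (j / 2) / 4` is admissible. -/
theorem IsSeqAdmissible.half {v v' : ℕ → ℝ} (hv : IsSeqAdmissible w v)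
    (hv' : IsSeqAdmissible w v') : IsSeqAdmissible w (fun j => v (j / 2) / 4 + v' (j / 2) / 4) := by
  refine ⟨fun j => ?_, fun i j hij => ?_, fun n => ?_⟩
  · have h1 := hv.pos (j / 2)
    have h2 := hv'.pos (j / 2)
    positivity
  · have h1 := hv.anti (Nat.div_le_div_right (c := 2) hij)
    have h2 := hv'.anti (Nat.div_le_div_right (c := 2) hij)
    show _ ≤ v (i / 2) / 4 + v' (i / 2) / 4
    linarith
  · rw [Finset.sum_add_distrib, ← Finset.sum_div, ← Finset.sum_div]
    have h1 := (sum_half_le hv.pos n).trans (mul_le_mul_of_nonneg_left (hv.submaj n) zero_le_two)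
    have h2 := (sum_half_le hv'.pos n).trans (mul_le_mul_of_nonneg_left (hv'.submaj n) zero_le_two)
    linarith

theorem IsSeqWeight.isSeqAdmissible (hw : IsSeqWeight w) : IsSeqAdmissible w w :=
  ⟨hw.pos, hw.anti, fun _ => le_rfl⟩

theorem isFrame_count (hw : IsSeqWeight w) :
    IsFrame Measure.count (fun j : ℕ => (j : ℝ≥0∞)) (fun j => j / 2) univ
      {v | IsSeqAdmissible w v} where
  ae_mem := Eventually.of_forall fun _ => mem_univ _
  pos := fun _ hv j _ => hv.pos j
  meas := fun _ _ => (measurable_of_countable _).aemeasurable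
  measτ := measurable_of_countable _
  ne_top := ENNReal.natCast_ne_top
  -- the only set of measure less than `1` is empty
  small := Eventually.of_forall fun j => ⟨1, zero_lt_one, fun S hS => by
    have : S = ∅ := by
      by_contra hne
      obtain ⟨i, hi⟩ := nonempty_iff_ne_empty.2 hne
      have h1 : Measure.count {i} ≤ Measure.count S := measure_mono (singleton_subset_iff.2 hi)
      rw [Measure.count_singleton] at h1
      exact absurd hS (not_lt.2 h1)
    rw [this, measure_empty]
    exact zero_le⟩
  bdd := fun _ v hv => by
    refine ⟨v 0, hv.pos 0, ?_⟩
    have : {j | v j ≤ v 0} = univ := eq_univ_of_forall fun j => hv.anti j.zero_le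
    rw [this]
    exact Measure.count_apply_infinite infinite_univ
  half_mem := fun _ _ => mem_univ _
  half_level := fun j => by
    norm_cast
    omega
  half_lintegral := fun g => by
    rw [lintegral_count, lintegral_count, tsum_half]
  half_weight := fun v hv v' hv' => IsSeqAdmissible.half hv hv'
  low := by
    intro m hm _
    obtain ⟨N, hN⟩ := ENNReal.exists_nat_gt hm
    refine ⟨w, hw.isSeqAdmissible, w N, hw.pos N, Eventually.of_forall fun j hj => hw.anti ?_⟩
    exact_mod_cast (hj.trans hN).le
  fin := by
    intro m hm
    obtain ⟨N, hN⟩ := ENNReal.exists_nat_gt hm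
    refine (Measure.count_apply_lt_top.2 ((finite_Iio N).subset fun j hj => ?_)).ne
    have hj' : (j : ℝ≥0∞) < m := hj
    exact_mod_cast hj'.trans hN

theorem IsSeqAdmissible.lintegral_cell_le {v : ℕ → ℝ} (hv : IsSeqAdmissible w v)
    (hw : IsSeqWeight w) {c : ℝ} (hc : c ∈ natSet) :
    ∫⁻ j in cell idxPos 0 c, ENNReal.ofReal (v j) ∂Measure.count
      ≤ ∫⁻ j in cell idxPos 0 c, ENNReal.ofReal (w j) ∂Measure.count := by
  obtain ⟨n, rfl⟩ := hc
  rw [← Nat.cast_zero, lintegral_cell_idxPos, lintegral_cell_idxPos, Nat.Ico_zero_eq_range,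
    ← ENNReal.ofReal_sum_of_nonneg fun j _ => (hv.pos j).le,
    ← ENNReal.ofReal_sum_of_nonneg fun j _ => (hw.pos j).le]
  exact ENNReal.ofReal_le_ofReal (hv.submaj n)

theorem seqModQ_le_seqModP (hφ : IsOrlicz φ) (hw : IsSeqWeight w) (x : ℕ →ₘ[Measure.count] ℝ) :
    seqModQ φ w x ≤ seqModP φ w ((4 : ℝ) • x) := by
  refine le_iInf₂ fun v hv => ?_
  simp only [seqRearr_four_smul]
  rw [seqModQ, ← lintegral_count, ← lintegral_count]
  change _ ≤ ∫⁻ j, persp φ (4 * seqRearr x j) (v j) ∂Measure.count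
  by_cases hB : ∫⁻ j, persp φ (4 * seqRearr x j) (v j) ∂Measure.count = ∞
  · rw [hB]; exact le_top
  have hvm : AEMeasurable v Measure.count := (measurable_of_countable _).aemeasurable
  have hcell := fun c (hc : c ∈ natSet) => hv.lintegral_cell_le hw hc
  have hD : ∀ᵐ j ∂(Measure.count : Measure ℕ), j ∈ univ := Eventually.of_forall fun _ => mem_univ _
  have hfin : ∀ j, seqRearr x j ≠ ∞ := by
    intro j
    have h := lintegral_ne_top_of_persp hφ (measurable_of_countable (seqRearr x)).aemeasurable hvm
      hD (fun j _ => hv.pos j) hB (E := {j}) (by simp)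
    simpa using h
  have hS := isSystem_psum hw (seqRearr_antitone x) hfin
  have hco := isCoercive_of_weight hφ hS hvm (fun j _ => hv.pos j) hcell hB (exists_psumW_gt hw)
  exact lintegral_slope_le hφ hS hco hvm (fun j _ => hv.pos j) hcell fun μ hμ y hy =>
    Eventually.of_forall fun j hyj => ENNReal.div_le_of_le_mul
      (levelSeq_le ⟨hw, hfin⟩ hco hμ hy hyj)

theorem seqModP_le_seqModQ (hφ : IsOrlicz φ) (hw : IsSeqWeight w) (x : ℕ →ₘ[Measure.count] ℝ) :
    seqModP φ w x ≤ seqModQ φ w ((4 : ℝ) • x) := by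
  by_cases hQ : seqModQ φ w ((4 : ℝ) • x) = ∞
  · rw [hQ]; exact le_top
  set g := seqRearr ((4 : ℝ) • x) with hgdef
  have hg : Antitone g := seqRearr_antitone _
  have hr := seqRatio_ne_top hw hQ
  have hdata := isSeqLevelData_of_seqRatio_ne_top hw hr
  have hco := isCoercive_of_levelSeq hφ hdata hr hQ
  have hS := isSystem_psum hw hg hdata.fin
  obtain ⟨v, hv0, hva, hvc, hle⟩ := exists_weight hφ hS hco
    (h := fun j => levelSeq g w j / ENNReal.ofReal (w j)) fun μ hμ y hy =>
      Eventually.of_forall fun j hjy => by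
        rw [ENNReal.le_div_iff_mul_le (Or.inl (by simpa using hw.pos j))
          (Or.inl ENNReal.ofReal_ne_top)]
        exact le_levelSeq hdata hμ (half_lt_self hμ) (hco _ (half_pos hμ)) hy hjy
  have hadm : IsSeqAdmissible w v := by
    refine ⟨fun j => hv0 j (mem_univ _), fun i j hij => hva i (mem_univ _) j (mem_univ _) ?_,
      fun n => ?_⟩
    · unfold idxPos
      exact_mod_cast Nat.succ_le_succ hij
    · have := hvc n (natCast_mem_natSet n)
      rw [← Nat.cast_zero, lintegral_cell_idxPos, lintegral_cell_idxPos, Nat.Ico_zero_eq_range,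
        ← ENNReal.ofReal_sum_of_nonneg fun j _ => (hv0 j (mem_univ _)).le,
        ← ENNReal.ofReal_sum_of_nonneg fun j _ => (hw.pos j).le] at this
      exact (ENNReal.ofReal_le_ofReal_iff (Finset.sum_nonneg fun j _ => (hw.pos j).le)).1 this
  refine (iInf₂_le v hadm).trans (le_trans (le_of_eq ?_) (hle.trans (le_of_eq ?_)))
  · rw [← lintegral_count]
    refine lintegral_congr fun j => ?_
    have h4 : 4 * seqRearr x j / 4 = seqRearr x j := by
      rw [mul_comm, ENNReal.mul_div_cancel_right (by norm_num) (by norm_num)]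
    rw [hgdef, seqRearr_four_smul, h4]
    rfl
  · rw [seqModQ, ← lintegral_count]

theorem seqSpaceM_parts_eq (hφ : IsOrlicz φ) (hw : IsSeqWeight w) :
    orderContinuousPart (seqSpaceM φ w) (seqNormM φ w)
        = simpleClosure (seqSpaceM φ w) (seqNormM φ w) ∧
      simpleClosure (seqSpaceM φ w) (seqNormM φ w) = finiteElements (seqModP φ w) ∧
      finiteElements (seqModP φ w) = finiteElements (seqModQ φ w) := by
  have hF := isFrame_count hw
  have h4 := (finiteElements_subset (seqModQ_le_seqModP hφ hw)).antisymm
    (finiteElements_subset (seqModP_le_seqModQ hφ hw))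
  rw [seqSpaceM, seqNormM]
  rw [seqModP_eq_genMod] at h4 ⊢
  have h1 := finiteElements_subset_orderContinuousPart hφ hF
  have h2 := orderContinuousPart_subset_simpleClosure (ν := Measure.count)
    (τ := fun j : ℕ => (j : ℝ≥0∞)) (A := {v | IsSeqAdmissible w v}) hφ
  have h3 := simpleClosure_subset_finiteElements hφ hF
  exact ⟨h2.antisymm (h3.trans h1), h3.antisymm (h1.trans h2), h4⟩

end Sequences

end OrliczLorentz

theorem mainTheorem2 (φ : ℝ → ℝ) (hφ : OrliczLorentz.IsOrlicz φ) :
    (∀ (γ : ENNReal) (w : ℝ → ℝ), 0 < γ → OrliczLorentz.IsWeight γ w →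
      OrliczLorentz.orderContinuousPart (OrliczLorentz.spaceM φ γ w) (OrliczLorentz.normM φ γ w)
          = OrliczLorentz.simpleClosure (OrliczLorentz.spaceM φ γ w) (OrliczLorentz.normM φ γ w) ∧
      OrliczLorentz.simpleClosure (OrliczLorentz.spaceM φ γ w) (OrliczLorentz.normM φ γ w)
          = OrliczLorentz.finiteElements (OrliczLorentz.modP φ γ w) ∧
      OrliczLorentz.finiteElements (OrliczLorentz.modP φ γ w)
          = OrliczLorentz.finiteElements (OrliczLorentz.modQ φ γ w)) ∧
    (∀ w : ℕ → ℝ, OrliczLorentz.IsSeqWeight w →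
      OrliczLorentz.orderContinuousPart (OrliczLorentz.seqSpaceM φ w) (OrliczLorentz.seqNormM φ w)
          = OrliczLorentz.simpleClosure (OrliczLorentz.seqSpaceM φ w)
              (OrliczLorentz.seqNormM φ w) ∧
      OrliczLorentz.simpleClosure (OrliczLorentz.seqSpaceM φ w) (OrliczLorentz.seqNormM φ w)
          = OrliczLorentz.finiteElements (OrliczLorentz.seqModP φ w) ∧
      OrliczLorentz.finiteElements (OrliczLorentz.seqModP φ w)
          = OrliczLorentz.finiteElements (OrliczLorentz.seqModQ φ w)) := by
  exact ⟨fun _ _ hγ hw => OrliczLorentz.spaceM_parts_eq hφ hγ hw,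
    fun _ hw => OrliczLorentz.seqSpaceM_parts_eq hφ hw⟩
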